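/- Let $1\le p<\infty$; all spaces are real. A Banach lattice $X$ is *$p$-convex* if there is $M\ge 1$ with $\big\|(\sum_{k=1}^n|x_k|^p)^{1/p}\big\|\le M(\sum_{k=1}^n\|x_k\|^p)^{1/p}$ for all finite families $x_1,\dots,x_n\in X$; let $\mathcal C_p$ be the class of Banach lattices for which this holds with $M=1$. (1) Let $X$ be a $p$-convex Banach lattice and let $(x_n)$ be a disjoint sequence of positive elements of $X$ that is equivalent to the unit vector basis of $\ell^p$, i.e. there are $c,C>0$ with $c\,(\sum|a_n|^p)^{1/p}\le\|\sum a_nx_n\|\le C\,(\sum|a_n|^p)^{1/p}$ for all finitely supported scalar sequences $(a_n)$. Then the closed linear span $[(x_n)]$ is the range of a positive bounded linear projection on $X$. (2) $\ell^p$ is injective in the class $\mathcal C_p$: if $Z\in\mathcal C_p$, $Y$ is a closed linear sublattice of $Z$ and $T:Y\to\ell^p$ is a positive bounded linear operator, then $T$ has a positive linear extension $S:Z\to\ell^p$ with $\|S\|=\|T\|$. (3) For a Banach space $E$ let $\mathrm{FVL}[E]$ be the smallest vector lattice of functions on $E^*$ containing all $\delta_x$, $x\in E$, where $\delta_x(x^*)=x^*(x)$.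 The free $p$-convex Banach lattice $\mathrm{FBL}^{(p)}[E]$ is the completion of $\mathrm{FVL}[E]$ in the norm $$\rho(f)=\sup\{\|\widehat Tf\|_X:\ X\in\mathcal C_p,\ T:E\to X\text{ linear},\ \|T\|\le1\},$$ where $\widehat T:\mathrm{FVL}[E]\to X$ is the lattice homomorphism with $\widehat T\delta_x=Tx$ for all $x\in E$. Let $\iota:F\to E$ be an isometric linear embedding of Banach spaces and let $\bar\iota:\mathrm{FBL}^{(p)}[F]\to\mathrm{FBL}^{(p)}[E]$ be the continuous extension of $f\mapsto f\circ\iota^*$. For $c\ge1$ call $\bar\iota$ a *$c$-lattice embedding* if it is a lattice homomorphism and $c^{-1}\|f\|\le\|\bar\iota f\|\le\|f\|$ for all $f$. Then: (a) if $\bar\iota$ is a $c_1$-lattice embedding, $c_1\ge 1$, then every bounded linear operator $T:F\to\ell^p$ has the form $T=R\iota$ with a bounded linear operator $R:E\to\ell^p$ such that $\|R\|\le 2^{p-\frac1p}c_1\|T\|$; (b) if $c_2\ge 1$ and every bounded linear operator $T:F\to\ell^p$ has the form $T=R\iota$ with a bounded linear operator $R:E\to\ell^p$ such that $\|R\|\le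 c_2\|T\|$, then $\bar\iota$ is a $c_2$-lattice embedding. In particular, $\bar\iota$ is a lattice embedding if and only if operators $F\to\ell^p$ extend to $E$ with control of norms. -/

import Mathlib

open scoped ENNReal

universe u v w

namespace PConvexFree

noncomputable section

/-! ### Banach lattices -/

/-- Bundled real Banach lattices: complete normed spaces with a compatible vector lattice order
such that `|x| ≤ |y|` implies `‖x‖ ≤ ‖y‖`. -/
structure BanachLat : Type (u + 1) where
  carrier : Type u
  [normedAddCommGroup : NormedAddCommGroup carrier]
  [normedSpace : NormedSpace ℝ carrier]
  [completeSpace : CompleteSpace carrier]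
  [lattice : Lattice carrier]
  [isOrderedAddMonoid : IsOrderedAddMonoid carrier]
  [isOrderedModule : IsOrderedModule ℝ carrier]
  [hasSolidNorm : HasSolidNorm carrier]

instance : CoeSort BanachLat.{u} (Type u) := ⟨BanachLat.carrier⟩

attribute [instance] BanachLat.normedAddCommGroup BanachLat.normedSpace BanachLat.completeSpace
  BanachLat.lattice BanachLat.isOrderedAddMonoid BanachLat.isOrderedModule BanachLat.hasSolidNorm

/-- `s = (∑ |x k|^p)^(1/p)` in a vector lattice: `s` is the least upper bound of all the elements
`∑ a k • x k`, where `a` runs through the linear forms on `ℝⁿ` that are dominated by the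
`ℓ^p`-norm, that is, through the unit ball of the dual of `ℓ^p(n)`. -/
def IsLpSum {X : Type u} [AddCommGroup X] [Module ℝ X] [Lattice X] (p : ℝ≥0∞) {n : ℕ}
    (x : Fin n → X) (s : X) : Prop :=
  IsLUB {y : X | ∃ a : Fin n → ℝ,
    (∀ t : Fin n → ℝ, ∑ k, a k * t k ≤ ‖WithLp.toLp p t‖) ∧ y = ∑ k, a k • x k} s

/-- `‖(∑ |x k|^p)^(1/p)‖ ≤ M (∑ ‖x k‖^p)^(1/p)` for all finite families in `X`
(in a Banach lattice the element `(∑ |x k|^p)^(1/p)` always exists, and it is unique). -/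
def PConvexWith (p : ℝ≥0∞) (M : ℝ) (X : Type u) [NormedAddCommGroup X] [NormedSpace ℝ X]
    [Lattice X] : Prop :=
  ∀ (n : ℕ) (x : Fin n → X), ∃ s : X, IsLpSum p x s ∧
    ‖s‖ ≤ M * ‖WithLp.toLp p (fun k => ‖x k‖)‖

/-- `X` is `p`-convex. -/
def PConvex (p : ℝ≥0∞) (X : Type u) [NormedAddCommGroup X] [NormedSpace ℝ X]
    [Lattice X] : Prop :=
  ∃ M : ℝ, 1 ≤ M ∧ PConvexWith p M X

/-- `x` is a disjoint sequence of positive vectors. -/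
def IsPositiveDisjoint {X : Type u} [AddCommGroup X] [Lattice X] (x : ℕ → X) : Prop :=
  (∀ n, 0 ≤ x n) ∧ ∀ m n, m ≠ n → |x m| ⊓ |x n| = 0

/-- The sequence `x` is equivalent to the unit vector basis of `ℓ^p`. -/
def IsEquivLpBasis {X : Type u} [NormedAddCommGroup X] [NormedSpace ℝ X] (p : ℝ≥0∞)
    (x : ℕ → X) : Prop :=
  ∃ c C : ℝ, 0 < c ∧ 0 < C ∧ ∀ (n : ℕ) (a : Fin n → ℝ),
    c * ‖WithLp.toLp p a‖ ≤ ‖∑ k, a k • x k‖ ∧ ‖∑ k, a k • x k‖ ≤ C * ‖WithLp.toLp p a‖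

/-- Lattice homomorphisms (among linear maps). -/
def IsLatticeHom {X : Type u} {Y : Type v} [AddCommGroup X] [Module ℝ X] [Lattice X]
    [AddCommGroup Y] [Module ℝ Y] [Lattice Y] (T : X →ₗ[ℝ] Y) : Prop :=
  ∀ x y : X, T (x ⊔ y) = T x ⊔ T y ∧ T (x ⊓ y) = T x ⊓ T y

/-- `T` is a `C`-lattice embedding: a lattice homomorphism with
`C⁻¹ ‖x‖ ≤ ‖T x‖ ≤ ‖x‖` for all `x` (and `1 ≤ C`, so that `T` is injective). -/
def IsLatticeEmbedding {X : Type u} {Y : Type v} [NormedAddCommGroup X] [NormedSpace ℝ X]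
    [Lattice X] [NormedAddCommGroup Y] [NormedSpace ℝ Y] [Lattice Y] (C : ℝ) (T : X →L[ℝ] Y) :
    Prop :=
  1 ≤ C ∧ IsLatticeHom (T : X →ₗ[ℝ] Y) ∧ ∀ x : X, C⁻¹ * ‖x‖ ≤ ‖T x‖ ∧ ‖T x‖ ≤ ‖x‖

/-! ### The completion of a normed vector lattice is a Banach lattice -/

section Completion

open UniformSpace

set_option linter.unusedSectionVars false

variable {V : Type u} [NormedAddCommGroup V] [Lattice V] [HasSolidNorm V] [IsOrderedAddMonoid V]

theorem uc_sup : UniformContinuous₂ (fun a b : V => a ⊔ b) := by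
  rw [uniformContinuous₂_def]
  refine Metric.uniformContinuous_iff.2 fun ε hε => ⟨ε / 2, half_pos hε, ?_⟩
  rintro ⟨a, b⟩ ⟨c, d⟩ h
  have h1 : dist a c < ε / 2 := lt_of_le_of_lt (le_max_left _ _) h
  have h2 : dist b d < ε / 2 := lt_of_le_of_lt (le_max_right _ _) h
  have := norm_sup_sub_sup_le_add_norm a b c d
  simp only [Function.uncurry, dist_eq_norm] at *
  linarith

theorem uc_inf : UniformContinuous₂ (fun a b : V => a ⊓ b) := by
  rw [uniformContinuous₂_def]
  refine Metric.uniformContinuous_iff.2 fun ε hε => ⟨ε / 2, half_pos hε, ?_⟩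
  rintro ⟨a, b⟩ ⟨c, d⟩ h
  have h1 : dist a c < ε / 2 := lt_of_le_of_lt (le_max_left _ _) h
  have h2 : dist b d < ε / 2 := lt_of_le_of_lt (le_max_right _ _) h
  have := norm_inf_sub_inf_le_add_norm a b c d
  simp only [Function.uncurry, dist_eq_norm] at *
  linarith

/-- The lattice operations of `V`, extended by continuity. -/
instance : Max (Completion V) := ⟨Completion.map₂ fun a b : V => a ⊔ b⟩

instance : Min (Completion V) := ⟨Completion.map₂ fun a b : V => a ⊓ b⟩

theorem coe_sup (a b : V) : ((a ⊔ b : V) : Completion V) = (a : Completion V) ⊔ (b : Completion V) :=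
  (Completion.map₂_coe_coe a b _ uc_sup).symm

theorem coe_inf (a b : V) : ((a ⊓ b : V) : Completion V) = (a : Completion V) ⊓ (b : Completion V) :=
  (Completion.map₂_coe_coe a b _ uc_inf).symm

theorem cont_sup {α : Type v} [TopologicalSpace α] {f g : α → Completion V} (hf : Continuous f)
    (hg : Continuous g) : Continuous fun x => f x ⊔ g x :=
  Completion.continuous_map₂ hf hg

theorem cont_inf {α : Type v} [TopologicalSpace α] {f g : α → Completion V} (hf : Continuous f)
    (hg : Continuous g) : Continuous fun x => f x ⊓ g x :=
  Completion.continuous_map₂ hf hg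

instance : Lattice (Completion V) :=
  Lattice.mk'
    (fun a b => Completion.induction_on₂ a b
      (isClosed_eq (cont_sup continuous_fst continuous_snd) (cont_sup continuous_snd continuous_fst))
      fun a b => by rw [← coe_sup, ← coe_sup, sup_comm])
    (fun a b c => Completion.induction_on₃ a b c
      (isClosed_eq
        (cont_sup (cont_sup continuous_fst (continuous_fst.comp continuous_snd))
          (continuous_snd.comp continuous_snd))
        (cont_sup continuous_fst (cont_sup (continuous_fst.comp continuous_snd)
          (continuous_snd.comp continuous_snd))))
      fun a b c => by simp only [← coe_sup, sup_assoc])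
    (fun a b => Completion.induction_on₂ a b
      (isClosed_eq (cont_inf continuous_fst continuous_snd) (cont_inf continuous_snd continuous_fst))
      fun a b => by rw [← coe_inf, ← coe_inf, inf_comm])
    (fun a b c => Completion.induction_on₃ a b c
      (isClosed_eq
        (cont_inf (cont_inf continuous_fst (continuous_fst.comp continuous_snd))
          (continuous_snd.comp continuous_snd))
        (cont_inf continuous_fst (cont_inf (continuous_fst.comp continuous_snd)
          (continuous_snd.comp continuous_snd))))
      fun a b c => by simp only [← coe_inf, inf_assoc])
    (fun a b => Completion.induction_on₂ a b
      (isClosed_eq (cont_sup continuous_fst (cont_inf continuous_fst continuous_snd)) continuous_fst)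
      fun a b => by rw [← coe_inf, ← coe_sup, sup_inf_self])
    (fun a b => Completion.induction_on₂ a b
      (isClosed_eq (cont_inf continuous_fst (cont_sup continuous_fst continuous_snd)) continuous_fst)
      fun a b => by rw [← coe_sup, ← coe_inf, inf_sup_self])

instance : IsOrderedAddMonoid (Completion V) where
  add_le_add_left a b h c := by
    have key : ∀ a b c : Completion V, (a + c) ⊔ (b + c) = (a ⊔ b) + c := fun a b c =>
      Completion.induction_on₃ a b c
        (isClosed_eq
          (cont_sup (continuous_fst.add (continuous_snd.comp continuous_snd))
            ((continuous_fst.comp continuous_snd).add (continuous_snd.comp continuous_snd)))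
          ((cont_sup continuous_fst (continuous_fst.comp continuous_snd)).add
            (continuous_snd.comp continuous_snd)))
        fun a b c => by simp only [← Completion.coe_add, ← coe_sup, sup_add]
    rw [← sup_eq_right, key, sup_eq_right.2 h]

theorem coe_abs (a : V) : ((|a| : V) : Completion V) = |(a : Completion V)| := by
  simp only [abs, coe_sup, Completion.coe_neg]

theorem cont_abs : Continuous fun x : Completion V => |x| :=
  cont_sup continuous_id continuous_neg

instance : HasSolidNorm (Completion V) where
  solid x y h := by
    have h1 : ∀ a : Completion V, ‖|a|‖ = ‖a‖ := fun a =>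
      Completion.induction_on a (isClosed_eq cont_abs.norm continuous_norm)
        fun a => by rw [← coe_abs, Completion.norm_coe, Completion.norm_coe, norm_abs_eq_norm]
    have h2 : ∀ a b : Completion V, ‖|a| ⊓ |b|‖ ≤ ‖b‖ := fun a b =>
      Completion.induction_on₂ a b
        (isClosed_le (cont_inf (cont_abs.comp continuous_fst) (cont_abs.comp continuous_snd)).norm
          continuous_snd.norm)
        fun a b => by
          rw [← coe_abs, ← coe_abs, ← coe_inf, Completion.norm_coe, Completion.norm_coe]
          refine HasSolidNorm.solid ?_
          rw [abs_of_nonneg (le_inf (abs_nonneg a) (abs_nonneg b))]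
          exact inf_le_right
    calc ‖x‖ = ‖|x| ⊓ |y|‖ := by rw [inf_eq_left.2 h, h1]
      _ ≤ ‖y‖ := h2 x y

theorem smul_sup' {W : Type u} [AddCommGroup W] [Module ℝ W] [Lattice W] [IsOrderedModule ℝ W]
    {a : ℝ} (ha : 0 ≤ a) (x y : W) : a • (x ⊔ y) = a • x ⊔ a • y := by
  rcases ha.eq_or_lt with rfl | ha
  · simp
  · exact (OrderIso.smulRight ha).map_sup x y

instance [NormedSpace ℝ V] [IsOrderedModule ℝ V] : IsOrderedModule ℝ (Completion V) :=
  have key : ∀ a : ℝ, 0 ≤ a → ∀ x y : Completion V, a • (x ⊔ y) = a • x ⊔ a • y :=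
    fun a ha x y => Completion.induction_on₂ x y
      (isClosed_eq ((cont_sup continuous_fst continuous_snd).const_smul a)
        (cont_sup (continuous_fst.const_smul a) (continuous_snd.const_smul a)))
      fun x y => by
        rw [← coe_sup, ← Completion.coe_smul, ← Completion.coe_smul, ← Completion.coe_smul,
          ← coe_sup, smul_sup' ha]
  have hs : ∀ a : ℝ, 0 ≤ a → ∀ x y : Completion V, x ≤ y → a • x ≤ a • y := fun a ha x y h => by
    rw [← sup_eq_right, ← key a ha, sup_eq_right.2 h]
  { smul_le_smul_of_nonneg_left := fun a ha x y h => hs a ha x y h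
    smul_le_smul_of_nonneg_right := fun x hx a b h => by
      have := hs (b - a) (sub_nonneg.2 h) 0 x hx
      rwa [smul_zero, sub_smul, sub_nonneg] at this }

end Completion

/-! ### The free vector lattice over a Banach space -/

section Free

variable (E : Type u) [NormedAddCommGroup E] [NormedSpace ℝ E]

/-- The free vector lattice over `E`: the smallest vector sublattice of the functions on the dual
of `E` that contains the evaluations `δ x = (ℓ ↦ ℓ x)`. -/
def fvl : Submodule ℝ (StrongDual ℝ E → ℝ) :=
  sInf {V | (∀ x : E, (fun ℓ : StrongDual ℝ E => ℓ x) ∈ V) ∧ ∀ f ∈ V, |f| ∈ V}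

variable {E} in
theorem fvl_le {V : Submodule ℝ (StrongDual ℝ E → ℝ)}
    (h1 : ∀ x : E, (fun ℓ : StrongDual ℝ E => ℓ x) ∈ V) (h2 : ∀ f ∈ V, |f| ∈ V) : fvl E ≤ V :=
  sInf_le ⟨h1, h2⟩

theorem delta_mem (x : E) : (fun ℓ : StrongDual ℝ E => ℓ x) ∈ fvl E :=
  Submodule.mem_sInf.2 fun _ hV => hV.1 x

variable {E} in
theorem abs_mem {f : StrongDual ℝ E → ℝ} (hf : f ∈ fvl E) : |f| ∈ fvl E :=
  Submodule.mem_sInf.2 fun _ hV => hV.2 f (Submodule.mem_sInf.1 hf _ hV)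

variable {E} in
theorem sup_mem {f g : StrongDual ℝ E → ℝ} (hf : f ∈ fvl E) (hg : g ∈ fvl E) :
    f ⊔ g ∈ fvl E := by
  rw [sup_eq_half_smul_add_add_abs_sub' ℝ]
  exact Submodule.smul_mem _ _ (add_mem (add_mem hf hg) (abs_mem (sub_mem hg hf)))

variable {E} in
theorem inf_mem {f g : StrongDual ℝ E → ℝ} (hf : f ∈ fvl E) (hg : g ∈ fvl E) :
    f ⊓ g ∈ fvl E := by
  rw [inf_eq_half_smul_add_sub_abs_sub' ℝ]
  exact Submodule.smul_mem _ _ (sub_mem (add_mem hf hg) (abs_mem (sub_mem hg hf)))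

/-- `FVL[E]` as a vector lattice, with the pointwise operations. The parameter `p` only selects the
norm that is put on it below. -/
def FVL (_p : ℝ≥0∞) (E : Type u) [NormedAddCommGroup E] [NormedSpace ℝ E] : Type u := fvl E

variable (p : ℝ≥0∞)

instance : AddCommGroup (FVL p E) := inferInstanceAs (AddCommGroup (fvl E))

instance : Module ℝ (FVL p E) := inferInstanceAs (Module ℝ (fvl E))

instance : Lattice (FVL p E) :=
  Subtype.lattice (fun _ _ hf hg => sup_mem hf hg) (fun _ _ hf hg => inf_mem hf hg)

instance : IsOrderedAddMonoid (FVL p E) where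
  add_le_add_left _ _ h k := fun ℓ => add_le_add_left (h ℓ) (k.1 ℓ)

instance : IsOrderedModule ℝ (FVL p E) where
  smul_le_smul_of_nonneg_left := fun _ ha _ _ h ℓ => mul_le_mul_of_nonneg_left (h ℓ) ha
  smul_le_smul_of_nonneg_right := fun _ hf _ _ h ℓ => mul_le_mul_of_nonneg_right h (hf ℓ)

variable {E}

/-- The canonical map `δ : E → FVL[E]`. -/
def delta (x : E) : FVL p E := ⟨fun ℓ => ℓ x, delta_mem E x⟩

variable {p}

/-- `S : FVL[E] → X` is the lattice homomorphic extension of a linear contraction `T : E → X` into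
a Banach lattice `X` with `p`-convexity constant one. -/
def IsContractiveExtension {X : BanachLat.{u}} (S : FVL p E →ₗ[ℝ] X) : Prop :=
  PConvexWith p 1 X ∧ IsLatticeHom S ∧
    ∃ T : E →L[ℝ] X, ‖T‖ ≤ 1 ∧ ∀ x : E, S (delta p x) = T x

/-- The values `‖S f‖` over all lattice homomorphic extensions `S` of linear contractions from `E`
into Banach lattices with `p`-convexity constant one. -/
def rhoSet (f : FVL p E) : Set ℝ :=
  {r | ∃ (X : BanachLat.{u}) (S : FVL p E →ₗ[ℝ] X), IsContractiveExtension S ∧ r = ‖S f‖}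

/-- The free `p`-convex norm of `f`. -/
def rho (f : FVL p E) : ℝ := sSup (rhoSet f)

theorem IsLatticeHom.map_abs {X : Type u} {Y : Type v} [AddCommGroup X] [Module ℝ X] [Lattice X]
    [AddCommGroup Y] [Module ℝ Y] [Lattice Y] {T : X →ₗ[ℝ] Y} (hT : IsLatticeHom T) (x : X) :
    T |x| = |T x| := by
  simp only [abs, (hT _ _).1, map_neg]

theorem rhoSet_bddAbove (f : FVL p E) : BddAbove (rhoSet f) := by
  let B : FVL p E → Prop := fun g => ∃ C : ℝ, ∀ (X : BanachLat.{u}) (S : FVL p E →ₗ[ℝ] X),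
    IsContractiveExtension S → ‖S g‖ ≤ C
  let V : Submodule ℝ (StrongDual ℝ E → ℝ) :=
    { carrier := {g | ∃ h : g ∈ fvl E, B ⟨g, h⟩}
      add_mem' := by
        rintro g k ⟨hg, C, hC⟩ ⟨hk, D, hD⟩
        refine ⟨add_mem hg hk, C + D, fun X S hS => ?_⟩
        have : S ⟨g + k, add_mem hg hk⟩ = S ⟨g, hg⟩ + S ⟨k, hk⟩ := map_add S ⟨g, hg⟩ ⟨k, hk⟩
        rw [this]
        exact (norm_add_le _ _).trans (add_le_add (hC X S hS) (hD X S hS))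
      zero_mem' := ⟨zero_mem _, 0, fun X S _ => by
        have : S ⟨0, zero_mem _⟩ = 0 := map_zero S
        rw [this, norm_zero]⟩
      smul_mem' := by
        rintro c g ⟨hg, C, hC⟩
        refine ⟨Submodule.smul_mem _ c hg, |c| * C, fun X S hS => ?_⟩
        have : S ⟨c • g, Submodule.smul_mem _ c hg⟩ = c • S ⟨g, hg⟩ := map_smul S c ⟨g, hg⟩
        rw [this, norm_smul]
        exact mul_le_mul_of_nonneg_left (hC X S hS) (abs_nonneg c) }
  have hV : fvl E ≤ V := by
    refine fvl_le (fun x => ⟨delta_mem E x, ‖x‖, ?_⟩) ?_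
    · rintro X S ⟨-, -, T, hT, hST⟩
      have : S ⟨fun ℓ : StrongDual ℝ E => ℓ x, delta_mem E x⟩ = T x := hST x
      rw [this]
      simpa using T.le_of_opNorm_le hT x
    · rintro g ⟨hg, C, hC⟩
      refine ⟨abs_mem hg, C, fun X S hS => ?_⟩
      have : S ⟨|g|, abs_mem hg⟩ = |S ⟨g, hg⟩| := hS.2.1.map_abs ⟨g, hg⟩
      rw [this, norm_abs_eq_norm]
      exact hC X S hS
  obtain ⟨_, C, hC⟩ := hV f.2
  exact ⟨C, by rintro r ⟨X, S, hS, rfl⟩; exact hC X S hS⟩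

theorem le_rho (f : FVL p E) {X : BanachLat.{u}} {S : FVL p E →ₗ[ℝ] X}
    (hS : IsContractiveExtension S) : ‖S f‖ ≤ rho f :=
  le_csSup (rhoSet_bddAbove f) ⟨X, S, hS, rfl⟩

theorem rho_nonneg (f : FVL p E) : 0 ≤ rho f :=
  Real.sSup_nonneg (by rintro r ⟨X, S, -, rfl⟩; exact norm_nonneg _)

theorem rho_le {f : FVL p E} {C : ℝ} (hC : 0 ≤ C) (h : ∀ (X : BanachLat.{u})
    (S : FVL p E →ₗ[ℝ] X), IsContractiveExtension S → ‖S f‖ ≤ C) : rho f ≤ C :=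
  Real.sSup_le (by rintro r ⟨X, S, hS, rfl⟩; exact h X S hS) hC

instance : IsOrderedModule ℝ (BoundedContinuousFunction PUnit.{u + 1} ℝ) where
  smul_le_smul_of_nonneg_left := fun _ ha _ _ h t => mul_le_mul_of_nonneg_left (h t) ha
  smul_le_smul_of_nonneg_right := fun _ hf _ _ h t => mul_le_mul_of_nonneg_right h (hf t)

/-- The real line, as a Banach lattice in an arbitrary universe. -/
def realLat : BanachLat.{u} where
  carrier := BoundedContinuousFunction PUnit.{u + 1} ℝ

theorem realLat_norm (f : BoundedContinuousFunction PUnit.{u + 1} ℝ) :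
    ‖f‖ = |f PUnit.unit| :=
  le_antisymm ((BoundedContinuousFunction.norm_le (abs_nonneg _)).2 fun _ => le_rfl)
    (f.norm_coe_le_norm PUnit.unit)

theorem norm_toLp_abs [Fact (1 ≤ p)] {n : ℕ} (t : Fin n → ℝ) :
    ‖WithLp.toLp p (fun k => |t k|)‖ = ‖WithLp.toLp p t‖ := by
  rcases eq_or_ne p ∞ with rfl | hp
  · simp [PiLp.norm_eq_ciSup]
  · have h0 : 0 < p.toReal := ENNReal.toReal_pos
      (zero_lt_one.trans_le (Fact.out : 1 ≤ p)).ne' hp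
    simp [PiLp.norm_eq_sum h0]

theorem realLat_pConvex [Fact (1 ≤ p)] : PConvexWith p 1 realLat.{u} := by
  intro n (x : Fin n → BoundedContinuousFunction PUnit.{u + 1} ℝ)
  refine ⟨BoundedContinuousFunction.const _ ‖WithLp.toLp p (fun k => x k PUnit.unit)‖,
    ⟨?_, ?_⟩, ?_⟩
  · rintro _ ⟨a, ha, rfl⟩ t
    have h1 := ha (fun k => x k PUnit.unit)
    have h2 : (∑ k, a k • x k) t = ∑ k, a k * x k PUnit.unit := by
      simp [BoundedContinuousFunction.coe_sum]
    exact h2.le.trans h1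
  · intro b hb t
    obtain ⟨g, hg, hgx⟩ := exists_dual_vector'' ℝ
      (WithLp.toLp p (fun k => x k PUnit.unit) : PiLp p fun _ : Fin n => ℝ)
    have hsum : ∀ t : Fin n → ℝ,
        ∑ k, g (WithLp.toLp p (Pi.single k 1)) * t k = g (WithLp.toLp p t) := by
      intro t
      have : (WithLp.toLp p t : PiLp p fun _ : Fin n => ℝ) =
          ∑ k, t k • WithLp.toLp p (Pi.single k (1 : ℝ)) := by
        ext j
        simp [Finset.sum_apply, Pi.single_apply]
      rw [this, map_sum]
      simp [mul_comm]
    have h1 := hb ⟨fun k => g (WithLp.toLp p (Pi.single k 1)), fun t => by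
      rw [hsum]
      exact (le_abs_self _).trans (by simpa using g.le_of_opNorm_le hg (WithLp.toLp p t)), rfl⟩ t
    have h2 : (∑ k, g (WithLp.toLp p (Pi.single k 1)) • x k) t =
        ‖WithLp.toLp p (fun k => x k PUnit.unit)‖ := by
      have := hsum (fun k => x k PUnit.unit)
      rw [hgx] at this
      simpa [BoundedContinuousFunction.coe_sum] using this
    exact h2.ge.trans h1
  · have h : (fun k => ‖x k‖) = fun k => |x k PUnit.unit| := funext fun k => realLat_norm _
    refine ((realLat_norm _).le.trans ?_)
    change |‖WithLp.toLp p (fun k => x k PUnit.unit)‖| ≤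
      1 * ‖WithLp.toLp p (fun k => ‖x k‖)‖
    rw [h, norm_toLp_abs, abs_norm, one_mul]

/-- Evaluation at a point of the dual of `E`. -/
def evalHom (p : ℝ≥0∞) (ℓ : StrongDual ℝ E) : FVL p E →ₗ[ℝ] realLat.{u} where
  toFun f := BoundedContinuousFunction.const _ (f.1 ℓ)
  map_add' _ _ := rfl
  map_smul' _ _ := rfl

theorem evalHom_isContractiveExtension [Fact (1 ≤ p)] {ℓ : StrongDual ℝ E} (hℓ : ‖ℓ‖ ≤ 1) :
    IsContractiveExtension (evalHom p ℓ) := by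
  refine ⟨realLat_pConvex, fun f g => ⟨rfl, rfl⟩, ?_⟩
  let T : E →ₗ[ℝ] realLat.{u} :=
    { toFun := fun x => BoundedContinuousFunction.const _ (ℓ x)
      map_add' := fun x y => by rw [map_add]; rfl
      map_smul' := fun c x => by rw [map_smul]; rfl }
  refine ⟨T.mkContinuous 1 fun x => ?_, T.mkContinuous_norm_le zero_le_one _, fun x => rfl⟩
  refine (realLat_norm _).le.trans ?_
  exact ℓ.le_of_opNorm_le hℓ x

theorem fvl_homogeneous {f : StrongDual ℝ E → ℝ} (hf : f ∈ fvl E) {r : ℝ} (hr : 0 ≤ r)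
    (ℓ : StrongDual ℝ E) : f (r • ℓ) = r * f ℓ := by
  let V : Submodule ℝ (StrongDual ℝ E → ℝ) :=
    { carrier := {g | g (r • ℓ) = r * g ℓ}
      add_mem' := fun {g k} hg hk => by
        simp only [Set.mem_ofPred_eq, Pi.add_apply] at *
        rw [hg, hk, mul_add]
      zero_mem' := by simp
      smul_mem' := fun c g hg => by
        simp only [Set.mem_ofPred_eq, Pi.smul_apply, smul_eq_mul] at *
        rw [hg]; ring }
  have : fvl E ≤ V := fvl_le (fun x => by simp [V]) fun g hg => by
    change |g (r • ℓ)| = r * |g ℓ|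
    rw [show g (r • ℓ) = r * g ℓ from hg, abs_mul, abs_of_nonneg hr]
  exact this hf

theorem rho_core [Fact (1 ≤ p)] : letI : Norm (FVL p E) := ⟨rho⟩
    NormedSpace.Core ℝ (FVL p E) := by
  let : Norm (FVL p E) := ⟨rho⟩
  have hs : ∀ (c : ℝ) (f : FVL p E), rho (c • f) ≤ |c| * rho f := fun c f =>
    rho_le (mul_nonneg (abs_nonneg c) (rho_nonneg f)) fun X S hS => by
      rw [map_smul, norm_smul]
      exact mul_le_mul_of_nonneg_left (le_rho f hS) (abs_nonneg c)
  refine { norm_nonneg := rho_nonneg, norm_smul := ?_, norm_triangle := ?_,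
           norm_eq_zero_iff := ?_ }
  · intro c f
    refine le_antisymm (hs c f) ?_
    rcases eq_or_ne c 0 with rfl | hc
    · simpa using rho_nonneg ((0 : ℝ) • f)
    · have h := hs c⁻¹ (c • f)
      rw [inv_smul_smul₀ hc, abs_inv] at h
      have hc' : 0 < |c| := abs_pos.2 hc
      have h2 := mul_le_mul_of_nonneg_left h hc'.le
      rw [mul_inv_cancel_left₀ hc'.ne'] at h2
      exact h2
  · intro f g
    refine rho_le (add_nonneg (rho_nonneg f) (rho_nonneg g)) fun X S hS => ?_
    rw [map_add]
    exact (norm_add_le _ _).trans (add_le_add (le_rho f hS) (le_rho g hS))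
  · intro f
    constructor
    · intro hf
      have h1 : ∀ ℓ : StrongDual ℝ E, ‖ℓ‖ ≤ 1 → f.1 ℓ = 0 := fun ℓ hℓ => by
        have h := le_rho f (evalHom_isContractiveExtension (p := p) hℓ)
        rw [show rho f = 0 from hf] at h
        have h' : |f.1 ℓ| ≤ 0 := (realLat_norm _).ge.trans h
        simpa using h'
      refine Subtype.ext (funext fun ℓ => ?_)
      have hpos : 0 < ‖ℓ‖ + 1 := by positivity
      have h2 : ‖(‖ℓ‖ + 1)⁻¹ • ℓ‖ ≤ 1 := by
        rw [norm_smul, norm_inv, Real.norm_of_nonneg hpos.le, inv_mul_le_iff₀ hpos]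
        linarith
      have h3 := h1 _ h2
      rw [fvl_homogeneous f.2 (inv_nonneg.2 hpos.le)] at h3
      exact (mul_eq_zero.1 h3).resolve_left (inv_ne_zero hpos.ne')
    · rintro rfl
      refine le_antisymm (rho_le le_rfl fun X S _ => ?_) (rho_nonneg _)
      rw [map_zero, norm_zero]

instance [Fact (1 ≤ p)] : NormedAddCommGroup (FVL p E) :=
  letI : Norm (FVL p E) := ⟨rho⟩
  NormedAddCommGroup.ofCore (𝕜 := ℝ) rho_core

instance [Fact (1 ≤ p)] : NormedSpace ℝ (FVL p E) :=
  letI : Norm (FVL p E) := ⟨rho⟩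
  NormedSpace.ofCore (rho_core (p := p) (E := E))

theorem norm_def [Fact (1 ≤ p)] (f : FVL p E) : ‖f‖ = rho f := rfl

instance [Fact (1 ≤ p)] : HasSolidNorm (FVL p E) where
  solid f g h := rho_le (rho_nonneg g) fun X S hS => by
    refine le_trans (HasSolidNorm.solid ?_) (le_rho g hS)
    rw [← hS.2.1.map_abs, ← hS.2.1.map_abs, ← sup_eq_right, ← (hS.2.1 _ _).1, sup_eq_right.2 h]

/-! ### The free `p`-convex Banach lattice and its functoriality -/

/-- `FBL^(p)[E]`: the completion of `FVL[E]` in the free `p`-convex norm. -/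
abbrev FBL (p : ℝ≥0∞) [Fact (1 ≤ p)] (E : Type u) [NormedAddCommGroup E] [NormedSpace ℝ E] :
    Type u :=
  UniformSpace.Completion (FVL p E)

variable {F : Type u} [NormedAddCommGroup F] [NormedSpace ℝ F]

theorem comp_mem (ι : F →ₗᵢ[ℝ] E) {f : StrongDual ℝ F → ℝ} (hf : f ∈ fvl F) :
    (fun ℓ : StrongDual ℝ E => f (ℓ.comp ι.toContinuousLinearMap)) ∈ fvl E := by
  let Q : (StrongDual ℝ F → ℝ) →ₗ[ℝ] (StrongDual ℝ E → ℝ) :=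
    { toFun := fun f ℓ => f (ℓ.comp ι.toContinuousLinearMap)
      map_add' := fun _ _ => rfl
      map_smul' := fun _ _ => rfl }
  have : fvl F ≤ (fvl E).comap Q := fvl_le (fun y => delta_mem E (ι y)) fun g hg => abs_mem hg
  exact this hf

/-- The lattice homomorphism `FVL[F] → FVL[E]`, `f ↦ f ∘ ι^*`; it sends `δ y` to `δ (ι y)`. -/
def mapFVL (p : ℝ≥0∞) (ι : F →ₗᵢ[ℝ] E) : FVL p F →ₗ[ℝ] FVL p E where
  toFun f := ⟨fun ℓ => f.1 (ℓ.comp ι.toContinuousLinearMap), comp_mem ι f.2⟩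
  map_add' _ _ := rfl
  map_smul' _ _ := rfl

theorem rho_mapFVL_le (ι : F →ₗᵢ[ℝ] E) (f : FVL p F) : rho (mapFVL p ι f) ≤ rho f := by
  refine rho_le (rho_nonneg f) fun X S hS => ?_
  obtain ⟨hX, hlat, T, hT, hST⟩ := hS
  refine le_rho f (S := S.comp (mapFVL p ι)) ⟨hX, fun g h => hlat (mapFVL p ι g) (mapFVL p ι h), ?_⟩
  refine ⟨T.comp ι.toContinuousLinearMap, ?_, fun y => hST (ι y)⟩
  refine ContinuousLinearMap.opNorm_le_bound _ zero_le_one fun y => ?_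
  have := T.le_of_opNorm_le hT (ι y)
  rwa [ι.norm_map] at this

/-- The map `ι̅ : FBL^(p)[F] → FBL^(p)[E]` induced by an isometric embedding `ι : F → E`: the
continuous extension of `f ↦ f ∘ ι^*`. -/
def mapFBL (p : ℝ≥0∞) [Fact (1 ≤ p)] (ι : F →ₗᵢ[ℝ] E) : FBL p F →L[ℝ] FBL p E :=
  ((mapFVL p ι).mkContinuous 1 fun f => by
    rw [one_mul]; exact rho_mapFVL_le ι f).completion

end Free

end

end PConvexFree

/-!
Everything rests on the extension theorem `PConvexWith.exists_extension`: positive operators into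
`ℓ^p` that are defined on a closed vector sublattice `Y` of a `p`-convex Banach lattice `Z` extend
to positive operators on `Z`, with the `p`-convexity constant as the only loss of norm.

By a Hahn-Banach argument with values in `ℓ^p`, such an extension of `T = (T n)` exists as soon as
`∑ T n (y n) ≤ ‖T‖ M ∑ ‖z j‖` whenever `y n ≤ ∑ b j n • z j` with `y n ∈ Y`, `z j ≥ 0` and with
nonnegative `b j` in the unit ball of the dual of `ℓ^p`; this is `PConvexWith.sum_map_le`. Only
finitely many vectors occur, and all of them may be taken from a principal order ideal with
generator in `Y`. By Kakutani's theorem (`exists_continuousMap_representation`) this ideal is a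
space `C(K)`, in which `Y` becomes a closed sublattice `L` containing the constants. On the
positive cone of `C(K)`, regarded as the `p`-concavification of the ideal, `p`-convexity makes
`‖g‖ ^ p` equivalent, with factor `M ^ p`, to a sublinear function of `g ^ p`, while `h ↦ ‖T h‖ ^ p` is
a superadditive function of `h ^ p` on `L`. Hence there is a positive functional `μ` between the
two (`exists_factorizing_functional`): `T` factors through `L^p(μ)`. If the `z j` were in `L`, the
inequality would be immediate from the positivity of `T` and duality. In general they are replaced
by their averages with respect to `μ` over the members of a fine partition of unity in `L`, which
by Jensen's inequality does not increase their `L^p(μ)`-norms and changes the hypothesis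
`y n ≤ ∑ b j n • z j` only slightly.

The rest follows from this theorem.

* A disjoint sequence equivalent to the basis of `ℓ^p` spans a closed sublattice that is lattice
  isomorphic to `ℓ^p`, and the extension of the isomorphism, followed by its inverse, is a positive
  projection.
* The completion `FBL^(p)[E]` is itself `p`-convex with constant one (`fbl_pConvex`). An operator
  `T : F → ℓ^p` induces a lattice homomorphism on `FBL^(p)[F]`. When `FBL^(p)[F]` embeds into
  `FBL^(p)[E]`, this homomorphism, moved to the range of the embedding, extends to a positive
  operator on `FBL^(p)[E]`, and the extension composed with `δ` extends `T`. This even gives the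
  constant `c`, without the factor `2 ^ (p - 1 / p)`.
* Conversely, the free `p`-convex norm is determined by operators into `ℓ^p`
  (`exists_operator_norm_le`): in a representation of a principal ideal of `X` as `C(K)`, the
  averages over a fine partition of unity with respect to a norming functional extend to a
  contraction `X → ℓ^p`, and this contraction almost preserves the norm of a given `S f`, because
  the lattice expression `f` is Lipschitz in its variables. Extending these operators from `F` to
  `E` compares the norms.
-/

set_option linter.unusedSectionVars false

namespace PConvexFree

/-! ### Lattice homomorphisms on vector lattices with an order unit -/

section LatticeSublinear

variable {V : Type u} [AddCommGroup V] [Module ℝ V] [Lattice V]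

/-- Sublinear functionals that preserve finite suprema. The minimal ones are the real-valued lattice
homomorphisms. -/
structure IsLatticeSublinear (q : V → ℝ) : Prop where
  add_le : ∀ x y, q (x + y) ≤ q x + q y
  smul_le : ∀ s : ℝ, 0 < s → ∀ x, q (s • x) ≤ s * q x
  map_sup : ∀ x y, q (x ⊔ y) = max (q x) (q y)

theorem IsLatticeSublinear.map_zero {q : V → ℝ} (hq : IsLatticeSublinear q) : q 0 = 0 := by
  have h1 := hq.smul_le 2 (by norm_num) 0
  have h2 := hq.smul_le 2⁻¹ (by norm_num) 0
  rw [smul_zero] at h1 h2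
  linarith

theorem IsLatticeSublinear.neg_le {q : V → ℝ} (hq : IsLatticeSublinear q) (x : V) :
    -q (-x) ≤ q x := by
  have h := hq.add_le x (-x)
  rw [add_neg_cancel, hq.map_zero] at h
  linarith

/-- The infimum of a downward directed family of functionals that preserve suprema preserves
suprema. -/
theorem isLatticeSublinear_iInf {ι : Type v} [Nonempty ι] {k : ι → V → ℝ}
    (hb : ∀ x, BddBelow (Set.range fun i => k i x))
    (hdir : ∀ i j, ∃ l, ∀ x, k l x ≤ k i x ∧ k l x ≤ k j x)
    (hadd : ∀ i j, ∃ l, ∀ x y, k l (x + y) ≤ k i x + k j y)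
    (hsmul : ∀ s : ℝ, 0 < s → ∀ i, ∃ l, ∀ x, k l (s • x) ≤ s * k i x)
    (hsup : ∀ i x y, k i (x ⊔ y) = max (k i x) (k i y)) :
    IsLatticeSublinear fun x => ⨅ i, k i x where
  add_le x y := by
    refine le_ciInf_add_ciInf fun i j => ?_
    obtain ⟨l, hl⟩ := hadd i j
    exact (ciInf_le (hb _) l).trans (hl x y)
  smul_le s hs x := by
    rw [Real.mul_iInf_of_nonneg hs.le]
    refine le_ciInf fun i => ?_
    obtain ⟨l, hl⟩ := hsmul s hs i
    exact (ciInf_le (hb _) l).trans (hl x)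
  map_sup x y := by
    apply le_antisymm
    · refine le_of_forall_gt fun t ht => ?_
      obtain ⟨i, hi⟩ := exists_lt_of_ciInf_lt ((le_max_left _ _).trans_lt ht)
      obtain ⟨j, hj⟩ := exists_lt_of_ciInf_lt ((le_max_right _ _).trans_lt ht)
      obtain ⟨l, hl⟩ := hdir i j
      refine (ciInf_le (hb _) l).trans_lt ?_
      rw [hsup]
      exact max_lt ((hl x).1.trans_lt hi) ((hl y).2.trans_lt hj)
    · refine max_le ?_ ?_ <;> refine le_ciInf fun i => (ciInf_le (hb _) i).trans ?_ <;> rw [hsup]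
      · exact le_max_left _ _
      · exact le_max_right _ _

/-- The modification of `q` in the direction `y` that is used to show that minimal functionals are
linear. -/
noncomputable def directional (q : V → ℝ) (y x : V) : ℝ :=
  ⨅ t : {t : ℝ // 0 ≤ t}, (q (x + t.1 • y) - t.1 * q y)

section

variable {q : V → ℝ} (hq : IsLatticeSublinear q)
include hq

theorem IsLatticeSublinear.smul_le' {s : ℝ} (hs : 0 ≤ s) (x : V) : q (s • x) ≤ s * q x := by
  rcases hs.eq_or_lt with rfl | hs
  · simp [hq.map_zero]
  · exact hq.smul_le s hs x

theorem directional_bddBelow (y x : V) :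
    BddBelow (Set.range fun t : {t : ℝ // 0 ≤ t} => q (x + t.1 • y) - t.1 * q y) := by
  refine ⟨-q (-x), ?_⟩
  rintro _ ⟨⟨t, ht⟩, rfl⟩
  have h1 := hq.add_le (x + t • y) (-x)
  have h2 : q (t • y) ≤ t * q y := hq.smul_le' ht y
  have h3 : t * q y ≤ q (t • y) := by
    rcases ht.eq_or_lt with rfl | ht
    · simp [hq.map_zero]
    · have h := hq.smul_le t⁻¹ (inv_pos.2 ht) (t • y)
      rw [inv_smul_smul₀ ht.ne', ← div_eq_inv_mul, le_div_iff₀ ht] at h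
      linarith
  rw [show x + t • y + -x = t • y by abel] at h1
  simp only
  linarith

theorem directional_le (y x : V) {t : ℝ} (ht : 0 ≤ t) :
    directional q y x ≤ q (x + t • y) - t * q y :=
  ciInf_le (directional_bddBelow hq y x) ⟨t, ht⟩

theorem directional_le_self (y x : V) : directional q y x ≤ q x := by
  simpa using directional_le hq y x le_rfl

theorem directional_neg_le (y : V) : directional q y (-y) ≤ -q y := by
  simpa [hq.map_zero] using directional_le hq y (-y) zero_le_one

theorem directional_isLatticeSublinear [IsOrderedAddMonoid V] (y : V) :
    IsLatticeSublinear (directional q y) := by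
  have : Nonempty {t : ℝ // 0 ≤ t} := ⟨⟨0, le_rfl⟩⟩
  have anti : ∀ s t : ℝ, 0 ≤ s → s ≤ t → ∀ x,
      q (x + t • y) - t * q y ≤ q (x + s • y) - s * q y := fun s t hs hst x => by
    have h1 := hq.add_le (x + s • y) ((t - s) • y)
    have h2 := hq.smul_le' (sub_nonneg.2 hst) y
    rw [show x + s • y + (t - s) • y = x + t • y by rw [sub_smul]; abel] at h1
    linarith
  refine isLatticeSublinear_iInf (directional_bddBelow hq y) ?_ ?_ ?_ ?_
  · rintro ⟨s, hs⟩ ⟨t, ht⟩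
    exact ⟨⟨max s t, hs.trans (le_max_left _ _)⟩, fun x =>
      ⟨anti _ _ hs (le_max_left _ _) x, anti _ _ ht (le_max_right _ _) x⟩⟩
  · rintro ⟨s, hs⟩ ⟨t, ht⟩
    refine ⟨⟨s + t, add_nonneg hs ht⟩, fun x z => ?_⟩
    have h := hq.add_le (x + s • y) (z + t • y)
    rw [show x + s • y + (z + t • y) = x + z + (s + t) • y by rw [add_smul]; abel] at h
    simp only
    linarith
  · rintro s hs ⟨t, ht⟩
    refine ⟨⟨s * t, mul_nonneg hs.le ht⟩, fun x => ?_⟩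
    have h := hq.smul_le s hs (x + t • y)
    rw [smul_add, smul_smul] at h
    simp only
    linarith
  · rintro ⟨t, ht⟩ x z
    simp only
    rw [sup_add, hq.map_sup, max_sub_sub_right]

/-- Below every sublinear functional that preserves suprema there is a lattice homomorphism. -/
theorem exists_latticeHom_le [IsOrderedAddMonoid V] :
    ∃ h : V →ₗ[ℝ] ℝ, IsLatticeHom h ∧ ∀ x, h x ≤ q x := by
  let S := {k : V → ℝ // IsLatticeSublinear k ∧ ∀ x, k x ≤ q x}
  obtain ⟨⟨m, hm, hmq⟩, hmin⟩ := exists_maximal_of_chains_bounded (α := S)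
    (r := fun a b => ∀ x, b.1 x ≤ a.1 x) (fun c hc => by
      rcases c.eq_empty_or_nonempty with rfl | hne
      · exact ⟨⟨q, hq, fun x => le_rfl⟩, by simp⟩
      have : Nonempty c := hne.to_subtype
      have hb : ∀ x, BddBelow (Set.range fun k : c => k.1.1 x) := fun x => by
        refine ⟨-q (-x), ?_⟩
        rintro _ ⟨⟨⟨k, hk, hkq⟩, -⟩, rfl⟩
        have := hk.neg_le x
        have := hkq (-x)
        simp only
        linarith
      have hdir : ∀ i j : c, ∃ l : c, ∀ x, l.1.1 x ≤ i.1.1 x ∧ l.1.1 x ≤ j.1.1 x := fun i j => by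
        rcases eq_or_ne i j with rfl | hij
        · exact ⟨i, fun x => ⟨le_rfl, le_rfl⟩⟩
        rcases hc i.2 j.2 (fun h => hij (Subtype.ext h)) with h | h
        · exact ⟨j, fun x => ⟨h x, le_rfl⟩⟩
        · exact ⟨i, fun x => ⟨le_rfl, h x⟩⟩
      refine ⟨⟨fun x => ⨅ k : c, k.1.1 x, isLatticeSublinear_iInf (k := fun k : c => k.1.1)
        hb hdir ?_ ?_ fun i => i.1.2.1.map_sup, fun x => ?_⟩, ?_⟩
      · intro i j
        obtain ⟨l, hl⟩ := hdir i j
        exact ⟨l, fun x y => (l.1.2.1.add_le x y).trans (add_le_add (hl x).1 (hl y).2)⟩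
      · exact fun s hs i => ⟨i, i.1.2.1.smul_le s hs⟩
      · exact (ciInf_le (hb x) (Classical.arbitrary c)).trans ((Classical.arbitrary c).1.2.2 x)
      · exact fun a ha x => ciInf_le (hb x) ⟨a, ha⟩)
    (fun {a b c} hab hbc x => (hbc x).trans (hab x))
  have hneg : ∀ y, m (-y) = -m y := fun y => by
    have h1 := hmin ⟨directional m y, directional_isLatticeSublinear hm y, fun x =>
      (directional_le_self hm y x).trans (hmq x)⟩ (directional_le_self hm y) (-y)
    have h2 := directional_neg_le hm y
    have h3 := hm.neg_le y
    simp only at h1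
    linarith
  have hadd : ∀ x y, m (x + y) = m x + m y := fun x y => by
    have h1 := hm.add_le x y
    have h2 := hm.add_le (x + y) (-y)
    rw [add_neg_cancel_right, hneg] at h2
    linarith
  have hpos : ∀ s : ℝ, 0 < s → ∀ x, m (s • x) = s * m x := fun s hs x => by
    have h1 := hm.smul_le s hs x
    have h2 := hm.smul_le s hs (-x)
    rw [smul_neg, hneg, hneg] at h2
    linarith
  let h : V →ₗ[ℝ] ℝ :=
    { toFun := m
      map_add' := hadd
      map_smul' := fun s x => by
        rcases lt_trichotomy s 0 with hs | rfl | hs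
        · have := hpos (-s) (neg_pos.2 hs) x
          rw [neg_smul, hneg] at this
          simp only [RingHom.id_apply, smul_eq_mul]
          linarith
        · simp [hm.map_zero]
        · exact hpos s hs x }
  refine ⟨h, fun x y => ⟨hm.map_sup x y, ?_⟩, hmq⟩
  have h1 : m (x ⊓ y) = -m (-x ⊔ -y) := by rw [← neg_inf, hneg, neg_neg]
  change m (x ⊓ y) = m x ⊓ m y
  rw [h1, hm.map_sup, hneg, hneg, max_neg_neg, neg_neg]

end

/-- In an Archimedean vector lattice with order unit `e`, the lattice homomorphisms that are
normalised at `e` determine the order. -/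
theorem exists_latticeHom_pos [IsOrderedAddMonoid V] [IsOrderedModule ℝ V] {e : V} (he : 0 ≤ e)
    (hu : ∀ x : V, ∃ t : ℝ, x ≤ t • e) (harch : ∀ x : V, (∀ ε : ℝ, 0 < ε → x ≤ ε • e) → x ≤ 0)
    {x₀ : V} (hx₀ : ¬ x₀ ≤ 0) : ∃ h : V →ₗ[ℝ] ℝ, IsLatticeHom h ∧ h e = 1 ∧ 0 < h x₀ := by
  have hmono : ∀ {x : V} {s t : ℝ}, s ≤ t → x ≤ s • e → x ≤ t • e := fun hst hx =>
    hx.trans (smul_le_smul_of_nonneg_right hst he)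
  have hnn : ∀ t : ℝ, 0 ≤ t • e → 0 ≤ t := fun t ht => by
    by_contra! hlt
    refine hx₀ ?_
    have h1 : e ≤ 0 := by
      have h2 : (-t)⁻¹ • (t • e) = -e := by
        rw [smul_smul, inv_neg, neg_mul, inv_mul_cancel₀ hlt.ne, neg_one_smul]
      have h3 : 0 ≤ (-t)⁻¹ • (t • e) := smul_nonneg (by simp [hlt.le]) ht
      rw [h2] at h3
      exact neg_nonneg.1 h3
    obtain ⟨s, hs⟩ := hu x₀
    rwa [le_antisymm h1 he, smul_zero] at hs
  let P : V → Set ℝ := fun x => {t | x ≤ t • e}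
  let p : V → ℝ := fun x => sInf (P x)
  have hb : ∀ x, BddBelow (P x) := fun x => by
    obtain ⟨s, hs⟩ := hu (-x)
    refine ⟨-s, fun t (ht : x ≤ t • e) => ?_⟩
    have := hnn (s + t) (by rw [add_smul]; simpa using add_le_add hs ht)
    linarith
  have hple : ∀ {x t}, x ≤ t • e → p x ≤ t := fun {x t} h => csInf_le (hb x) h
  have hlt : ∀ {x t}, p x < t → x ≤ t • e := fun {x t} h => by
    obtain ⟨s, hs, hst⟩ := exists_lt_of_csInf_lt (hu x) h
    exact hmono hst.le hs
  have hp : IsLatticeSublinear p := by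
    refine ⟨fun x y => ?_, fun s hs x => ?_, fun x y => le_antisymm ?_ ?_⟩
    · refine le_of_forall_pos_le_add fun ε hε => ?_
      have h1 : x ≤ (p x + ε / 2) • e := hlt (by linarith)
      have h2 : y ≤ (p y + ε / 2) • e := hlt (by linarith)
      refine hple ((add_le_add h1 h2).trans (le_of_eq ?_))
      rw [← add_smul]
      congr 1
      ring
    · refine le_of_forall_pos_le_add fun ε hε => ?_
      have h1 : x ≤ (p x + ε / s) • e := hlt (by have := div_pos hε hs; linarith)
      refine hple ((smul_le_smul_of_nonneg_left h1 hs.le).trans (le_of_eq ?_))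
      rw [smul_smul, mul_add, mul_div_cancel₀ _ hs.ne']
    · refine le_of_forall_gt_imp_ge_of_dense fun t ht => ?_
      exact hple (sup_le (hlt ((le_max_left _ _).trans_lt ht))
        (hlt ((le_max_right _ _).trans_lt ht)))
    · refine max_le ?_ ?_ <;> refine le_of_forall_gt_imp_ge_of_dense fun t ht => hple ?_
      · exact le_sup_left.trans (hlt ht)
      · exact le_sup_right.trans (hlt ht)
  have hpos : 0 < p x₀ := by
    by_contra! h
    exact hx₀ (harch x₀ fun ε hε => hlt (h.trans_lt hε))
  obtain ⟨h, hh, hle⟩ := exists_latticeHom_le (directional_isLatticeSublinear hp x₀)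
  have hhp : ∀ x, h x ≤ p x := fun x => (hle x).trans (directional_le_self hp x₀ x)
  refine ⟨h, hh, le_antisymm ((hhp e).trans (hple (by rw [one_smul]))) ?_, ?_⟩
  · have h1 := (hhp (-e)).trans (hple (t := -1) (by simp))
    rw [map_neg] at h1
    linarith
  · have h1 := (hle (-x₀)).trans (directional_neg_le hp x₀)
    rw [map_neg] at h1
    linarith

end LatticeSublinear

/-! ### Principal order ideals of Banach lattices are spaces of continuous functions -/

section LatticeHom

variable {X : Type u} {Y : Type v} [AddCommGroup X] [Module ℝ X] [Lattice X]
  [AddCommGroup Y] [Module ℝ Y] [Lattice Y] {T : X →ₗ[ℝ] Y}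

theorem IsLatticeHom.mono (hT : IsLatticeHom T) {x y : X} (h : x ≤ y) : T x ≤ T y := by
  rw [← sup_eq_right, ← (hT x y).1, sup_eq_right.2 h]

theorem IsLatticeHom.nonneg (hT : IsLatticeHom T) {x : X} (h : 0 ≤ x) : 0 ≤ T x := by
  simpa using hT.mono h

theorem IsLatticeHom.le_of_map_le (hT : IsLatticeHom T) (hinj : Function.Injective T) {x y : X}
    (h : T x ≤ T y) : x ≤ y := by
  rw [← sup_eq_right]
  apply hinj
  rw [(hT x y).1, sup_eq_right.2 h]

end LatticeHom

section Representation

variable {Z : Type u} [NormedAddCommGroup Z] [NormedSpace ℝ Z] [Lattice Z]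
  [IsOrderedAddMonoid Z] [IsOrderedModule ℝ Z] [HasSolidNorm Z]

/-- Normed vector lattices are Archimedean. -/
theorem le_of_forall_le_add_smul {x y e : Z} (h : ∀ ε : ℝ, 0 < ε → x ≤ y + ε • e) : x ≤ y := by
  have h1 : Filter.Tendsto (fun ε : ℝ => y + ε • e) (nhdsWithin 0 (Set.Ioi 0)) (nhds y) := by
    have : Filter.Tendsto (fun ε : ℝ => y + ε • e) (nhds 0) (nhds (y + (0 : ℝ) • e)) :=
      (continuous_const.add (continuous_id.smul continuous_const)).tendsto 0
    rw [zero_smul, add_zero] at this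
    exact this.mono_left nhdsWithin_le_nhds
  exact ge_of_tendsto h1 (Filter.eventually_of_mem self_mem_nhdsWithin h)

theorem abs_smul_le (c : ℝ) (x : Z) : |c • x| ≤ |c| • |x| := by
  have key : ∀ (c : ℝ) (x : Z), c • x ≤ |c| • |x| := fun c x => by
    rcases le_total 0 c with hc | hc
    · rw [abs_of_nonneg hc]
      exact smul_le_smul_of_nonneg_left (le_abs_self x) hc
    · rw [abs_of_nonpos hc, ← neg_smul_neg]
      exact smul_le_smul_of_nonneg_left (neg_le_abs x) (neg_nonneg.2 hc)
  refine abs_le'.2 ⟨key c x, ?_⟩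
  rw [← smul_neg, ← abs_neg x]
  exact key c (-x)

/-- The order ideal generated by `e`. -/
def orderIdeal (e : Z) : Submodule ℝ Z where
  carrier := {z | ∃ t : ℝ, |z| ≤ t • e}
  add_mem' := by
    rintro x y ⟨s, hs⟩ ⟨t, ht⟩
    exact ⟨s + t, (abs_add_le x y).trans (by rw [add_smul]; exact add_le_add hs ht)⟩
  zero_mem' := ⟨0, by simp⟩
  smul_mem' := by
    rintro c x ⟨t, ht⟩
    refine ⟨|c| * t, ?_⟩
    rw [mul_smul]
    exact (abs_smul_le c x).trans (smul_le_smul_of_nonneg_left ht (abs_nonneg c))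

theorem orderIdeal_solid {e x y : Z} (hy : y ∈ orderIdeal e) (h : |x| ≤ |y|) :
    x ∈ orderIdeal e := by
  obtain ⟨t, ht⟩ := hy
  exact ⟨t, h.trans ht⟩

theorem abs_mem_orderIdeal {e x : Z} (hx : x ∈ orderIdeal e) : |x| ∈ orderIdeal e :=
  orderIdeal_solid hx (by rw [abs_abs])

theorem sup_mem_orderIdeal {e x y : Z} (hx : x ∈ orderIdeal e) (hy : y ∈ orderIdeal e) :
    x ⊔ y ∈ orderIdeal e := by
  rw [sup_eq_half_smul_add_add_abs_sub' ℝ]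
  exact Submodule.smul_mem _ _ (add_mem (add_mem hx hy) (abs_mem_orderIdeal (sub_mem hy hx)))

theorem inf_mem_orderIdeal {e x y : Z} (hx : x ∈ orderIdeal e) (hy : y ∈ orderIdeal e) :
    x ⊓ y ∈ orderIdeal e := by
  rw [inf_eq_half_smul_add_sub_abs_sub' ℝ]
  exact Submodule.smul_mem _ _ (sub_mem (add_mem hx hy) (abs_mem_orderIdeal (sub_mem hy hx)))

instance (e : Z) : Lattice (orderIdeal e) :=
  Subtype.lattice (fun _ _ => sup_mem_orderIdeal) (fun _ _ => inf_mem_orderIdeal)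

instance (e : Z) : IsOrderedAddMonoid (orderIdeal e) where
  add_le_add_left _ _ h c := add_le_add_left (α := Z) h c.1

instance (e : Z) : IsOrderedModule ℝ (orderIdeal e) where
  smul_le_smul_of_nonneg_left := fun _ ha _ _ h =>
    smul_le_smul_of_nonneg_left (α := ℝ) (β := Z) h ha
  smul_le_smul_of_nonneg_right := fun x hx _ _ h =>
    smul_le_smul_of_nonneg_right (α := ℝ) (β := Z) h (b := x.1) hx

/-- The generator of an order ideal, as an element of the ideal. -/
def orderIdealUnit {e : Z} (he : 0 ≤ e) : orderIdeal e :=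
  ⟨e, 1, by rw [abs_of_nonneg he, one_smul]⟩

/-- The normalised real-valued lattice homomorphisms on the order ideal generated by `e`, with the
topology of pointwise convergence. -/
def latticeSpectrum {e : Z} (he : 0 ≤ e) : Set (orderIdeal e → ℝ) :=
  {h | (∀ x y, h (x + y) = h x + h y) ∧ (∀ (c : ℝ) x, h (c • x) = c * h x) ∧
    (∀ x y, h (x ⊔ y) = h x ⊔ h y) ∧ (∀ x y, h (x ⊓ y) = h x ⊓ h y) ∧ h (orderIdealUnit he) = 1}

theorem latticeSpectrum_mono {e : Z} {he : 0 ≤ e} {h : orderIdeal e → ℝ}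
    (hh : h ∈ latticeSpectrum he) {x y : orderIdeal e} (hxy : x ≤ y) : h x ≤ h y := by
  rw [← sup_eq_right, ← hh.2.2.1, sup_eq_right.2 hxy]

theorem latticeSpectrum_abs_le {e : Z} {he : 0 ≤ e} {h : orderIdeal e → ℝ}
    (hh : h ∈ latticeSpectrum he) {x : orderIdeal e} {t : ℝ} (hx : |(x : Z)| ≤ t • e) :
    |h x| ≤ t := by
  have h1 := latticeSpectrum_mono hh (x := x) (y := t • orderIdealUnit he)
    ((le_abs_self (x : Z)).trans hx)
  have h2 := latticeSpectrum_mono hh (x := (-1 : ℝ) • x) (y := t • orderIdealUnit he) (by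
    change (-1 : ℝ) • (x : Z) ≤ t • e
    rw [neg_one_smul]
    exact (neg_le_abs (x : Z)).trans hx)
  rw [hh.2.1, hh.2.2.2.2, mul_one] at h1
  rw [hh.2.1, hh.2.1, hh.2.2.2.2, mul_one] at h2
  exact abs_le.2 ⟨by linarith, h1⟩

instance compactSpace_latticeSpectrum {e : Z} (he : 0 ≤ e) : CompactSpace (latticeSpectrum he) := by
  rw [← isCompact_iff_compactSpace]
  choose t ht using fun x : orderIdeal e => x.2
  refine (isCompact_univ_pi fun x : orderIdeal e => isCompact_Icc (a := -t x)
    (b := t x)).of_isClosed_subset ?_ fun h hh x _ => abs_le.1 (latticeSpectrum_abs_le hh (ht x))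
  have ev : ∀ x : orderIdeal e, Continuous fun h : orderIdeal e → ℝ => h x := continuous_apply
  simp only [latticeSpectrum, Set.ofPred_and, Set.ofPred_forall]
  refine IsClosed.inter (isClosed_iInter fun x => isClosed_iInter fun y => ?_)
    (IsClosed.inter (isClosed_iInter fun c => isClosed_iInter fun x => ?_)
    (IsClosed.inter (isClosed_iInter fun x => isClosed_iInter fun y => ?_)
    (IsClosed.inter (isClosed_iInter fun x => isClosed_iInter fun y => ?_) ?_)))
  · exact isClosed_eq (ev _) ((ev _).add (ev _))
  · exact isClosed_eq (ev _) ((ev _).const_mul c)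
  · exact isClosed_eq (ev _) ((ev _).sup (ev _))
  · exact isClosed_eq (ev _) ((ev _).inf (ev _))
  · exact isClosed_eq (ev _) continuous_const

/-- Elements of an order ideal as continuous functions on its spectrum. -/
def gelfand {e : Z} (he : 0 ≤ e) : orderIdeal e →ₗ[ℝ] C(latticeSpectrum he, ℝ) where
  toFun x := ⟨fun h => h.1 x, (continuous_apply x).comp continuous_subtype_val⟩
  map_add' x y := ContinuousMap.ext fun h => h.2.1 x y
  map_smul' c x := ContinuousMap.ext fun h => h.2.2.1 c x

theorem gelfand_sup {e : Z} (he : 0 ≤ e) (x y : orderIdeal e) :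
    gelfand he (x ⊔ y) = gelfand he x ⊔ gelfand he y :=
  ContinuousMap.ext fun h => h.2.2.2.1 x y

theorem gelfand_inf {e : Z} (he : 0 ≤ e) (x y : orderIdeal e) :
    gelfand he (x ⊓ y) = gelfand he x ⊓ gelfand he y :=
  ContinuousMap.ext fun h => h.2.2.2.2.1 x y

theorem le_smul_of_gelfand_le {e : Z} (he : 0 ≤ e) {x : orderIdeal e} {t : ℝ}
    (h : ∀ k, gelfand he x k ≤ t) : (x : Z) ≤ t • e := by
  by_contra hx
  obtain ⟨k, hk, hke, hkx⟩ := exists_latticeHom_pos (V := orderIdeal e) (e := orderIdealUnit he)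
    he (fun x => by
      obtain ⟨t, ht⟩ := x.2
      exact ⟨t, (le_abs_self (x : Z)).trans ht⟩)
    (fun x hx => le_of_forall_le_add_smul (Z := Z) (y := 0) (e := e) fun ε hε => by
      rw [zero_add]; exact hx ε hε)
    (x₀ := x - t • orderIdealUnit he) (fun h0 => hx (sub_nonpos.1 h0))
  have h1 := h ⟨k, k.map_add, k.map_smul, fun x y => (hk x y).1, fun x y => (hk x y).2, hke⟩
  rw [map_sub, map_smul, hke] at hkx
  change k x ≤ t at h1
  rw [smul_eq_mul, mul_one] at hkx
  linarith

theorem abs_le_norm_gelfand_smul {e : Z} (he : 0 ≤ e) (x : orderIdeal e) :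
    |(x : Z)| ≤ ‖gelfand he x‖ • e := by
  refine abs_le'.2 ⟨le_smul_of_gelfand_le he fun k =>
    (le_abs_self _).trans ((gelfand he x).norm_coe_le_norm k), ?_⟩
  refine le_smul_of_gelfand_le he (x := -x) fun k => ?_
  rw [map_neg]
  exact (neg_le_abs _).trans ((gelfand he x).norm_coe_le_norm k)

theorem norm_le_norm_gelfand_mul {e : Z} (he : 0 ≤ e) (x : orderIdeal e) :
    ‖(x : Z)‖ ≤ ‖gelfand he x‖ * ‖e‖ := by
  have h := norm_le_norm_of_abs_le_abs (α := Z) (a := x) (b := ‖gelfand he x‖ • e) (by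
    rw [abs_of_nonneg (smul_nonneg (norm_nonneg _) he)]
    exact abs_le_norm_gelfand_smul he x)
  rwa [norm_smul, norm_norm] at h

theorem gelfand_injective {e : Z} (he : 0 ≤ e) : Function.Injective (gelfand he) := by
  rw [injective_iff_map_eq_zero]
  intro x hx
  have h := norm_le_norm_gelfand_mul he x
  rw [hx, norm_zero, zero_mul] at h
  exact Subtype.ext (norm_le_zero_iff.1 h)

theorem gelfand_denseRange {e : Z} (he : 0 ≤ e) :
    closure (Set.range (gelfand he)) = ⊤ := by
  have hone : ∀ k : latticeSpectrum he, gelfand he (orderIdealUnit he) k = 1 := fun k =>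
    k.2.2.2.2.2
  refine ContinuousMap.sublattice_closure_eq_top _ ⟨_, 0, rfl⟩ ?_ ?_ ?_
  · rintro _ ⟨x, rfl⟩ _ ⟨y, rfl⟩
    exact ⟨x ⊓ y, gelfand_inf he x y⟩
  · rintro _ ⟨x, rfl⟩ _ ⟨y, rfl⟩
    exact ⟨x ⊔ y, gelfand_sup he x y⟩
  · intro v k l
    rcases eq_or_ne k l with rfl | hkl
    · refine ⟨_, ⟨v k • orderIdealUnit he, rfl⟩, ?_, ?_⟩ <;>
      · rw [map_smul, ContinuousMap.smul_apply, hone, smul_eq_mul, mul_one]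
    · obtain ⟨x, hx⟩ : ∃ x, k.1 x ≠ l.1 x := by
        by_contra! h
        exact hkl (Subtype.ext (funext h))
      have hx' : gelfand he x k - gelfand he x l ≠ 0 := sub_ne_zero.2 hx
      refine ⟨_, ⟨((v k - v l) / (gelfand he x k - gelfand he x l)) • x +
        (v k - (v k - v l) / (gelfand he x k - gelfand he x l) * gelfand he x k) •
          orderIdealUnit he, rfl⟩, ?_, ?_⟩ <;>
      · rw [map_add, map_smul, map_smul, ContinuousMap.add_apply, ContinuousMap.smul_apply,
          ContinuousMap.smul_apply, hone, smul_eq_mul, smul_eq_mul]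
        field_simp
        ring

theorem gelfand_surjective [CompleteSpace Z] {e : Z} (he : 0 ≤ e) :
    Function.Surjective (gelfand he) := by
  intro g
  have hg : g ∈ closure (Set.range (gelfand he)) := by rw [gelfand_denseRange]; trivial
  obtain ⟨w, hw, hlim⟩ := mem_closure_iff_seq_limit.1 hg
  choose x hx using hw
  obtain rfl : (fun n => gelfand he (x n)) = w := funext hx
  have hcauchy : CauchySeq fun n => (x n : Z) := by
    rw [Metric.cauchySeq_iff]
    intro ε hε
    obtain ⟨N, hN⟩ := Metric.cauchySeq_iff.1 hlim.cauchySeq (ε / (‖e‖ + 1)) (by positivity)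
    refine ⟨N, fun m hm n hn => ?_⟩
    have h1 := hN m hm n hn
    rw [dist_eq_norm, ← map_sub, lt_div_iff₀ (by positivity)] at h1
    have h2 := norm_le_norm_gelfand_mul he (x m - x n)
    rw [dist_eq_norm]
    refine h2.trans_lt (lt_of_le_of_lt ?_ h1)
    gcongr
    linarith
  obtain ⟨z, hz⟩ := cauchySeq_tendsto_of_complete hcauchy
  have hle : ∀ n, |(x n : Z) - z| ≤ ‖gelfand he (x n) - g‖ • e := fun n => by
    have h1 : Filter.Tendsto (fun m => |(x n : Z) - x m|) Filter.atTop (nhds |(x n : Z) - z|) :=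
      (tendsto_const_nhds.sub hz).sup_nhds (tendsto_const_nhds.sub hz).neg
    have h2 : Filter.Tendsto (fun m => ‖gelfand he (x n) - gelfand he (x m)‖ • e) Filter.atTop
        (nhds (‖gelfand he (x n) - g‖ • e)) :=
      ((tendsto_const_nhds.sub hlim).norm).smul_const e
    refine le_of_tendsto_of_tendsto' h1 h2 fun m => ?_
    rw [← map_sub]
    exact abs_le_norm_gelfand_smul he (x n - x m)
  have hmem : z ∈ orderIdeal e := by
    have h1 : (x 0 : Z) - z ∈ orderIdeal e := ⟨_, hle 0⟩
    have := sub_mem (x 0).2 h1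
    rwa [sub_sub_cancel] at this
  refine ⟨⟨z, hmem⟩, ?_⟩
  refine tendsto_nhds_unique ?_ hlim
  rw [tendsto_iff_norm_sub_tendsto_zero]
  refine squeeze_zero (fun _ => norm_nonneg _) (fun n => ?_)
    (tendsto_iff_norm_sub_tendsto_zero.1 hlim)
  rw [← map_sub]
  exact (ContinuousMap.norm_le _ (norm_nonneg _)).2 fun k =>
    latticeSpectrum_abs_le k.2 (hle n)

/-- **Kakutani's theorem**: the order ideal generated by a positive element `e` of a Banach lattice
is lattice isomorphic to a space of continuous functions on a compact space, with `e` corresponding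
to the constant function `1`. -/
theorem exists_continuousMap_representation [CompleteSpace Z] {e : Z} (he : 0 ≤ e) :
    ∃ (K : Type u) (_ : TopologicalSpace K) (_ : CompactSpace K) (Φ : C(K, ℝ) →ₗ[ℝ] Z),
      IsLatticeHom Φ ∧ Function.Injective Φ ∧ Φ 1 = e ∧ ∀ z ∈ orderIdeal e, ∃ g, Φ g = z := by
  let G := LinearEquiv.ofBijective (gelfand he) ⟨gelfand_injective he, gelfand_surjective he⟩
  refine ⟨latticeSpectrum he, inferInstance, inferInstance,
    (orderIdeal e).subtype ∘ₗ G.symm.toLinearMap, fun f g => ?_, ?_, ?_, fun z hz => ?_⟩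
  · obtain ⟨x, rfl⟩ := G.surjective f
    obtain ⟨y, rfl⟩ := G.surjective g
    have h1 : G x ⊔ G y = G (x ⊔ y) := (gelfand_sup he x y).symm
    have h2 : G x ⊓ G y = G (x ⊓ y) := (gelfand_inf he x y).symm
    rw [h1, h2]
    simp only [LinearMap.comp_apply, LinearEquiv.coe_coe, LinearEquiv.symm_apply_apply]
    exact ⟨rfl, rfl⟩
  · exact Subtype.val_injective.comp G.symm.injective
  · have : (1 : C(latticeSpectrum he, ℝ)) = G (orderIdealUnit he) :=
      ContinuousMap.ext fun k => k.2.2.2.2.2.symm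
    rw [this]
    simp only [LinearMap.comp_apply, LinearEquiv.coe_coe, LinearEquiv.symm_apply_apply]
    rfl
  · exact ⟨G ⟨z, hz⟩, by simp⟩

end Representation

/-! ### The `ℓ^p`-norm on `ℝⁿ` and its dual ball -/

section DualBall

variable {p : ℝ≥0∞} {n : ℕ}

/-- The linear forms on `ℝⁿ` that are dominated by the `ℓ^p`-norm. -/
def DualBall (p : ℝ≥0∞) {n : ℕ} (a : Fin n → ℝ) : Prop :=
  ∀ t : Fin n → ℝ, ∑ k, a k * t k ≤ ‖WithLp.toLp p t‖

variable [Fact (1 ≤ p)]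

theorem one_le_toReal (hp : p ≠ ∞) : 1 ≤ p.toReal := by
  have := ENNReal.toReal_mono hp (Fact.out : 1 ≤ p)
  simpa using this

theorem toReal_pos' (hp : p ≠ ∞) : 0 < p.toReal := zero_lt_one.trans_le (one_le_toReal hp)

theorem norm_toLp_rpow {ι : Type v} [Fintype ι] (hp : p ≠ ∞) (t : ι → ℝ) :
    ‖WithLp.toLp p t‖ ^ p.toReal = ∑ k, |t k| ^ p.toReal := by
  rw [PiLp.norm_eq_sum (toReal_pos' hp), one_div, Real.rpow_inv_rpow _ (toReal_pos' hp).ne']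
  · rfl
  · exact Finset.sum_nonneg fun k _ => Real.rpow_nonneg (norm_nonneg _) _

/-- Neither truncation nor extension by zero increases the norm. -/
theorem norm_toLp_extend_le (hp : p ≠ ∞) (t : Fin n → ℝ) (m : ℕ) :
    ‖WithLp.toLp p fun k : Fin m => if h : (k : ℕ) < n then t ⟨k, h⟩ else 0‖ ≤
      ‖WithLp.toLp p t‖ := by
  have hr := toReal_pos' hp
  let t' : ℕ → ℝ := fun k => if h : k < n then t ⟨k, h⟩ else 0
  rw [← Real.rpow_le_rpow_iff (norm_nonneg _) (norm_nonneg _) hr, norm_toLp_rpow hp,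
    norm_toLp_rpow hp, Fin.sum_univ_eq_sum_range (fun k => |t' k| ^ p.toReal)]
  have h1 : ∑ k : Fin n, |t k| ^ p.toReal = ∑ k ∈ Finset.range n, |t' k| ^ p.toReal := by
    rw [← Fin.sum_univ_eq_sum_range (fun k => |t' k| ^ p.toReal)]
    exact Finset.sum_congr rfl fun k _ => by simp [t']
  rw [h1, Finset.sum_subset (Finset.range_mono (le_max_left n m)) fun k _ hk => by
    rw [Finset.mem_range] at hk
    simp [t', hk, Real.zero_rpow hr.ne']]
  exact Finset.sum_le_sum_of_subset_of_nonneg (Finset.range_mono (le_max_right n m))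
    fun k _ _ => Real.rpow_nonneg (abs_nonneg _) _

theorem norm_toLp_mono {s t : Fin n → ℝ} (h : ∀ k, |s k| ≤ |t k|) :
    ‖WithLp.toLp p s‖ ≤ ‖WithLp.toLp p t‖ := by
  rcases eq_or_ne p ∞ with rfl | hp
  · rw [PiLp.norm_toLp, PiLp.norm_toLp]
    refine (pi_norm_le_iff_of_nonneg (norm_nonneg _)).2 fun k => ?_
    exact (h k).trans (norm_le_pi_norm t k)
  · rw [← Real.rpow_le_rpow_iff (norm_nonneg _) (norm_nonneg _) (toReal_pos' hp),
      norm_toLp_rpow hp, norm_toLp_rpow hp]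
    exact Finset.sum_le_sum fun k _ =>
      Real.rpow_le_rpow (abs_nonneg _) (h k) (toReal_pos' hp).le

theorem exists_dualBall_eq_norm (t : Fin n → ℝ) :
    ∃ a, DualBall p a ∧ ∑ k, a k * t k = ‖WithLp.toLp p t‖ := by
  obtain ⟨g, hg, hgx⟩ := exists_dual_vector'' ℝ (WithLp.toLp p t : PiLp p fun _ : Fin n => ℝ)
  have hsum : ∀ t : Fin n → ℝ,
      ∑ k, g (WithLp.toLp p (Pi.single k 1)) * t k = g (WithLp.toLp p t) := by
    intro t
    have : (WithLp.toLp p t : PiLp p fun _ : Fin n => ℝ) =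
        ∑ k, t k • WithLp.toLp p (Pi.single k (1 : ℝ)) := by
      ext j
      simp [Finset.sum_apply, Pi.single_apply]
    rw [this, map_sum]
    simp [mul_comm]
  refine ⟨fun k => g (WithLp.toLp p (Pi.single k 1)), fun t => ?_, ?_⟩
  · rw [hsum]
    exact (le_abs_self _).trans (by simpa using g.le_of_opNorm_le hg (WithLp.toLp p t))
  · rw [hsum, hgx]
    rfl

theorem dualBall_zero : DualBall p (0 : Fin n → ℝ) := fun t => by simp

theorem DualBall.abs {a : Fin n → ℝ} (ha : DualBall p a) : DualBall p fun k => |a k| := by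
  intro t
  refine le_trans ?_ ((ha fun k => SignType.sign (a k) * |t k|).trans (norm_toLp_mono fun k => ?_))
  · refine Finset.sum_le_sum fun k _ => ?_
    rw [← mul_assoc, self_mul_sign]
    exact mul_le_mul_of_nonneg_left (le_abs_self _) (abs_nonneg _)
  · rw [abs_mul, abs_abs]
    refine mul_le_of_le_one_left (abs_nonneg _) ?_
    rcases lt_trichotomy (a k) 0 with h | h | h <;> simp [h]

/-- The nonnegative part of the dual ball suffices to norm nonnegative vectors. -/
theorem exists_nonneg_dualBall_eq_norm {t : Fin n → ℝ} (ht : ∀ k, 0 ≤ t k) :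
    ∃ a, DualBall p a ∧ (∀ k, 0 ≤ a k) ∧ ∑ k, a k * t k = ‖WithLp.toLp p t‖ := by
  obtain ⟨a, ha, hat⟩ := exists_dualBall_eq_norm (p := p) t
  refine ⟨fun k => |a k|, ha.abs, fun k => abs_nonneg _, le_antisymm (ha.abs t) ?_⟩
  rw [← hat]
  exact Finset.sum_le_sum fun k _ => mul_le_mul_of_nonneg_right (le_abs_self _) (ht k)

end DualBall

/-! ### Finite suprema of linear combinations -/

section SupList

variable {n : ℕ}

/-- The supremum of `0` and of the linear combinations of `x` with coefficients in the list `A`;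
these suprema approximate `(∑ |x k|^p)^(1/p)` when `A` runs through the lists in the dual ball. -/
def supList {X : Type u} [AddCommGroup X] [Module ℝ X] [Lattice X] (A : List (Fin n → ℝ))
    (x : Fin n → X) : X :=
  A.foldr (fun a s => (∑ k, a k • x k) ⊔ s) 0

section

variable {X : Type u} [AddCommGroup X] [Module ℝ X] [Lattice X] {A : List (Fin n → ℝ)}
  {x : Fin n → X}

theorem supList_le {s : X} (hs : 0 ≤ s) (h : ∀ a ∈ A, ∑ k, a k • x k ≤ s) : supList A x ≤ s := by
  induction A with
  | nil => exact hs
  | cons a A ih =>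
    exact sup_le (h a List.mem_cons_self) (ih fun b hb => h b (List.mem_cons_of_mem _ hb))

theorem supList_nonneg : 0 ≤ supList A x := by
  induction A with
  | nil => exact le_rfl
  | cons a A ih => exact ih.trans le_sup_right

theorem le_supList {a : Fin n → ℝ} (ha : a ∈ A) : ∑ k, a k • x k ≤ supList A x := by
  induction A with
  | nil => simp at ha
  | cons b A ih =>
    rcases List.mem_cons.1 ha with rfl | ha
    · exact le_sup_left
    · exact (ih ha).trans le_sup_right

theorem IsLatticeHom.map_supList {Y : Type v} [AddCommGroup Y] [Module ℝ Y] [Lattice Y]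
    {T : X →ₗ[ℝ] Y} (hT : IsLatticeHom T) (A : List (Fin n → ℝ)) (x : Fin n → X) :
    T (supList A x) = supList A fun k => T (x k) := by
  induction A with
  | nil => exact map_zero T
  | cons a A ih =>
    change T ((∑ k, a k • x k) ⊔ supList A x) = (∑ k, a k • T (x k)) ⊔ supList A fun k => T (x k)
    rw [(hT _ _).1, ih, map_sum]
    simp only [map_smul]

end

theorem continuous_supList {X : Type u} [NormedAddCommGroup X] [NormedSpace ℝ X] [Lattice X]
    [ContinuousSup X] (A : List (Fin n → ℝ)) :
    Continuous fun x : Fin n → X => supList A x := by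
  induction A with
  | nil => exact continuous_const
  | cons a A ih =>
    exact (continuous_finsetSum _ fun k _ => (continuous_apply k).const_smul (a k)).sup ih

end SupList

/-! ### `p`-sums in spaces of continuous functions -/

section LpFun

variable {p : ℝ≥0∞} [Fact (1 ≤ p)] {n : ℕ} {K : Type v} [TopologicalSpace K]

/-- The function `(∑ |g k|^p)^(1/p)`. -/
noncomputable def lpFun (p : ℝ≥0∞) [Fact (1 ≤ p)] (g : Fin n → C(K, ℝ)) : C(K, ℝ) where
  toFun ω := ‖WithLp.toLp p fun k => g k ω‖
  continuous_toFun := ((PiLp.continuous_toLp p _).comp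
    (continuous_pi fun k => (g k).continuous)).norm

theorem lpFun_apply (g : Fin n → C(K, ℝ)) (ω : K) :
    lpFun p g ω = ‖WithLp.toLp p fun k => g k ω‖ := rfl

theorem lpFun_nonneg (g : Fin n → C(K, ℝ)) : 0 ≤ lpFun p g := fun _ => norm_nonneg _

theorem sum_smul_le_lpFun {a : Fin n → ℝ} (ha : DualBall p a) (g : Fin n → C(K, ℝ)) :
    ∑ k, a k • g k ≤ lpFun p g := fun ω => by
  have h := ha fun k => g k ω
  have h1 : (∑ k, a k • g k) ω = ∑ k, a k * g k ω := by simp [ContinuousMap.coe_sum]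
  exact h1.trans_le h

theorem exists_lpFun_le_supList [CompactSpace K] (g : Fin n → C(K, ℝ)) {ε : ℝ} (hε : 0 < ε) :
    ∃ A : List (Fin n → ℝ), (∀ a ∈ A, DualBall p a) ∧ lpFun p g ≤ supList A g + ε • 1 := by
  choose a ha hag using fun ω : K => exists_dualBall_eq_norm (p := p) fun k => g k ω
  let U : K → Set K := fun ω => {ω' | lpFun p g ω' < (∑ k, a ω k • g k) ω' + ε}
  have hU : ∀ ω, IsOpen (U ω) := fun ω =>
    isOpen_lt (lpFun p g).continuous ((∑ k, a ω k • g k : C(K, ℝ)).continuous.add continuous_const)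
  have hmem : ∀ ω, ω ∈ U ω := fun ω => by
    have h1 : (∑ k, a ω k • g k) ω = lpFun p g ω := by
      rw [lpFun_apply, ← hag]
      simp [ContinuousMap.coe_sum]
    change lpFun p g ω < (∑ k, a ω k • g k) ω + ε
    linarith
  obtain ⟨s, hs⟩ := isCompact_univ.elim_finite_subcover U hU fun ω _ =>
    Set.mem_iUnion.2 ⟨ω, hmem ω⟩
  refine ⟨s.toList.map a, fun b hb => ?_, fun ω => ?_⟩
  · obtain ⟨ω, -, rfl⟩ := List.mem_map.1 hb
    exact ha ω
  · obtain ⟨ω', hω', hω⟩ := Set.mem_iUnion₂.1 (hs (Set.mem_univ ω))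
    have h1 : (∑ k, a ω' k • g k) ω ≤ supList (s.toList.map a) g ω :=
      le_supList (x := g) (List.mem_map.2 ⟨ω', Finset.mem_toList.2 hω', rfl⟩) ω
    have h2 : lpFun p g ω < (∑ k, a ω' k • g k) ω + ε := hω
    change lpFun p g ω ≤ supList (s.toList.map a) g ω + ε * 1
    linarith

variable {Z : Type u} [NormedAddCommGroup Z] [NormedSpace ℝ Z] [Lattice Z]
  [IsOrderedAddMonoid Z] [IsOrderedModule ℝ Z] [HasSolidNorm Z] [CompactSpace K]
  {Φ : C(K, ℝ) →ₗ[ℝ] Z}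

theorem isLpSum_map_lpFun (hΦ : IsLatticeHom Φ) (g : Fin n → C(K, ℝ)) :
    IsLpSum p (fun k => Φ (g k)) (Φ (lpFun p g)) := by
  constructor
  · rintro _ ⟨a, ha, rfl⟩
    have h := hΦ.mono (sum_smul_le_lpFun (p := p) ha g)
    simpa only [map_sum, map_smul] using h
  · intro s hs
    have hs0 : 0 ≤ s := hs ⟨0, dualBall_zero, by simp⟩
    refine le_of_forall_le_add_smul (e := Φ 1) fun ε hε => ?_
    obtain ⟨A, hA, hle⟩ := exists_lpFun_le_supList (p := p) g hε
    refine (hΦ.mono hle).trans ?_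
    rw [map_add, map_smul, hΦ.map_supList]
    gcongr
    exact supList_le hs0 fun a ha => hs ⟨a, hA a ha, rfl⟩

theorem PConvexWith.norm_map_lpFun_le {M : ℝ} (hZ : PConvexWith p M Z) (hΦ : IsLatticeHom Φ)
    (g : Fin n → C(K, ℝ)) :
    ‖Φ (lpFun p g)‖ ≤ M * ‖WithLp.toLp p fun k => ‖Φ (g k)‖‖ := by
  obtain ⟨s, hs, hle⟩ := hZ n fun k => Φ (g k)
  rwa [(isLpSum_map_lpFun hΦ g).unique hs]

/-- In a Banach lattice, `p`-convexity may be tested on finite suprema. -/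
theorem pConvexWith_of_supList [CompleteSpace Z] {M : ℝ}
    (h : ∀ (n : ℕ) (x : Fin n → Z) (A : List (Fin n → ℝ)), (∀ a ∈ A, DualBall p a) →
      ‖supList A x‖ ≤ M * ‖WithLp.toLp p fun k => ‖x k‖‖) : PConvexWith p M Z := by
  intro n x
  have he : 0 ≤ ∑ k, |x k| := Finset.sum_nonneg fun k _ => abs_nonneg _
  obtain ⟨K, _, _, Φ, hΦ, -, hΦ1, hsurj⟩ := exists_continuousMap_representation he
  choose g hg using fun k => hsurj (x k) ⟨1, by
    rw [one_smul]
    exact Finset.single_le_sum (f := fun k => |x k|) (fun k _ => abs_nonneg _) (Finset.mem_univ k)⟩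
  obtain rfl : (fun k => Φ (g k)) = x := funext hg
  refine ⟨Φ (lpFun p g), isLpSum_map_lpFun hΦ g, ?_⟩
  have hlim : ∀ ε : ℝ, 0 < ε →
      ‖Φ (lpFun p g)‖ ≤ M * ‖WithLp.toLp p fun k => ‖Φ (g k)‖‖ + ε * ‖Φ 1‖ := fun ε hε => by
    obtain ⟨A, hA, hle⟩ := exists_lpFun_le_supList (p := p) g hε
    have h1 := hΦ.mono hle
    rw [map_add, map_smul, hΦ.map_supList] at h1
    have h2 : ‖Φ (lpFun p g)‖ ≤ ‖(supList A fun k => Φ (g k)) + ε • Φ 1‖ := by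
      refine norm_le_norm_of_abs_le_abs ?_
      have h0 := hΦ.nonneg (lpFun_nonneg (p := p) g)
      rwa [abs_of_nonneg h0, abs_of_nonneg (h0.trans h1)]
    refine h2.trans ((norm_add_le _ _).trans (add_le_add (h n _ A hA) ?_))
    rw [norm_smul, Real.norm_of_nonneg hε.le]
  refine le_of_forall_pos_le_add fun δ hδ => ?_
  refine (hlim (δ / (‖Φ 1‖ + 1)) (by positivity)).trans ?_
  gcongr
  rw [div_mul_eq_mul_div, div_le_iff₀ (by positivity)]
  gcongr
  linarith

theorem PConvexWith.norm_supList_le {M : ℝ} (hZ : PConvexWith p M Z) (x : Fin n → Z)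
    {A : List (Fin n → ℝ)} (hA : ∀ a ∈ A, DualBall p a) :
    ‖supList A x‖ ≤ M * ‖WithLp.toLp p fun k => ‖x k‖‖ := by
  obtain ⟨s, hs, hle⟩ := hZ n x
  refine le_trans (norm_le_norm_of_abs_le_abs ?_) hle
  have hs0 : 0 ≤ s := hs.1 ⟨0, dualBall_zero, by simp⟩
  rw [abs_of_nonneg supList_nonneg, abs_of_nonneg hs0]
  exact supList_le hs0 fun a ha => hs.1 ⟨a, hA a ha, rfl⟩

end LpFun

/-! ### Closed vector sublattices of spaces of continuous functions -/

section FunctionSublattice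

variable {K : Type v} [TopologicalSpace K] [CompactSpace K]

/-- Closed vector sublattices of `C(K)` that contain the constants. -/
structure IsUnitalSublattice (L : Submodule ℝ C(K, ℝ)) : Prop where
  one_mem : (1 : C(K, ℝ)) ∈ L
  sup_mem : ∀ f ∈ L, ∀ g ∈ L, f ⊔ g ∈ L
  isClosed : IsClosed (L : Set C(K, ℝ))

theorem IsUnitalSublattice.inf_mem {L : Submodule ℝ C(K, ℝ)} (hL : IsUnitalSublattice L)
    {f g : C(K, ℝ)} (hf : f ∈ L) (hg : g ∈ L) : f ⊓ g ∈ L := by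
  rw [← neg_neg (f ⊓ g), neg_inf]
  exact neg_mem (hL.sup_mem _ (neg_mem hf) _ (neg_mem hg))

/-- The joint values of finitely many functions. -/
def jointRange {m : ℕ} (η : Fin m → C(K, ℝ)) : Set (Fin m → ℝ) :=
  Set.range fun ω k => η k ω

/-- Finitely many functions as a map onto their joint range. -/
def jointMap {m : ℕ} (η : Fin m → C(K, ℝ)) : C(K, jointRange η) where
  toFun ω := ⟨fun k => η k ω, ω, rfl⟩
  continuous_toFun := (continuous_pi fun k => (η k).continuous).subtype_mk _

instance {m : ℕ} (η : Fin m → C(K, ℝ)) : CompactSpace (jointRange η) :=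
  isCompact_iff_compactSpace.1 (isCompact_range (continuous_pi fun k => (η k).continuous))

/-- Closed unital sublattices of `C(K)` are stable under the continuous functional calculus in
finitely many variables. -/
theorem IsUnitalSublattice.comp_mem {L : Submodule ℝ C(K, ℝ)} (hL : IsUnitalSublattice L) {m : ℕ}
    {η : Fin m → C(K, ℝ)} (hη : ∀ k, η k ∈ L) (ψ : C(jointRange η, ℝ)) :
    ψ.comp (jointMap η) ∈ L := by
  let S : Set C(jointRange η, ℝ) := {φ | φ.comp (jointMap η) ∈ L}
  have hS : IsClosed S := hL.isClosed.preimage (ContinuousMap.continuous_precomp (jointMap η))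
  have key : closure S = ⊤ := by
    refine ContinuousMap.sublattice_closure_eq_top S ⟨0, L.zero_mem⟩ ?_ ?_ ?_
    · exact fun f hf g hg => hL.inf_mem (f := f.comp _) (g := g.comp _) hf hg
    · exact fun f hf g hg => hL.sup_mem (f.comp _) hf (g.comp _) hg
    · intro v x y
      have hc : ∀ c : ℝ, ContinuousMap.const _ c ∈ S := fun c => by
        have h1 : c • (1 : C(K, ℝ)) ∈ L := L.smul_mem c hL.one_mem
        have h2 : (ContinuousMap.const _ c).comp (jointMap η) = c • (1 : C(K, ℝ)) := by
          ext ω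
          simp
        change (ContinuousMap.const _ c).comp (jointMap η) ∈ L
        rwa [h2]
      rcases eq_or_ne x y with rfl | hxy
      · exact ⟨_, hc (v x), rfl, rfl⟩
      · obtain ⟨k, hk⟩ : ∃ k, x.1 k ≠ y.1 k := by
          by_contra! h
          exact hxy (Subtype.ext (funext h))
        have hk' : x.1 k - y.1 k ≠ 0 := sub_ne_zero.2 hk
        let πk : C(jointRange η, ℝ) :=
          ⟨fun z => z.1 k, (continuous_apply k).comp continuous_subtype_val⟩
        have hπ : πk ∈ S := hη k
        refine ⟨((v x - v y) / (x.1 k - y.1 k)) • πk +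
          ContinuousMap.const _ (v x - (v x - v y) / (x.1 k - y.1 k) * x.1 k), ?_, ?_, ?_⟩
        · exact L.add_mem (L.smul_mem _ hπ) (hc _)
        · simp [πk]
        · simp only [ContinuousMap.add_apply, ContinuousMap.smul_apply, ContinuousMap.const_apply,
            smul_eq_mul, πk, ContinuousMap.coe_mk]
          field_simp
          ring
  have : ψ ∈ closure S := by rw [key]; trivial
  rwa [hS.closure_eq] at this

theorem IsUnitalSublattice.lpFun_mem {L : Submodule ℝ C(K, ℝ)} (hL : IsUnitalSublattice L)
    {p : ℝ≥0∞} [Fact (1 ≤ p)] {m : ℕ} {η : Fin m → C(K, ℝ)} (hη : ∀ k, η k ∈ L) :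
    lpFun p η ∈ L :=
  hL.comp_mem hη ⟨fun z => ‖WithLp.toLp p z.1‖,
    ((PiLp.continuous_toLp p _).comp continuous_subtype_val).norm⟩

/-- Partitions of unity in `L` on whose members the given functions of `L` oscillate little. -/
theorem IsUnitalSublattice.exists_partition {L : Submodule ℝ C(K, ℝ)} (hL : IsUnitalSublattice L)
    {m : ℕ} {η : Fin m → C(K, ℝ)} (hη : ∀ k, η k ∈ L) {ε : ℝ} (hε : 0 < ε) :
    ∃ (N : ℕ) (f : Fin N → C(K, ℝ)) (c : Fin N → Fin m → ℝ), (∀ i, f i ∈ L) ∧ (∀ i, 0 ≤ f i) ∧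
      ∑ i, f i = 1 ∧ ∀ i k ω, 0 < f i ω → |η k ω - c i k| ≤ ε := by
  obtain ⟨t, hcov⟩ : ∃ t : Finset (jointRange η),
      ∀ x : jointRange η, ∃ y ∈ t, dist x y < ε := by
    obtain ⟨t, -, htf, ht⟩ := finite_cover_balls_of_compact
      (isCompact_univ (X := jointRange η)) hε
    refine ⟨htf.toFinset, fun x => ?_⟩
    obtain ⟨y, hy, hxy⟩ := Set.mem_iUnion₂.1 (ht (Set.mem_univ x))
    exact ⟨y, htf.mem_toFinset.2 hy, hxy⟩
  let y : Fin t.card → jointRange η := fun i => (t.equivFin.symm i).1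
  let b : Fin t.card → jointRange η → ℝ := fun i x => max 0 (ε - dist x (y i))
  have hb0 : ∀ i x, 0 ≤ b i x := fun i x => le_max_left _ _
  have hbc : ∀ i, Continuous (b i) := fun i => by fun_prop
  have hpos : ∀ x, 0 < ∑ i, b i x := fun x => by
    obtain ⟨z, hz, hxz⟩ := hcov x
    refine Finset.sum_pos' (fun i _ => hb0 i x) ⟨t.equivFin ⟨z, hz⟩, Finset.mem_univ _, ?_⟩
    refine lt_max_of_lt_right (sub_pos.2 ?_)
    simpa [y] using hxz
  let ψ : Fin t.card → C(jointRange η, ℝ) := fun i =>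
    ⟨fun x => b i x / ∑ j, b j x, (hbc i).div (continuous_finsetSum _ fun j _ => hbc j)
      fun x => (hpos x).ne'⟩
  refine ⟨t.card, fun i => (ψ i).comp (jointMap η), fun i => (y i).1,
    fun i => hL.comp_mem hη (ψ i), fun i ω => div_nonneg (hb0 _ _) (hpos _).le, ?_, ?_⟩
  · ext ω
    rw [ContinuousMap.coe_sum, Finset.sum_apply]
    change ∑ i, b i (jointMap η ω) / ∑ j, b j (jointMap η ω) = 1
    rw [← Finset.sum_div, div_self (hpos _).ne']
  · intro i k ω hω
    have h1 : 0 < b i (jointMap η ω) := by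
      have h2 : 0 < b i (jointMap η ω) / ∑ j, b j (jointMap η ω) := hω
      exact (div_pos_iff_of_pos_right (hpos _)).1 h2
    have h3 : 0 < ε - dist (jointMap η ω) (y i) := (lt_max_iff.1 h1).resolve_left (lt_irrefl 0)
    have h4 : dist (η k ω) ((y i).1 k) ≤ dist (jointMap η ω) (y i) :=
      dist_le_pi_dist (jointMap η ω).1 (y i).1 k
    rw [Real.dist_eq] at h4
    linarith

end FunctionSublattice

/-! ### Functionals that dominate the norm on the `p`-concavification -/

section Domination

variable {p : ℝ≥0∞} [Fact (1 ≤ p)] {K : Type v} [TopologicalSpace K]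

/-- The function `|g|^p`. -/
noncomputable def powFun (p : ℝ≥0∞) (g : C(K, ℝ)) : C(K, ℝ) where
  toFun ω := |g ω| ^ p.toReal
  continuous_toFun := g.continuous.abs.rpow_const fun _ => Or.inr ENNReal.toReal_nonneg

theorem powFun_apply (g : C(K, ℝ)) (ω : K) : powFun p g ω = |g ω| ^ p.toReal := rfl

theorem powFun_nonneg (g : C(K, ℝ)) : 0 ≤ powFun p g := fun _ => Real.rpow_nonneg (abs_nonneg _) _

theorem powFun_lpFun (hp : p ≠ ∞) {n : ℕ} (g : Fin n → C(K, ℝ)) :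
    powFun p (lpFun p g) = ∑ k, powFun p (g k) := by
  ext ω
  rw [ContinuousMap.coe_sum, Finset.sum_apply, powFun_apply, lpFun_apply, abs_norm,
    norm_toLp_rpow hp]
  rfl

theorem powFun_smul {c : ℝ} (hc : 0 ≤ c) (g : C(K, ℝ)) :
    powFun p (c • g) = c ^ p.toReal • powFun p g := by
  ext ω
  simp [powFun_apply, abs_mul, Real.mul_rpow hc (abs_nonneg _), abs_of_nonneg hc]

variable {Z : Type u} [NormedAddCommGroup Z] [NormedSpace ℝ Z] [Lattice Z]
  [IsOrderedAddMonoid Z] [IsOrderedModule ℝ Z] [HasSolidNorm Z] [CompactSpace K]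
  {Φ : C(K, ℝ) →ₗ[ℝ] Z}

/-- The cone of pairs `(f, r)` on which `(f, r) ↦ r - μ f` has to be nonnegative for a positive
functional `μ` with `μ (|g|^p) ≤ (M ‖Φ g‖)^p` for all `g` and `t ≤ μ f` for all `(f, t)` in `D`. -/
noncomputable def dominationCone (hp : p ≠ ∞) {M : ℝ} (hM : 0 ≤ M) (Φ : C(K, ℝ) →ₗ[ℝ] Z)
    (D : PointedCone ℝ (C(K, ℝ) × ℝ)) : PointedCone ℝ (C(K, ℝ) × ℝ) where
  carrier := {x | ∃ d ∈ D, ∃ (n : ℕ) (g : Fin n → C(K, ℝ)), x.1 + d.1 ≤ ∑ k, powFun p (g k) ∧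
    ∑ k, (M * ‖Φ (g k)‖) ^ p.toReal ≤ x.2 + d.2}
  add_mem' := by
    rintro x y ⟨d, hd, n, g, h1, h2⟩ ⟨e, he, m, h, h3, h4⟩
    refine ⟨d + e, add_mem hd he, n + m, Fin.append g h, ?_, ?_⟩
    · simp only [Fin.sum_univ_add, Fin.append_left, Fin.append_right, Prod.fst_add]
      rw [add_add_add_comm]
      exact add_le_add h1 h3
    · simp only [Fin.sum_univ_add, Fin.append_left, Fin.append_right, Prod.snd_add]
      rw [add_add_add_comm]
      exact add_le_add h2 h4
  zero_mem' := ⟨0, zero_mem _, 0, Fin.elim0, by simp, by simp⟩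
  smul_mem' := by
    rintro ⟨c, hc⟩ x ⟨d, hd, n, g, h1, h2⟩
    have hc' : 0 ≤ c ^ p.toReal⁻¹ := Real.rpow_nonneg hc _
    have hcp : (c ^ p.toReal⁻¹) ^ p.toReal = c := Real.rpow_inv_rpow hc (toReal_pos' hp).ne'
    refine ⟨(⟨c, hc⟩ : {c : ℝ // 0 ≤ c}) • d, Submodule.smul_mem _ _ hd, n,
      fun k => c ^ p.toReal⁻¹ • g k, ?_, ?_⟩
    · simp only [powFun_smul hc', hcp, ← Finset.smul_sum]
      change c • x.1 + c • d.1 ≤ _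
      rw [← smul_add]
      exact fun ω => mul_le_mul_of_nonneg_left (h1 ω) hc
    · have h3 : ∀ k, (M * ‖Φ (c ^ p.toReal⁻¹ • g k)‖) ^ p.toReal =
          c * (M * ‖Φ (g k)‖) ^ p.toReal := fun k => by
        rw [map_smul, norm_smul, Real.norm_of_nonneg hc', mul_left_comm,
          Real.mul_rpow hc' (mul_nonneg hM (norm_nonneg _)), hcp]
      simp only [h3, ← Finset.mul_sum]
      change _ ≤ c • x.2 + c • d.2
      rw [← smul_add]
      exact mul_le_mul_of_nonneg_left h2 hc

/-- If `Z` is `p`-convex, a superlinear lower bound on the functions `|g|^p` that is compatible with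
the norm can be separated from the norm by a positive functional. -/
theorem PConvexWith.exists_functional (hp : p ≠ ∞) {M C : ℝ} (hM : 0 ≤ M) (hC : 0 ≤ C)
    (hZ : PConvexWith p M Z) (hΦ : IsLatticeHom Φ) (D : PointedCone ℝ (C(K, ℝ) × ℝ))
    (hD : ∀ d ∈ D, ∀ g : C(K, ℝ), 0 ≤ g → d.1 ≤ powFun p g → d.2 ≤ (C * ‖Φ g‖) ^ p.toReal) :
    ∃ μ : C(K, ℝ) →ₗ[ℝ] ℝ, (∀ f, 0 ≤ f → 0 ≤ μ f) ∧
      (∀ g, μ (powFun p g) ≤ (C * M * ‖Φ g‖) ^ p.toReal) ∧ ∀ d ∈ D, d.2 ≤ μ d.1 := by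
  have hr := toReal_pos' hp
  obtain ⟨G, hG, hGs⟩ := riesz_extension (dominationCone hp (mul_nonneg hC hM) Φ D)
    (⟨LinearMap.ker (LinearMap.fst ℝ C(K, ℝ) ℝ),
      (LinearMap.snd ℝ C(K, ℝ) ℝ) ∘ₗ Submodule.subtype _⟩ : C(K, ℝ) × ℝ →ₗ.[ℝ] ℝ) (by
    rintro ⟨⟨f, r⟩, (rfl : f = 0)⟩ ⟨d, hd, n, g, h1, h2⟩
    rw [zero_add, ← powFun_lpFun hp] at h1
    have h3 := hD d hd _ (lpFun_nonneg g) h1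
    have h4 : (C * ‖Φ (lpFun p g)‖) ^ p.toReal ≤ ∑ k, (C * M * ‖Φ (g k)‖) ^ p.toReal := by
      refine (Real.rpow_le_rpow (mul_nonneg hC (norm_nonneg _))
        (mul_le_mul_of_nonneg_left (hZ.norm_map_lpFun_le hΦ g) hC) hr.le).trans ?_
      rw [← mul_assoc, Real.mul_rpow (mul_nonneg hC hM) (norm_nonneg _), norm_toLp_rpow hp,
        Finset.mul_sum]
      refine Finset.sum_le_sum fun k _ => ?_
      rw [Real.mul_rpow (mul_nonneg hC hM) (norm_nonneg _), abs_norm]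
    change 0 ≤ r
    simp only at h2
    linarith) (by
    rintro ⟨f, t⟩
    let g : C(K, ℝ) := ContinuousMap.const K (‖f‖ ^ p.toReal⁻¹)
    refine ⟨⟨(0, (C * M * ‖Φ g‖) ^ p.toReal - t), rfl⟩, 0, zero_mem _, 1, fun _ => g, ?_, ?_⟩
    · intro ω
      have h1 : powFun p g ω = ‖f‖ := by
        rw [powFun_apply, ContinuousMap.const_apply, abs_of_nonneg (by positivity),
          Real.rpow_inv_rpow (norm_nonneg _) hr.ne']
      have h2 := (le_abs_self _).trans (f.norm_coe_le_norm ω)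
      simpa [h1] using h2
    · simp)
  have hG2 : ∀ r : ℝ, G (0, r) = r := fun r => hG ⟨(0, r), rfl⟩
  have hGs' : ∀ f r, (f, r) ∈ dominationCone hp (mul_nonneg hC hM) Φ D → -G (f, 0) ≤ r := by
    intro f r h
    have h1 := hGs _ h
    have h2 : ((f, r) : C(K, ℝ) × ℝ) = (f, 0) + (0, r) := by simp
    rw [h2, map_add, hG2] at h1
    linarith
  refine ⟨-(G ∘ₗ LinearMap.inl ℝ C(K, ℝ) ℝ), fun f hf => ?_, fun g => ?_, fun d hd => ?_⟩
  · have h1 := hGs' (-f) 0 ⟨0, zero_mem _, 0, Fin.elim0, by simpa using hf, by simp⟩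
    have h2 : ((-f, 0) : C(K, ℝ) × ℝ) = -(f, 0) := by simp
    rw [h2, map_neg] at h1
    change 0 ≤ -G (f, 0)
    linarith
  · exact hGs' _ _ ⟨0, zero_mem _, 1, fun _ => g, by simp, by simp⟩
  · have h1 := hGs' (-d.1) (-d.2) ⟨d, hd, 0, Fin.elim0, by simp, by simp⟩
    have h2 : ((-d.1, 0) : C(K, ℝ) × ℝ) = -(d.1, 0) := by simp
    rw [h2, map_neg] at h1
    change d.2 ≤ -G (d.1, 0)
    linarith

/-! ### Averages with respect to a positive functional -/

/-- Jensen's inequality for the average `μ (ζ f) / μ f`. -/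
theorem average_rpow_le {μ : C(K, ℝ) →ₗ[ℝ] ℝ} (hμ : ∀ f, 0 ≤ f → 0 ≤ μ f) (hp : p ≠ ∞)
    {ζ f : C(K, ℝ)} (hζ : 0 ≤ ζ) (hf : 0 ≤ f) :
    (μ (ζ * f) / μ f) ^ p.toReal * μ f ≤ μ (powFun p ζ * f) := by
  have hr := one_le_toReal hp
  set m := μ (ζ * f) / μ f with hm
  have hnn : 0 ≤ μ (powFun p ζ * f) := hμ _ (mul_nonneg (powFun_nonneg ζ) hf)
  rcases (hμ f hf).eq_or_lt with h0 | h0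
  · rw [← h0, mul_zero]
    exact hnn
  have hm0 : 0 ≤ m := div_nonneg (hμ _ (mul_nonneg hζ hf)) h0.le
  rcases hm0.eq_or_lt with hm1 | hm1
  · rw [← hm1, Real.zero_rpow (by linarith), zero_mul]
    exact hnn
  have hmf : μ (ζ * f) = m * μ f := by rw [hm, div_mul_cancel₀ _ h0.ne']
  -- the tangent of `t ↦ t ^ p` at `m`
  have key : ∀ t : ℝ, 0 ≤ t →
      m ^ p.toReal + p.toReal * m ^ (p.toReal - 1) * (t - m) ≤ t ^ p.toReal := fun t ht => by
    have h1 := one_add_mul_self_le_rpow_one_add (s := t / m - 1)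
      (by have := div_nonneg ht hm1.le; linarith) hr
    rw [add_sub_cancel, Real.div_rpow ht hm1.le, le_div_iff₀ (by positivity)] at h1
    refine le_trans (le_of_eq ?_) h1
    rw [Real.rpow_sub_one hm1.ne']
    field_simp
  have h2 : (m ^ p.toReal) • f + (p.toReal * m ^ (p.toReal - 1)) • (ζ * f - m • f) ≤
      powFun p ζ * f := fun ω => by
    have hζω : 0 ≤ ζ ω := hζ ω
    have hfω : 0 ≤ f ω := hf ω
    have := mul_le_mul_of_nonneg_right (key (ζ ω) hζω) hfω
    change m ^ p.toReal * f ω + p.toReal * m ^ (p.toReal - 1) * (ζ ω * f ω - m * f ω) ≤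
      |ζ ω| ^ p.toReal * f ω
    rw [abs_of_nonneg hζω]
    refine le_trans (le_of_eq ?_) this
    ring
  have h3 := hμ _ (sub_nonneg.2 h2)
  rw [map_sub, map_add, map_smul, map_smul, map_sub, map_smul, hmf] at h3
  simp only [smul_eq_mul, sub_self, mul_zero, add_zero] at h3
  linarith

end Domination

/-! ### The key inequality for positive operators into `ℓ^p` -/

section KeyInequality

variable {p : ℝ≥0∞} [Fact (1 ≤ p)] {K : Type v} [TopologicalSpace K] [CompactSpace K]
  {Z : Type u} [NormedAddCommGroup Z] [NormedSpace ℝ Z] [Lattice Z]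
  [IsOrderedAddMonoid Z] [IsOrderedModule ℝ Z] [HasSolidNorm Z] {Φ : C(K, ℝ) →ₗ[ℝ] Z}
  {L : Submodule ℝ C(K, ℝ)} {N : ℕ} {τ : Fin N → L →ₗ[ℝ] ℝ}

/-- Positive functionals are `p`-superadditive. -/
theorem norm_toLp_le_map_lpFun (hL : IsUnitalSublattice L) {σ : L →ₗ[ℝ] ℝ}
    (hσ : ∀ h : L, 0 ≤ (h : C(K, ℝ)) → 0 ≤ σ h) {n : ℕ} (h : Fin n → L) :
    ‖WithLp.toLp p fun k => σ (h k)‖ ≤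
      σ ⟨lpFun p fun k => (h k : C(K, ℝ)), hL.lpFun_mem fun k => (h k).2⟩ := by
  obtain ⟨a, ha, hat⟩ := exists_dualBall_eq_norm (p := p) fun k => σ (h k)
  have h1 := hσ (⟨lpFun p fun k => (h k : C(K, ℝ)), hL.lpFun_mem fun k => (h k).2⟩ -
    ∑ k, a k • h k) (by
      have := sum_smul_le_lpFun (p := p) ha fun k => (h k : C(K, ℝ))
      rw [AddSubgroupClass.coe_sub, AddSubmonoidClass.coe_finsetSum]
      exact sub_nonneg.2 this)
  rw [map_sub, map_sum] at h1
  simp only [map_smul, smul_eq_mul] at h1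
  linarith

/-- The pairs `(f, t)` for which there is `h ≥ 0` in `L` with `h^p ≤ f` and `t ≤ ∑ (τ n h)^p`. -/
noncomputable def operatorCone (hp : p ≠ ∞) (hL : IsUnitalSublattice L)
    (hτ : ∀ n, ∀ h : L, 0 ≤ (h : C(K, ℝ)) → 0 ≤ τ n h) : PointedCone ℝ (C(K, ℝ) × ℝ) where
  carrier := {x | ∃ h : L, 0 ≤ (h : C(K, ℝ)) ∧ powFun p (h : C(K, ℝ)) ≤ x.1 ∧
    x.2 ≤ ∑ n, (τ n h) ^ p.toReal}
  add_mem' := by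
    rintro x y ⟨h, h0, h1, h2⟩ ⟨k, k0, k1, k2⟩
    refine ⟨⟨lpFun p fun i => ((![h, k] i : L) : C(K, ℝ)), hL.lpFun_mem fun i => (![h, k] i).2⟩,
      lpFun_nonneg _, ?_, ?_⟩
    · rw [powFun_lpFun hp]
      simpa using add_le_add h1 k1
    · refine (add_le_add h2 k2).trans ?_
      rw [← Finset.sum_add_distrib]
      refine Finset.sum_le_sum fun n _ => ?_
      have h3 := Real.rpow_le_rpow (norm_nonneg _)
        (norm_toLp_le_map_lpFun (p := p) hL (hτ n) ![h, k]) (toReal_pos' hp).le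
      rw [norm_toLp_rpow hp] at h3
      simpa [abs_of_nonneg (hτ n h h0), abs_of_nonneg (hτ n k k0)] using h3
  zero_mem' := ⟨0, le_rfl, fun ω => by
    simp [powFun_apply, Real.zero_rpow (toReal_pos' hp).ne'], by
    simp [Real.zero_rpow (toReal_pos' hp).ne']⟩
  smul_mem' := by
    rintro ⟨c, hc⟩ x ⟨h, h0, h1, h2⟩
    have hc' : 0 ≤ c ^ p.toReal⁻¹ := Real.rpow_nonneg hc _
    have hcp : (c ^ p.toReal⁻¹) ^ p.toReal = c := Real.rpow_inv_rpow hc (toReal_pos' hp).ne'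
    refine ⟨c ^ p.toReal⁻¹ • h, fun ω => mul_nonneg hc' (h0 ω), ?_, ?_⟩
    · rw [Submodule.coe_smul, powFun_smul hc', hcp]
      exact fun ω => mul_le_mul_of_nonneg_left (h1 ω) hc
    · simp only [map_smul, smul_eq_mul]
      refine (mul_le_mul_of_nonneg_left h2 hc).trans (le_of_eq ?_)
      rw [Finset.mul_sum]
      refine Finset.sum_congr rfl fun n _ => ?_
      rw [Real.mul_rpow hc' (hτ n h h0), hcp]

theorem powFun_le_iff (hp : p ≠ ∞) {g h : C(K, ℝ)} (hg : 0 ≤ g) (hh : 0 ≤ h) :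
    powFun p h ≤ powFun p g ↔ h ≤ g := by
  refine forall_congr' fun ω => ?_
  have h1 : 0 ≤ g ω := hg ω
  have h2 : 0 ≤ h ω := hh ω
  change |h ω| ^ p.toReal ≤ |g ω| ^ p.toReal ↔ h ω ≤ g ω
  rw [abs_of_nonneg h1, abs_of_nonneg h2, Real.rpow_le_rpow_iff h2 h1 (toReal_pos' hp)]

/-- A positive functional on `C(K)` that lies between a positive operator into `ℓ^p` and the norm:
the factorization of the operator through an `L^p`-space. -/
theorem exists_factorizing_functional (hp : p ≠ ∞) {M C : ℝ} (hM : 0 ≤ M) (hC : 0 ≤ C)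
    (hZ : PConvexWith p M Z) (hΦ : IsLatticeHom Φ) (hL : IsUnitalSublattice L)
    (hτ : ∀ n, ∀ h : L, 0 ≤ (h : C(K, ℝ)) → 0 ≤ τ n h)
    (hτC : ∀ h : L, ‖WithLp.toLp p fun n => τ n h‖ ≤ C * ‖Φ h‖) :
    ∃ μ : C(K, ℝ) →ₗ[ℝ] ℝ, (∀ f, 0 ≤ f → 0 ≤ μ f) ∧
      (∀ g, μ (powFun p g) ≤ (C * M * ‖Φ g‖) ^ p.toReal) ∧
      ∀ h : L, 0 ≤ (h : C(K, ℝ)) →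
        ‖WithLp.toLp p fun n => τ n h‖ ^ p.toReal ≤ μ (powFun p (h : C(K, ℝ))) := by
  have hpow : ∀ h : L, 0 ≤ (h : C(K, ℝ)) →
      ‖WithLp.toLp p fun n => τ n h‖ ^ p.toReal = ∑ n, (τ n h) ^ p.toReal := fun h hh => by
    rw [norm_toLp_rpow hp]
    exact Finset.sum_congr rfl fun n _ => by rw [abs_of_nonneg (hτ n h hh)]
  obtain ⟨μ, h1, h2, h3⟩ := hZ.exists_functional hp hM hC hΦ (operatorCone hp hL hτ) (by
    rintro ⟨f, t⟩ ⟨h, h0, h1, h2⟩ g hg hfg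
    have h3 : (h : C(K, ℝ)) ≤ g := (powFun_le_iff hp hg h0).1 (h1.trans hfg)
    refine h2.trans ?_
    rw [← hpow h h0]
    refine Real.rpow_le_rpow (norm_nonneg _) ((hτC h).trans ?_) (toReal_pos' hp).le
    refine mul_le_mul_of_nonneg_left (norm_le_norm_of_abs_le_abs ?_) hC
    rw [abs_of_nonneg (hΦ.nonneg h0), abs_of_nonneg (hΦ.nonneg hg)]
    exact hΦ.mono h3)
  refine ⟨μ, h1, h2, fun h hh => ?_⟩
  rw [hpow h hh]
  exact h3 (powFun p (h : C(K, ℝ)), ∑ n, (τ n h) ^ p.toReal) ⟨h, hh, le_rfl, le_rfl⟩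

theorem powFun_sum_smul_le (hp : p ≠ ∞) {m : ℕ} {f : Fin m → C(K, ℝ)} (hf : ∀ i, 0 ≤ f i)
    (hf1 : ∑ i, f i = 1) {c : Fin m → ℝ} (hc : ∀ i, 0 ≤ c i) :
    powFun p (∑ i, c i • f i) ≤ ∑ i, c i ^ p.toReal • f i := fun ω => by
  have hfω : ∀ i, 0 ≤ f i ω := fun i => hf i ω
  have h1 : (∑ i, c i • f i) ω = ∑ i, f i ω * c i := by simp [ContinuousMap.coe_sum, mul_comm]
  have h2 : (∑ i, c i ^ p.toReal • f i) ω = ∑ i, f i ω * c i ^ p.toReal := by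
    simp [ContinuousMap.coe_sum, mul_comm]
  have h3 : ∑ i, f i ω = 1 := by
    have := congrArg (fun g : C(K, ℝ) => g ω) hf1
    simpa [ContinuousMap.coe_sum] using this
  change |(∑ i, c i • f i) ω| ^ p.toReal ≤ (∑ i, c i ^ p.toReal • f i) ω
  rw [h1, h2, abs_of_nonneg (Finset.sum_nonneg fun i _ => mul_nonneg (hfω i) (hc i))]
  exact Real.rpow_arith_mean_le_arith_mean_rpow _ _ _ (fun i _ => hfω i) h3 (fun i _ => hc i)
    (one_le_toReal hp)

theorem sum_average_rpow_le {μ : C(K, ℝ) →ₗ[ℝ] ℝ} (hμ : ∀ f, 0 ≤ f → 0 ≤ μ f) (hp : p ≠ ∞)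
    {m : ℕ} {f : Fin m → C(K, ℝ)} (hf : ∀ i, 0 ≤ f i) (hf1 : ∑ i, f i = 1) {ζ : C(K, ℝ)}
    (hζ : 0 ≤ ζ) :
    ∑ i, (μ (ζ * f i) / μ (f i)) ^ p.toReal * μ (f i) ≤ μ (powFun p ζ) := by
  refine (Finset.sum_le_sum fun i _ => average_rpow_le hμ hp hζ (hf i)).trans (le_of_eq ?_)
  rw [← map_sum, ← Finset.mul_sum, hf1, mul_one]

/-- The key inequality in a space of continuous functions. A conditional expectation onto a
partition of unity in `L` replaces the functions `ζ j` by elements of `L`. -/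
theorem sum_map_le_of_le_sum (hp : p ≠ ∞) {M C : ℝ} (hM : 0 ≤ M) (hC : 0 ≤ C)
    (hZ : PConvexWith p M Z) (hΦ : IsLatticeHom Φ) (hL : IsUnitalSublattice L)
    (hτ : ∀ n, ∀ h : L, 0 ≤ (h : C(K, ℝ)) → 0 ≤ τ n h)
    (hτC : ∀ h : L, ‖WithLp.toLp p fun n => τ n h‖ ≤ C * ‖Φ h‖) {J : ℕ} {η : Fin N → L}
    {ζ : Fin J → C(K, ℝ)} (hζ : ∀ j, 0 ≤ ζ j) {b : Fin J → Fin N → ℝ} (hb : ∀ j, DualBall p (b j))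
    (hle : ∀ n, (η n : C(K, ℝ)) ≤ ∑ j, b j n • ζ j) :
    ∑ n, τ n (η n) ≤ C * M * ∑ j, ‖Φ (ζ j)‖ := by
  obtain ⟨μ, hμ, hμΦ, hμτ⟩ := exists_factorizing_functional hp hM hC hZ hΦ hL hτ hτC
  have hr := toReal_pos' hp
  have hmono : ∀ n (g h : L), (g : C(K, ℝ)) ≤ h → τ n g ≤ τ n h := fun n g h hgh => by
    have := hτ n (h - g) (sub_nonneg.2 hgh)
    rw [map_sub] at this
    linarith
  have hμmono : ∀ {g h : C(K, ℝ)}, g ≤ h → μ g ≤ μ h := fun {g h} hgh => by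
    have := hμ (h - g) (sub_nonneg.2 hgh)
    rw [map_sub] at this
    linarith
  have key : ∀ ε : ℝ, 0 < ε → ∑ n, τ n (η n) ≤
      C * M * ∑ j, ‖Φ (ζ j)‖ + ε * (2 * ∑ n, τ n ⟨1, hL.one_mem⟩) := fun ε hε => by
    obtain ⟨m, f, c, hfL, hf, hf1, hosc⟩ := hL.exists_partition (fun n => (η n).2) hε
    let F : Fin m → L := fun i => ⟨f i, hfL i⟩
    have hF1 : ∑ i, F i = ⟨1, hL.one_mem⟩ := Subtype.ext (by simpa [F] using hf1)
    have hsum1 : ∀ ω, ∑ i, f i ω = 1 := fun ω => by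
      have := congrArg (fun g : C(K, ℝ) => g ω) hf1
      simpa [ContinuousMap.coe_sum] using this
    have hfω : ∀ i ω, 0 ≤ f i ω := fun i ω => hf i ω
    let l : Fin m → Fin J → ℝ := fun i j => μ (ζ j * f i) / μ (f i)
    have hl : ∀ i j, 0 ≤ l i j := fun i j =>
      div_nonneg (hμ _ (mul_nonneg (hζ j) (hf i))) (hμ _ (hf i))
    have h1 : ∀ n, τ n (η n) ≤ ∑ i, (c i n + ε) * τ n (F i) := fun n => by
      have h2 : (η n : C(K, ℝ)) ≤ ((∑ i, (c i n + ε) • F i : L) : C(K, ℝ)) := fun ω => by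
        have h3 : ((∑ i, (c i n + ε) • F i : L) : C(K, ℝ)) ω = ∑ i, (c i n + ε) * f i ω := by
          rw [AddSubmonoidClass.coe_finsetSum, ContinuousMap.coe_sum, Finset.sum_apply]
          rfl
        change (η n : C(K, ℝ)) ω ≤ ((∑ i, (c i n + ε) • F i : L) : C(K, ℝ)) ω
        rw [h3, ← mul_one ((η n : C(K, ℝ)) ω), ← hsum1 ω, Finset.mul_sum]
        refine Finset.sum_le_sum fun i _ => ?_
        rcases (hfω i ω).eq_or_lt with h0 | h0
        · simp [← h0]
        · have := (abs_le.1 (hosc i n ω h0)).2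
          exact mul_le_mul_of_nonneg_right (by linarith) h0.le
      refine (hmono n _ _ h2).trans (le_of_eq ?_)
      rw [map_sum]
      simp only [map_smul, smul_eq_mul]
    have h2 : ∀ n i, (c i n + ε) * τ n (F i) ≤ (2 * ε + ∑ j, b j n * l i j) * τ n (F i) := by
      intro n i
      rcases (hμ _ (hf i)).eq_or_lt with h0 | h0
      · -- `τ n` vanishes on the members of the partition on which `μ` vanishes
        have h3 : ‖WithLp.toLp p fun n => τ n (F i)‖ ^ p.toReal ≤ 0 := by
          refine (hμτ (F i) (hf i)).trans ?_
          rw [h0]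
          refine hμmono fun ω => ?_
          have hle1 : f i ω ≤ 1 := by
            rw [← hsum1 ω]
            exact Finset.single_le_sum (f := fun i => f i ω) (fun i _ => hfω i ω)
              (Finset.mem_univ i)
          change |f i ω| ^ p.toReal ≤ f i ω
          rw [abs_of_nonneg (hfω i ω)]
          exact Real.rpow_le_self_of_le_one (hfω i ω) hle1 (one_le_toReal hp)
        rw [norm_toLp_rpow hp] at h3
        have h4 := (Finset.single_le_sum (f := fun n => |τ n (F i)| ^ p.toReal)
          (fun n _ => Real.rpow_nonneg (abs_nonneg _) _) (Finset.mem_univ n)).trans h3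
        have h5 : τ n (F i) = 0 := by
          by_contra hne
          exact absurd h4 (not_le.2 (Real.rpow_pos_of_pos (abs_pos.2 hne) _))
        rw [h5, mul_zero, mul_zero]
      · refine mul_le_mul_of_nonneg_right ?_ (hτ n _ (hf i))
        have h3 : (c i n - ε) • f i ≤ ∑ j, b j n • (ζ j * f i) := fun ω => by
          have h4 : (∑ j, b j n • (ζ j * f i)) ω = (∑ j, b j n • ζ j) ω * f i ω := by
            simp [ContinuousMap.coe_sum, Finset.sum_mul, mul_assoc]
          change (c i n - ε) * f i ω ≤ (∑ j, b j n • (ζ j * f i)) ω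
          rw [h4]
          rcases (hfω i ω).eq_or_lt with h0 | h0
          · simp [← h0]
          · have h5 := (abs_le.1 (hosc i n ω h0)).1
            have h6 : (η n : C(K, ℝ)) ω ≤ (∑ j, b j n • ζ j) ω := hle n ω
            exact mul_le_mul_of_nonneg_right (by linarith) h0.le
        have h4 := hμmono h3
        rw [map_smul, map_sum] at h4
        simp only [map_smul, smul_eq_mul] at h4
        rw [← le_div_iff₀ h0, Finset.sum_div] at h4
        simp only [mul_div_assoc] at h4
        linarith
    let g : Fin J → L := fun j => ∑ i, l i j • F i
    have hg : ∀ j, ((g j : L) : C(K, ℝ)) = ∑ i, l i j • f i := fun j => by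
      simp only [g, AddSubmonoidClass.coe_finsetSum]
      rfl
    have hg0 : ∀ j, 0 ≤ (g j : C(K, ℝ)) := fun j => by
      rw [hg]
      exact Finset.sum_nonneg fun i _ ω => mul_nonneg (hl i j) (hfω i ω)
    have h3 : ∀ j, ∑ n, b j n * τ n (g j) ≤ C * M * ‖Φ (ζ j)‖ := fun j => by
      refine (hb j _).trans ?_
      rw [← Real.rpow_le_rpow_iff (norm_nonneg _)
        (mul_nonneg (mul_nonneg hC hM) (norm_nonneg _)) hr]
      refine (hμτ (g j) (hg0 j)).trans (le_trans ?_ (hμΦ (ζ j)))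
      rw [hg]
      refine (hμmono (powFun_sum_smul_le hp hf hf1 fun i => hl i j)).trans ?_
      rw [map_sum]
      simp only [map_smul, smul_eq_mul]
      exact sum_average_rpow_le hμ hp hf hf1 (hζ j)
    calc ∑ n, τ n (η n) ≤ ∑ n, ∑ i, (2 * ε + ∑ j, b j n * l i j) * τ n (F i) :=
          Finset.sum_le_sum fun n _ => (h1 n).trans (Finset.sum_le_sum fun i _ => h2 n i)
      _ = ∑ j, ∑ n, b j n * τ n (g j) + ε * (2 * ∑ n, τ n ⟨1, hL.one_mem⟩) := by
          rw [← hF1, Finset.sum_comm (s := Finset.univ (α := Fin J))]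
          simp only [g, map_sum, map_smul, smul_eq_mul, Finset.mul_sum, ← Finset.sum_add_distrib]
          refine Finset.sum_congr rfl fun n _ => ?_
          rw [Finset.sum_comm, ← Finset.sum_add_distrib]
          refine Finset.sum_congr rfl fun i _ => ?_
          rw [add_mul, Finset.sum_mul, add_comm]
          congr 1
          · exact Finset.sum_congr rfl fun j _ => by ring
          · ring
      _ ≤ _ := by
          gcongr
          rw [Finset.mul_sum]
          exact Finset.sum_le_sum fun j _ => h3 j
  have h0 : 0 ≤ ∑ n, τ n ⟨1, hL.one_mem⟩ :=
    Finset.sum_nonneg fun n _ => hτ n _ zero_le_one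
  refine le_of_forall_pos_le_add fun δ hδ => ?_
  refine (key (δ / (2 * ∑ n, τ n ⟨1, hL.one_mem⟩ + 1)) (by positivity)).trans ?_
  gcongr
  rw [div_mul_eq_mul_div, div_le_iff₀ (by positivity)]
  gcongr
  linarith

end KeyInequality

/-! ### Extension of positive operators into `ℓ^p` -/

section Extension

variable {p : ℝ≥0∞} [Fact (1 ≤ p)]

theorem inf_sum_le_sum_inf {Z : Type u} [AddCommGroup Z] [Lattice Z] [IsOrderedAddMonoid Z]
    {ι : Type v} (s : Finset ι) {a : ι → Z} (ha : ∀ i ∈ s, 0 ≤ a i) {c : Z} (hc : 0 ≤ c) :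
    c ⊓ ∑ i ∈ s, a i ≤ ∑ i ∈ s, c ⊓ a i := by
  classical
  induction s using Finset.induction_on with
  | empty => simp
  | insert i s hi ih =>
    rw [Finset.sum_insert hi, Finset.sum_insert hi]
    have h2 := ih fun j hj => ha j (Finset.mem_insert_of_mem hj)
    have h0 := ha i (Finset.mem_insert_self i s)
    have h3 : 0 ≤ ∑ j ∈ s, a j := Finset.sum_nonneg fun j hj => ha j (Finset.mem_insert_of_mem hj)
    refine le_trans ?_ (add_le_add_right h2 (c ⊓ a i))
    rw [inf_add, add_inf, add_inf]
    refine le_inf (le_inf ?_ ?_) (le_inf ?_ inf_le_right)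
    · exact inf_le_left.trans (le_add_of_nonneg_left hc)
    · exact inf_le_left.trans (le_add_of_nonneg_right h3)
    · exact inf_le_left.trans (le_add_of_nonneg_left h0)

variable {Z : Type u} [NormedAddCommGroup Z] [NormedSpace ℝ Z] [Lattice Z]
  [IsOrderedAddMonoid Z] [IsOrderedModule ℝ Z] [HasSolidNorm Z]

/-- Vector sublattices that are closed under relatively uniform limits. Norm closed sublattices and
order ideals are of this kind. -/
structure IsUniformlyClosedSublattice (Y : Submodule ℝ Z) : Prop where
  sup_mem : ∀ y ∈ Y, ∀ z ∈ Y, y ⊔ z ∈ Y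
  mem_of_approx : ∀ e ∈ Y, 0 ≤ e → ∀ z, (∀ ε : ℝ, 0 < ε → ∃ y ∈ Y, |z - y| ≤ ε • e) → z ∈ Y

theorem isUniformlyClosedSublattice_of_isClosed {Y : Submodule ℝ Z} (hY : IsClosed (Y : Set Z))
    (hsup : ∀ y ∈ Y, ∀ z ∈ Y, y ⊔ z ∈ Y) : IsUniformlyClosedSublattice Y where
  sup_mem := hsup
  mem_of_approx e _ he z h := by
    change z ∈ (Y : Set Z)
    rw [← hY.closure_eq, Metric.mem_closure_iff]
    intro ε hε
    obtain ⟨y, hy, hzy⟩ := h (ε / (‖e‖ + 1)) (by positivity)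
    refine ⟨y, hy, ?_⟩
    rw [dist_eq_norm]
    have h1 := norm_le_norm_of_abs_le_abs (a := z - y) (b := (ε / (‖e‖ + 1)) • e)
      (hzy.trans (le_abs_self _))
    refine h1.trans_lt ?_
    rw [norm_smul, Real.norm_of_nonneg (by positivity), div_mul_eq_mul_div,
      div_lt_iff₀ (by positivity)]
    exact mul_lt_mul_of_pos_left (lt_add_one _) hε

theorem orderIdeal_isUniformlyClosedSublattice (e : Z) :
    IsUniformlyClosedSublattice (orderIdeal e) where
  sup_mem _ hy _ hz := sup_mem_orderIdeal hy hz
  mem_of_approx d hd hd0 z h := by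
    obtain ⟨y, hy, hzy⟩ := h 1 one_pos
    rw [one_smul] at hzy
    have h1 : z - y ∈ orderIdeal e := orderIdeal_solid hd (hzy.trans (le_abs_self d))
    simpa using add_mem h1 hy

/-- The preimage of a uniformly closed sublattice in a space of continuous functions. -/
theorem IsUniformlyClosedSublattice.comap {Y : Submodule ℝ Z} (hY : IsUniformlyClosedSublattice Y)
    {K : Type v} [TopologicalSpace K] [CompactSpace K] {Φ : C(K, ℝ) →ₗ[ℝ] Z}
    (hΦ : IsLatticeHom Φ) (h1 : Φ 1 ∈ Y) : IsUnitalSublattice (Y.comap Φ) where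
  one_mem := h1
  sup_mem f hf g hg := by
    rw [Submodule.mem_comap, (hΦ f g).1]
    exact hY.sup_mem _ hf _ hg
  isClosed := by
    refine isClosed_of_closure_subset fun g hg => ?_
    refine hY.mem_of_approx (Φ 1) h1 (hΦ.nonneg zero_le_one) (Φ g) fun ε hε => ?_
    obtain ⟨f, hf, hgf⟩ := Metric.mem_closure_iff.1 hg ε hε
    refine ⟨Φ f, hf, ?_⟩
    rw [← map_sub, ← hΦ.map_abs, ← map_smul]
    refine hΦ.mono fun ω => ?_
    change |(g - f) ω| ≤ ε * 1
    rw [mul_one]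
    rw [dist_eq_norm] at hgf
    exact ((g - f).norm_coe_le_norm ω).trans hgf.le

theorem smul_inf_of_nonneg {a : ℝ} (ha : 0 ≤ a) (x y : Z) : a • (x ⊓ y) = a • x ⊓ a • y := by
  rcases ha.eq_or_lt with rfl | ha
  · simp
  · exact (OrderIso.smulRight ha).map_inf x y

/-- If `y n ≤ ∑ b j n • z j` in a `p`-convex Banach lattice, then positive operators `T` from a
sublattice that contains the `y n` into `ℓ^p` satisfy
`∑ T n (y n) ≤ ‖T‖ M ∑ ‖z j‖`. This is the estimate that a positive extension of `T` requires. -/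
theorem PConvexWith.sum_map_le [CompleteSpace Z] (hp : p ≠ ∞) {M C : ℝ} (hM : 0 ≤ M) (hC : 0 ≤ C)
    (hZ : PConvexWith p M Z) {Y : Submodule ℝ Z} (hY : IsUniformlyClosedSublattice Y) {N : ℕ}
    {T : Fin N → Y →ₗ[ℝ] ℝ} (hT : ∀ n, ∀ y : Y, 0 ≤ (y : Z) → 0 ≤ T n y)
    (hTC : ∀ y : Y, ‖WithLp.toLp p fun n => T n y‖ ≤ C * ‖(y : Z)‖) {J : ℕ} {y : Fin N → Y}
    {z : Fin J → Z} (hz : ∀ j, 0 ≤ z j) {b : Fin J → Fin N → ℝ} (hb0 : ∀ j n, 0 ≤ b j n)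
    (hb : ∀ j, DualBall p (b j)) (hle : ∀ n, (y n : Z) ≤ ∑ j, b j n • z j) :
    ∑ n, T n (y n) ≤ C * M * ∑ j, ‖z j‖ := by
  let y' : Fin N → Y := fun n => ⟨y n ⊔ 0, hY.sup_mem _ (y n).2 _ Y.zero_mem⟩
  have hy' : ∀ n, 0 ≤ (y' n : Z) := fun n => le_sup_right
  have hyy' : ∀ n, T n (y n) ≤ T n (y' n) := fun n => by
    have := hT n (y' n - y n) (sub_nonneg.2 le_sup_left)
    rw [map_sub] at this
    linarith
  let e : Z := ∑ n, (y' n : Z)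
  have heY : e ∈ Y := Y.sum_mem fun n _ => (y' n).2
  have he : 0 ≤ e := Finset.sum_nonneg fun n _ => hy' n
  have hye : ∀ n, (y' n : Z) ≤ e := fun n =>
    Finset.single_le_sum (f := fun n => (y' n : Z)) (fun n _ => hy' n) (Finset.mem_univ n)
  -- a multiple of `e` at which the `z j` may be truncated without violating the inequalities
  let A : ℝ := ∑ j, ∑ n, (b j n)⁻¹
  have hA0 : 0 ≤ A := Finset.sum_nonneg fun j _ =>
    Finset.sum_nonneg fun n _ => inv_nonneg.2 (hb0 j n)
  have hA : ∀ j n, 0 < b j n → 1 ≤ b j n * A := fun j n h => by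
    have h1 : (b j n)⁻¹ ≤ A :=
      (Finset.single_le_sum (f := fun n => (b j n)⁻¹) (fun n _ => inv_nonneg.2 (hb0 j n))
        (Finset.mem_univ n)).trans
      (Finset.single_le_sum (f := fun j => ∑ n, (b j n)⁻¹)
        (fun j _ => Finset.sum_nonneg fun n _ => inv_nonneg.2 (hb0 j n)) (Finset.mem_univ j))
    calc (1 : ℝ) = b j n * (b j n)⁻¹ := (mul_inv_cancel₀ h.ne').symm
      _ ≤ b j n * A := mul_le_mul_of_nonneg_left h1 h.le
  let z' : Fin J → Z := fun j => z j ⊓ A • e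
  have hz' : ∀ j, 0 ≤ z' j := fun j => le_inf (hz j) (smul_nonneg hA0 he)
  have hle' : ∀ n, (y' n : Z) ≤ ∑ j, b j n • z' j := fun n => by
    have h1 : (y' n : Z) ≤ e ⊓ ∑ j, b j n • z j :=
      le_inf (hye n) (sup_le (hle n) (Finset.sum_nonneg fun j _ => smul_nonneg (hb0 j n) (hz j)))
    refine h1.trans ((inf_sum_le_sum_inf _ (fun j _ => smul_nonneg (hb0 j n) (hz j)) he).trans
      (Finset.sum_le_sum fun j _ => ?_))
    rw [smul_inf_of_nonneg (hb0 j n)]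
    refine le_inf inf_le_right ?_
    rcases (hb0 j n).eq_or_lt with h0 | h0
    · simp [← h0]
    · rw [smul_smul]
      refine inf_le_left.trans ?_
      have := smul_le_smul_of_nonneg_right (hA j n h0) he
      rwa [one_smul] at this
  have hnorm : ∀ j, ‖z' j‖ ≤ ‖z j‖ := fun j => norm_le_norm_of_abs_le_abs (by
    rw [abs_of_nonneg (hz' j), abs_of_nonneg (hz j)]
    exact inf_le_left)
  obtain ⟨K, _, _, Φ, hΦ, hinj, hΦ1, hsurj⟩ := exists_continuousMap_representation he
  have hL : IsUnitalSublattice (Y.comap Φ) := hY.comap hΦ (by rwa [hΦ1])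
  choose η hη using fun n => hsurj (y' n) ⟨1, by rw [one_smul, abs_of_nonneg (hy' n)]; exact hye n⟩
  choose ζ hζ using fun j => hsurj (z' j) ⟨A, by rw [abs_of_nonneg (hz' j)]; exact inf_le_right⟩
  let Ψ : Y.comap Φ →ₗ[ℝ] Y := (Φ ∘ₗ (Y.comap Φ).subtype).codRestrict Y fun f => f.2
  have key := sum_map_le_of_le_sum (τ := fun n => T n ∘ₗ Ψ) hp hM hC hZ hΦ hL
    (fun n h hh => hT n (Ψ h) (hΦ.nonneg hh)) (fun h => hTC (Ψ h))
    (η := fun n => ⟨η n, by rw [Submodule.mem_comap, hη]; exact (y' n).2⟩) (ζ := ζ)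
    (fun j => hΦ.le_of_map_le hinj (by rw [map_zero, hζ]; exact hz' j)) hb
    (fun n => hΦ.le_of_map_le hinj (by
      rw [map_sum, hη]
      simp only [map_smul, hζ]
      exact hle' n))
  have hΨ : ∀ n, Ψ ⟨η n, by rw [Submodule.mem_comap, hη]; exact (y' n).2⟩ = y' n := fun n =>
    Subtype.ext (hη n)
  simp only [LinearMap.comp_apply, hΨ, hζ] at key
  refine (Finset.sum_le_sum fun n _ => hyy' n).trans (key.trans ?_)
  exact mul_le_mul_of_nonneg_left (Finset.sum_le_sum fun j _ => hnorm j) (mul_nonneg hC hM)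

/-! #### Norms in `ℓ^p` and in its finite-dimensional sections -/

theorem norm_section_le (hp : p ≠ ∞) (a : lp (fun _ : ℕ => ℝ) p) (N : ℕ) :
    ‖WithLp.toLp p fun n : Fin N => a n‖ ≤ ‖a‖ := by
  have hr := toReal_pos' hp
  rw [← Real.rpow_le_rpow_iff (norm_nonneg _) (norm_nonneg _) hr, norm_toLp_rpow hp,
    Fin.sum_univ_eq_sum_range (fun n => |a n| ^ p.toReal)]
  exact lp.sum_rpow_le_norm_rpow hr a (Finset.range N)

theorem sum_rpow_le_of_section_le (hp : p ≠ ∞) {a : ℕ → ℝ} {B : ℝ}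
    (h : ∀ N, ‖WithLp.toLp p fun n : Fin N => a n‖ ≤ B) (s : Finset ℕ) :
    ∑ n ∈ s, ‖a n‖ ^ p.toReal ≤ B ^ p.toReal := by
  obtain ⟨N, hN⟩ := s.exists_nat_subset_range
  refine (Finset.sum_le_sum_of_subset_of_nonneg hN fun n _ _ =>
    Real.rpow_nonneg (norm_nonneg _) _).trans ?_
  have h1 := Real.rpow_le_rpow (norm_nonneg _) (h N) (toReal_pos' hp).le
  rw [norm_toLp_rpow hp, Fin.sum_univ_eq_sum_range (fun n => |a n| ^ p.toReal)] at h1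
  exact h1

theorem norm_le_of_section_le (hp : p ≠ ∞) {a : lp (fun _ : ℕ => ℝ) p} {B : ℝ} (hB : 0 ≤ B)
    (h : ∀ N, ‖WithLp.toLp p fun n : Fin N => a n‖ ≤ B) : ‖a‖ ≤ B :=
  lp.norm_le_of_forall_sum_le (toReal_pos' hp) hB (sum_rpow_le_of_section_le hp h)

/-- A sequence of functionals that is bounded as an operator into the finite sections of `ℓ^p`
defines an operator into `ℓ^p`. -/
theorem exists_operator_of_section_le {X : Type v} [NormedAddCommGroup X] [NormedSpace ℝ X]
    (hp : p ≠ ∞) {S : ℕ → X →ₗ[ℝ] ℝ} {B : ℝ} (hB : 0 ≤ B)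
    (h : ∀ (N : ℕ) (x : X), ‖WithLp.toLp p fun n : Fin N => S n x‖ ≤ B * ‖x‖) :
    ∃ R : X →L[ℝ] lp (fun _ : ℕ => ℝ) p, (∀ x n, R x n = S n x) ∧ ‖R‖ ≤ B := by
  let R : X →ₗ[ℝ] lp (fun _ : ℕ => ℝ) p :=
    { toFun := fun x => ⟨fun n => S n x, memℓp_gen' (sum_rpow_le_of_section_le hp fun N => h N x)⟩
      map_add' := fun x y => by ext n; exact map_add (S n) x y
      map_smul' := fun c x => by ext n; exact map_smul (S n) c x }
  have hR : ∀ x, ‖R x‖ ≤ B * ‖x‖ := fun x =>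
    norm_le_of_section_le hp (mul_nonneg hB (norm_nonneg x)) fun N => h N x
  exact ⟨R.mkContinuous B hR, fun x n => rfl, R.mkContinuous_norm_le hB hR⟩

/-! #### The extension theorem -/

/-- The pairs `(w, r)` such that `w n ≤ ∑ b j n • z j` for some positive `z j` and some nonnegative
`b j` in the unit ball of the dual of `ℓ^p`, with `C ∑ ‖z j‖ ≤ r`. -/
def extensionCone (p : ℝ≥0∞) (Z : Type u) [NormedAddCommGroup Z] [NormedSpace ℝ Z] [Lattice Z]
    [IsOrderedAddMonoid Z] [IsOrderedModule ℝ Z] (C : ℝ) :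
    PointedCone ℝ ((ℕ →₀ Z) × ℝ) where
  carrier := {x | ∃ (J : ℕ) (z : Fin J → Z) (b : Fin J → ℕ → ℝ), (∀ j, 0 ≤ z j) ∧
    (∀ j n, 0 ≤ b j n) ∧ (∀ j N, DualBall p fun n : Fin N => b j n) ∧
    (∀ n, x.1 n ≤ ∑ j, b j n • z j) ∧ C * ∑ j, ‖z j‖ ≤ x.2}
  add_mem' := by
    rintro x y ⟨J, z, b, hz, hb0, hb, h1, h2⟩ ⟨J', z', b', hz', hb0', hb', h1', h2'⟩
    refine ⟨J + J', Fin.append z z', Fin.append b b', fun j => ?_, fun j => ?_, fun j => ?_,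
      fun n => ?_, ?_⟩
    · refine Fin.addCases (fun i => ?_) (fun i => ?_) j <;> simp [hz, hz']
    · refine Fin.addCases (fun i => ?_) (fun i => ?_) j <;> simp [hb0, hb0']
    · refine Fin.addCases (fun i => ?_) (fun i => ?_) j <;> simp [hb, hb']
    · simp only [Fin.sum_univ_add, Fin.append_left, Fin.append_right, Prod.fst_add,
        Finsupp.add_apply]
      exact add_le_add (h1 n) (h1' n)
    · simp only [Fin.sum_univ_add, Fin.append_left, Fin.append_right, Prod.snd_add, mul_add]
      exact add_le_add h2 h2'
  zero_mem' := ⟨0, Fin.elim0, Fin.elim0, fun j => j.elim0, fun j => j.elim0, fun j => j.elim0,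
    by simp, by simp⟩
  smul_mem' := by
    rintro ⟨c, hc⟩ x ⟨J, z, b, hz, hb0, hb, h1, h2⟩
    refine ⟨J, fun j => c • z j, b, fun j => smul_nonneg hc (hz j), hb0, hb, fun n => ?_, ?_⟩
    · change c • x.1 n ≤ _
      simp only [smul_comm _ c, ← Finset.smul_sum]
      exact smul_le_smul_of_nonneg_left (h1 n) hc
    · change _ ≤ c * x.2
      simp only [norm_smul, Real.norm_of_nonneg hc, ← Finset.mul_sum]
      rw [mul_left_comm]
      exact mul_le_mul_of_nonneg_left h2 hc

theorem dualBall_single (j N : ℕ) :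
    DualBall p fun n : Fin N => if (n : ℕ) = j then (1 : ℝ) else 0 := by
  intro t
  rcases lt_or_ge j N with hj | hj
  · have h1 : ∑ n : Fin N, (if (n : ℕ) = j then (1 : ℝ) else 0) * t n = t ⟨j, hj⟩ := by
      rw [Finset.sum_eq_single ⟨j, hj⟩]
      · simp
      · intro n _ hn
        rw [if_neg fun h => hn (Fin.ext h), zero_mul]
      · simp
    rw [h1]
    exact (le_abs_self _).trans (PiLp.norm_apply_le (WithLp.toLp p t) ⟨j, hj⟩)
  · rw [Finset.sum_eq_zero]
    · exact norm_nonneg _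
    · intro n _
      have h1 : (n : ℕ) ≠ j := (n.2.trans_le hj).ne
      simp [h1]

/-- Positive operators from uniformly closed sublattices of a `p`-convex Banach lattice into `ℓ^p`
have positive extensions. -/
theorem PConvexWith.exists_extension [CompleteSpace Z] (hp : p ≠ ∞) {M C : ℝ} (hM : 0 ≤ M)
    (hC : 0 ≤ C) (hZ : PConvexWith p M Z) {Y : Submodule ℝ Z} (hY : IsUniformlyClosedSublattice Y)
    {T : ℕ → Y →ₗ[ℝ] ℝ} (hT : ∀ n, ∀ y : Y, 0 ≤ (y : Z) → 0 ≤ T n y)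
    (hTC : ∀ (N : ℕ) (y : Y), ‖WithLp.toLp p fun n : Fin N => T n y‖ ≤ C * ‖(y : Z)‖) :
    ∃ S : Z →L[ℝ] lp (fun _ : ℕ => ℝ) p, (∀ z, 0 ≤ z → ∀ n, 0 ≤ S z n) ∧
      (∀ (y : Y) n, S y n = T n y) ∧ ‖S‖ ≤ C * M := by
  -- Arbitrary linear extensions only serve to write down a functional on a subspace.
  choose T' hT' using fun n => LinearMap.exists_extend (T n)
  have hT'' : ∀ n (y : Y), T' n y = T n y := fun n y => LinearMap.congr_fun (hT' n) y
  let φ : (ℕ →₀ Z) →ₗ[ℝ] ℝ := Finsupp.lsum ℝ T'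
  have hφs : ∀ n z, φ (Finsupp.single n z) = T' n z := fun n z => by simp [φ]
  let W : Submodule ℝ ((ℕ →₀ Z) × ℝ) :=
    { carrier := {x | ∀ n, x.1 n ∈ Y}
      add_mem' := fun hx hy n => Y.add_mem (hx n) (hy n)
      zero_mem' := fun n => Y.zero_mem
      smul_mem' := fun c x hx n => Y.smul_mem c (hx n) }
  obtain ⟨G, hG, hGs⟩ := riesz_extension (extensionCone p Z (C * M))
    (⟨W, (LinearMap.snd ℝ _ ℝ - φ ∘ₗ LinearMap.fst ℝ _ ℝ) ∘ₗ W.subtype⟩ :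
      ((ℕ →₀ Z) × ℝ) →ₗ.[ℝ] ℝ) (by
    rintro ⟨⟨w, r⟩, hw : ∀ n, w n ∈ Y⟩ ⟨J, z, b, hz, hb0, hb, h1, h2⟩
    obtain ⟨N, hN⟩ := w.support.exists_nat_subset_range
    have h3 := hZ.sum_map_le (N := N) hp hM hC hY (T := fun n => T n) (fun n => hT n) (hTC N)
      (y := fun n => ⟨w n, hw n⟩) hz (b := fun j n => b j n) (fun j n => hb0 j n)
      (fun j => hb j N) fun n => h1 n
    have h4 : φ w = ∑ n : Fin N, T n ⟨w n, hw n⟩ := by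
      have h5 : φ w = ∑ n ∈ Finset.range N, T' n (w n) := by
        simp only [φ, Finsupp.lsum_apply]
        exact Finsupp.sum_of_support_subset _ hN _ fun n _ => map_zero _
      rw [h5, ← Fin.sum_univ_eq_sum_range (fun n => T' n (w n))]
      exact Finset.sum_congr rfl fun n _ => hT'' n ⟨w n, hw n⟩
    change 0 ≤ r - φ w
    simp only at h2
    linarith) (by
    rintro ⟨w, t⟩
    obtain ⟨N, hN⟩ := w.support.exists_nat_subset_range
    refine ⟨⟨(0, C * M * ∑ j : Fin N, ‖|w j|‖ - t), fun n => Y.zero_mem⟩, N, fun j => |w j|,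
      fun j n => if n = j then 1 else 0, fun j => abs_nonneg _,
      fun j n => by dsimp only; split_ifs <;> simp,
      fun j n => dualBall_single j n, fun n => ?_, by simp⟩
    simp only [Prod.fst_add, zero_add]
    rcases lt_or_ge n N with hn | hn
    · rw [Finset.sum_eq_single ⟨n, hn⟩]
      · simpa using le_abs_self (w n)
      · intro j _ hj
        rw [if_neg fun h => hj (Fin.ext h.symm), zero_smul]
      · simp
    · have h0 : w n = 0 := by
        by_contra hne
        have := Finset.mem_range.1 (hN (Finsupp.mem_support_iff.2 hne))
        omega
      rw [h0]
      exact Finset.sum_nonneg fun j _ => smul_nonneg (by split_ifs <;> simp) (abs_nonneg _))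
  have hG2 : ∀ r : ℝ, G (0, r) = r := fun r => by
    have h := hG ⟨(0, r), fun n => Y.zero_mem⟩
    refine h.trans ?_
    change r - φ 0 = r
    rw [map_zero, sub_zero]
  let S₀ : (ℕ →₀ Z) →ₗ[ℝ] ℝ := -(G ∘ₗ LinearMap.inl ℝ _ ℝ)
  have hS₀ : ∀ w r, (w, r) ∈ extensionCone p Z (C * M) → S₀ w ≤ r := fun w r h => by
    have h1 := hGs _ h
    have h2 : ((w, r) : (ℕ →₀ Z) × ℝ) = (w, 0) + (0, r) := by simp
    rw [h2, map_add, hG2] at h1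
    change -G (w, 0) ≤ r
    linarith
  let S : ℕ → Z →ₗ[ℝ] ℝ := fun n => S₀ ∘ₗ Finsupp.lsingle n
  have hSn : ∀ n z, S n z = S₀ (Finsupp.single n z) := fun n z => rfl
  have hS0 : ∀ n z, 0 ≤ z → 0 ≤ S n z := fun n z hz => by
    have h1 := hS₀ (Finsupp.single n (-z)) 0 ⟨0, Fin.elim0, Fin.elim0, fun j => j.elim0,
      fun j => j.elim0, fun j => j.elim0, fun m => by
        rcases eq_or_ne m n with rfl | hmn
        · simpa using hz
        · simp [Finsupp.single_eq_of_ne hmn], by simp⟩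
    rw [← hSn, map_neg] at h1
    linarith
  have hSY : ∀ n (y : Y), S n y = T n y := fun n y => by
    have hmem : ((Finsupp.single n (y : Z), 0) : (ℕ →₀ Z) × ℝ) ∈ W := fun m => by
      rcases eq_or_ne m n with rfl | hmn
      · simp
      · simp [Finsupp.single_eq_of_ne hmn]
    have h := hG ⟨_, hmem⟩
    change -G (Finsupp.single n (y : Z), 0) = _
    rw [h]
    change -(0 - φ (Finsupp.single n (y : Z))) = _
    rw [hφs, hT'']
    ring
  have hSN : ∀ N z, 0 ≤ z → ‖WithLp.toLp p fun n : Fin N => S n z‖ ≤ C * M * ‖z‖ := by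
    intro N z hz
    obtain ⟨a, ha, ha0, haS⟩ := exists_nonneg_dualBall_eq_norm (p := p)
      (t := fun n : Fin N => S n z) fun n => hS0 n z hz
    let b : ℕ → ℝ := fun n => if h : n < N then a ⟨n, h⟩ else 0
    have hb0 : ∀ n, 0 ≤ b n := fun n => by
      by_cases h : n < N <;> simp [b, h, ha0]
    have hb : ∀ m, DualBall p fun n : Fin m => b n := fun m t => by
      -- restrict or extend by zero to `N` coordinates
      let t' : ℕ → ℝ := fun n => if h : n < m then t ⟨n, h⟩ else 0
      have h1 : ∑ n : Fin m, b n * t n = ∑ n : Fin N, a n * t' n := by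
        have h2 : ∑ n : Fin m, b n * t n = ∑ n ∈ Finset.range (max m N), b n * t' n := by
          have h3 : ∀ n : Fin m, b n * t n = b n * t' n := fun n => by simp [t']
          rw [Finset.sum_congr rfl fun n _ => h3 n,
            Fin.sum_univ_eq_sum_range (fun n => b n * t' n)]
          refine Finset.sum_subset (Finset.range_mono (le_max_left _ _)) fun n _ hn => ?_
          rw [Finset.mem_range] at hn
          simp [t', hn]
        have h3 : ∑ n : Fin N, a n * t' n = ∑ n ∈ Finset.range (max m N), b n * t' n := by
          have h3 : ∀ n : Fin N, a n * t' n = b n * t' n := fun n => by simp [b]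
          rw [Finset.sum_congr rfl fun n _ => h3 n,
            Fin.sum_univ_eq_sum_range (fun n => b n * t' n)]
          refine Finset.sum_subset (Finset.range_mono (le_max_right _ _)) fun n _ hn => ?_
          rw [Finset.mem_range] at hn
          simp [b, hn]
        rw [h2, h3]
      rw [h1]
      exact (ha _).trans (norm_toLp_extend_le hp t N)
    have h1 := hS₀ (∑ n ∈ Finset.range N, Finsupp.single n (b n • z)) (C * M * ‖z‖)
      ⟨1, fun _ => z, fun _ => b, fun _ => hz, fun _ => hb0, fun _ => hb, fun n => by
        rw [Finsupp.finsetSum_apply]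
        simp only [Finsupp.single_apply, Finset.sum_ite_eq', Finset.mem_range, Finset.sum_const,
          Finset.card_univ, Fintype.card_fin, one_smul]
        split_ifs
        · exact le_rfl
        · exact smul_nonneg (hb0 n) hz, by simp⟩
    rw [map_sum] at h1
    simp only [← hSn, map_smul, smul_eq_mul] at h1
    rw [← haS]
    refine le_trans (le_of_eq ?_) h1
    rw [← Fin.sum_univ_eq_sum_range (fun n => b n * S n z)]
    exact Finset.sum_congr rfl fun n _ => by simp [b]
  obtain ⟨R, hR, hRn⟩ := exists_operator_of_section_le (S := S) hp (mul_nonneg hC hM)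
    fun N z => by
      refine (norm_toLp_mono fun n => ?_).trans ((hSN N |z| (abs_nonneg z)).trans ?_)
      · have h1 := hS0 n (|z| - z) (sub_nonneg.2 (le_abs_self z))
        have h2 := hS0 n (|z| + z) (by
          have := neg_le_abs z
          rwa [neg_le_iff_add_nonneg] at this)
        rw [map_sub] at h1
        rw [map_add] at h2
        exact (abs_le.2 ⟨by linarith, by linarith⟩).trans (le_abs_self _)
      · rw [norm_abs_eq_norm]
  exact ⟨R, fun z hz n => by rw [hR]; exact hS0 n z hz, fun y n => by rw [hR]; exact hSY n y, hRn⟩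

end Extension

/-! ### Injectivity of `ℓ^p` and projections onto spans of disjoint sequences -/

section Injectivity

variable {p : ℝ≥0∞} [Fact (1 ≤ p)]

theorem PConvexWith.exists_extension_norm_eq {Z : Type u} [NormedAddCommGroup Z] [NormedSpace ℝ Z]
    [Lattice Z] [IsOrderedAddMonoid Z] [IsOrderedModule ℝ Z] [HasSolidNorm Z] [CompleteSpace Z]
    (hp : p ≠ ∞) (hZ : PConvexWith p 1 Z) {Y : Submodule ℝ Z} (hY : IsUniformlyClosedSublattice Y)
    (T : Y →L[ℝ] lp (fun _ : ℕ => ℝ) p) (hT : ∀ y : Y, 0 ≤ (y : Z) → ∀ n, 0 ≤ T y n) :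
    ∃ S : Z →L[ℝ] lp (fun _ : ℕ => ℝ) p, (∀ z : Z, 0 ≤ z → ∀ n, 0 ≤ S z n) ∧
      (∀ y : Y, S y = T y) ∧ ‖S‖ = ‖T‖ := by
  let T' : ℕ → Y →ₗ[ℝ] ℝ := fun n => lp.evalₗ (fun _ : ℕ => ℝ) p n ∘ₗ (T : Y →ₗ[ℝ] _)
  obtain ⟨S, hS0, hSY, hSn⟩ := hZ.exists_extension (T := T') hp zero_le_one (norm_nonneg T) hY
    (fun n y hy => hT y hy n) fun N y => (norm_section_le hp (T y) N).trans (T.le_opNorm y)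
  have hST : ∀ y : Y, S y = T y := fun y => by
    ext n
    exact hSY y n
  refine ⟨S, hS0, hST, le_antisymm (by rwa [mul_one] at hSn) ?_⟩
  refine T.opNorm_le_bound (norm_nonneg S) fun y => ?_
  rw [← hST]
  exact S.le_opNorm y

end Injectivity

section DisjointSequence

variable {p : ℝ≥0∞} [Fact (1 ≤ p)] {X : Type u} [NormedAddCommGroup X] [NormedSpace ℝ X]
  [Lattice X] [IsOrderedAddMonoid X] [IsOrderedModule ℝ X] [HasSolidNorm X]

theorem smul_inf_smul_eq_zero {x y : X} (hx : 0 ≤ x) (hy : 0 ≤ y) (hxy : x ⊓ y = 0) {s t : ℝ}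
    (hs : 0 ≤ s) (ht : 0 ≤ t) : s • x ⊓ t • y = 0 := by
  refine le_antisymm ?_ (le_inf (smul_nonneg hs hx) (smul_nonneg ht hy))
  calc s • x ⊓ t • y ≤ (s + t) • x ⊓ (s + t) • y :=
        inf_le_inf (smul_le_smul_of_nonneg_right (by linarith) hx)
          (smul_le_smul_of_nonneg_right (by linarith) hy)
    _ = 0 := by rw [← smul_inf_of_nonneg (add_nonneg hs ht), hxy, smul_zero]

theorem IsPositiveDisjoint.sum_inf_sum_eq_zero {x : ℕ → X} (hx : IsPositiveDisjoint x)
    {a b : ℕ → ℝ} (ha : ∀ n, 0 ≤ a n) (hb : ∀ n, 0 ≤ b n) (hab : ∀ n, a n = 0 ∨ b n = 0)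
    (s : Finset ℕ) : (∑ n ∈ s, a n • x n) ⊓ ∑ n ∈ s, b n • x n = 0 := by
  have hax : ∀ n, 0 ≤ a n • x n := fun n => smul_nonneg (ha n) (hx.1 n)
  have hbx : ∀ n, 0 ≤ b n • x n := fun n => smul_nonneg (hb n) (hx.1 n)
  have h0 : 0 ≤ ∑ n ∈ s, b n • x n := Finset.sum_nonneg fun n _ => hbx n
  refine le_antisymm ?_ (le_inf (Finset.sum_nonneg fun n _ => hax n) h0)
  rw [inf_comm]
  refine (inf_sum_le_sum_inf s (fun n _ => hax n) h0).trans (Finset.sum_nonpos fun n _ => ?_)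
  rw [inf_comm]
  refine (inf_sum_le_sum_inf s (fun n _ => hbx n) (hax n)).trans (Finset.sum_nonpos fun m _ => ?_)
  rcases eq_or_ne n m with rfl | hnm
  · rcases hab n with h | h
    · rw [h, zero_smul]
      exact inf_le_left
    · rw [h, zero_smul]
      exact inf_le_right
  · have h1 := hx.2 n m hnm
    rw [abs_of_nonneg (hx.1 n), abs_of_nonneg (hx.1 m)] at h1
    exact (smul_inf_smul_eq_zero (hx.1 n) (hx.1 m) h1 (ha n) (hb m)).le

theorem norm_sum_le_of_upper_estimate (hp : p ≠ ∞) {x : ℕ → X} {C : ℝ}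
    (hC : ∀ (n : ℕ) (a : Fin n → ℝ), ‖∑ k, a k • x k‖ ≤ C * ‖WithLp.toLp p a‖) (a : ℕ → ℝ)
    (s : Finset ℕ) :
    ‖∑ n ∈ s, a n • x n‖ ≤ C * (∑ n ∈ s, |a n| ^ p.toReal) ^ p.toReal⁻¹ := by
  have hr := toReal_pos' hp
  obtain ⟨N, hN⟩ := s.exists_nat_subset_range
  let b : ℕ → ℝ := fun n => if n ∈ s then a n else 0
  have h1 := hC N fun k => b k
  have h2 : ∑ k : Fin N, b k • x k = ∑ n ∈ s, a n • x n := by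
    rw [Fin.sum_univ_eq_sum_range (fun n => b n • x n), ← Finset.sum_subset hN fun n _ hn => by
      simp [b, hn]]
    exact Finset.sum_congr rfl fun n hn => by simp [b, hn]
  have h3 : ‖WithLp.toLp p fun k : Fin N => b k‖ =
      (∑ n ∈ s, |a n| ^ p.toReal) ^ p.toReal⁻¹ := by
    rw [← Real.rpow_rpow_inv (norm_nonneg (WithLp.toLp p fun k : Fin N => b k)) hr.ne',
      norm_toLp_rpow hp, Fin.sum_univ_eq_sum_range (fun n => |b n| ^ p.toReal),
      ← Finset.sum_subset hN fun n _ hn => by simp [b, hn, Real.zero_rpow hr.ne']]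
    congr 1
    exact Finset.sum_congr rfl fun n hn => by simp [b, hn]
  rwa [h2, h3] at h1

/-- The `ℓ^p`-combinations of a sequence with an upper `p`-estimate. -/
theorem summable_smul_of_upper_estimate [CompleteSpace X] (hp : p ≠ ∞) {x : ℕ → X} {C : ℝ}
    (hC0 : 0 < C)
    (hC : ∀ (n : ℕ) (a : Fin n → ℝ), ‖∑ k, a k • x k‖ ≤ C * ‖WithLp.toLp p a‖)
    (a : lp (fun _ : ℕ => ℝ) p) : Summable fun n => a n • x n := by
  have hr := toReal_pos' hp
  rw [summable_iff_vanishing_norm]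
  intro ε hε
  obtain ⟨s, hs⟩ := summable_iff_vanishing_norm.1 ((lp.memℓp a).summable hr)
    ((ε / C) ^ p.toReal) (by positivity)
  refine ⟨s, fun t ht => ?_⟩
  have h1 := (le_abs_self _).trans_lt (hs t ht)
  refine (norm_sum_le_of_upper_estimate hp hC a t).trans_lt ?_
  rw [← lt_div_iff₀' hC0, ← Real.rpow_rpow_inv (div_nonneg hε.le hC0.le) hr.ne']
  exact Real.rpow_lt_rpow (Finset.sum_nonneg fun n _ => Real.rpow_nonneg (abs_nonneg _) _) h1
    (inv_pos.2 hr)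

/-- The positive part of an element of `ℓ^p`. -/
def lpPosPart (hp : p ≠ ∞) (a : lp (fun _ : ℕ => ℝ) p) : lp (fun _ : ℕ => ℝ) p :=
  ⟨fun n => max (a n) 0, memℓp_gen (Summable.of_nonneg_of_le
    (fun _ => Real.rpow_nonneg (norm_nonneg _) _)
    (fun n => Real.rpow_le_rpow (norm_nonneg _) (by
      rw [Real.norm_eq_abs, Real.norm_eq_abs, abs_of_nonneg (le_max_right _ _)]
      exact max_le (le_abs_self _) (abs_nonneg _)) (toReal_pos' hp).le)
    ((lp.memℓp a).summable (toReal_pos' hp)))⟩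

theorem section_mono (hp : p ≠ ∞) (a : ℕ → ℝ) {N N' : ℕ} (h : N ≤ N') :
    ‖WithLp.toLp p fun n : Fin N => a n‖ ≤ ‖WithLp.toLp p fun n : Fin N' => a n‖ := by
  rw [← Real.rpow_le_rpow_iff (norm_nonneg _) (norm_nonneg _) (toReal_pos' hp), norm_toLp_rpow hp,
    norm_toLp_rpow hp, Fin.sum_univ_eq_sum_range (fun n => |a n| ^ p.toReal),
    Fin.sum_univ_eq_sum_range (fun n => |a n| ^ p.toReal)]
  exact Finset.sum_le_sum_of_subset_of_nonneg (Finset.range_mono h)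
    fun n _ _ => Real.rpow_nonneg (abs_nonneg _) _

/-- A disjoint positive sequence that is equivalent to the `ℓ^p` basis spans a lattice isomorphic
copy of `ℓ^p`, with `e n` corresponding to `x n`. -/
theorem exists_lattice_copy [CompleteSpace X] (hp : p ≠ ∞) {x : ℕ → X} (hx : IsPositiveDisjoint x)
    (hxp : IsEquivLpBasis p x) :
    ∃ (J : lp (fun _ : ℕ => ℝ) p →L[ℝ] X) (c : ℝ), 0 < c ∧ (∀ a, c * ‖a‖ ≤ ‖J a‖) ∧
      (∀ a, HasSum (fun n => a n • x n) (J a)) ∧ ∀ a, J a ⊔ 0 = J (lpPosPart hp a) := by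
  obtain ⟨c, C, hc, hC, hcC⟩ := hxp
  have hsum := summable_smul_of_upper_estimate hp hC fun n a => (hcC n a).2
  let J₀ : lp (fun _ : ℕ => ℝ) p →ₗ[ℝ] X :=
    { toFun := fun a => ∑' n, a n • x n
      map_add' := fun a b => by
        rw [← (hsum a).tsum_add (hsum b)]
        exact tsum_congr fun n => by rw [← add_smul]; rfl
      map_smul' := fun t a => by
        rw [RingHom.id_apply, ← (hsum a).tsum_const_smul t]
        exact tsum_congr fun n => by rw [smul_smul]; rfl }
  have hJs : ∀ a, HasSum (fun n => a n • x n) (J₀ a) := fun a => (hsum a).hasSum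
  have hlim : ∀ a, Filter.Tendsto (fun N => ‖∑ n ∈ Finset.range N, a n • x n‖) Filter.atTop
      (nhds ‖J₀ a‖) := fun a => (hJs a).tendsto_sum_nat.norm
  have hN : ∀ (a : lp (fun _ : ℕ => ℝ) p) N,
      c * ‖WithLp.toLp p fun n : Fin N => a n‖ ≤ ‖∑ n ∈ Finset.range N, a n • x n‖ ∧
      ‖∑ n ∈ Finset.range N, a n • x n‖ ≤ C * ‖WithLp.toLp p fun n : Fin N => a n‖ := fun a N => by
    rw [← Fin.sum_univ_eq_sum_range (fun n => a n • x n)]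
    exact hcC N fun n => a n
  have hup : ∀ a, ‖J₀ a‖ ≤ C * ‖a‖ := fun a => le_of_tendsto' (hlim a) fun N =>
    (hN a N).2.trans (mul_le_mul_of_nonneg_left (norm_section_le hp a N) hC.le)
  have hlow : ∀ a, c * ‖a‖ ≤ ‖J₀ a‖ := fun a => by
    rw [← le_div_iff₀' hc]
    refine norm_le_of_section_le hp (div_nonneg (norm_nonneg _) hc.le) fun N => ?_
    rw [le_div_iff₀' hc]
    refine ge_of_tendsto (hlim a) (Filter.eventually_atTop.2 ⟨N, fun N' hN' => ?_⟩)
    exact (mul_le_mul_of_nonneg_left (section_mono hp (fun n => a n) hN') hc.le).trans (hN a N').1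
  refine ⟨J₀.mkContinuous C hup, c, hc, hlow, hJs, fun a => ?_⟩
  -- the positive and the negative part of `a` have disjoint images
  set u := J₀ (lpPosPart hp a)
  set v := J₀ (lpPosPart hp (-a))
  have huv : u ⊓ v = 0 := by
    have h1 : Filter.Tendsto (fun s : Finset ℕ => (∑ n ∈ s, lpPosPart hp a n • x n) ⊓
        ∑ n ∈ s, lpPosPart hp (-a) n • x n) Filter.atTop (nhds (u ⊓ v)) :=
      (hJs (lpPosPart hp a)).inf_nhds (hJs (lpPosPart hp (-a)))
    refine tendsto_nhds_unique h1 (tendsto_const_nhds.congr fun s => ?_)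
    refine (hx.sum_inf_sum_eq_zero (fun n => le_max_right _ _) (fun n => le_max_right _ _)
      (fun n => ?_) s).symm
    rcases le_total (a n) 0 with h | h
    · exact Or.inl (max_eq_right h)
    · exact Or.inr (max_eq_right (neg_nonpos.2 h))
  have ha : J₀ a = u - v := by
    rw [← map_sub]
    congr 1
    ext n
    change a n = max (a n) 0 - max (-(a n)) 0
    exact (posPart_sub_negPart (a n)).symm
  change J₀ a ⊔ 0 = u
  have h1 := inf_add_sup u v
  rw [huv, zero_add] at h1
  rw [ha, ← sub_self v, ← sup_sub, h1, add_sub_cancel_right]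

/-- The projection is `J S`, where `J` embeds `ℓ^p` as the closed span and `S` is a positive
extension of `J⁻¹`. -/
theorem exists_positive_projection [CompleteSpace X] (hp : p ≠ ∞) (hX : PConvex p X) {x : ℕ → X}
    (hx : IsPositiveDisjoint x) (hxp : IsEquivLpBasis p x) :
    ∃ P : X →L[ℝ] X, (∀ y : X, 0 ≤ y → 0 ≤ P y) ∧ P ∘L P = P ∧
      P.range = (Submodule.span ℝ (Set.range x)).topologicalClosure := by
  obtain ⟨M, hM1, hM⟩ := hX
  obtain ⟨J, c, hc, hlow, hJs, hJp⟩ := exists_lattice_copy hp hx hxp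
  have hanti : AntilipschitzWith (Real.toNNReal c⁻¹) J :=
    ContinuousLinearMap.antilipschitz_of_bound J fun a => by
      rw [Real.coe_toNNReal _ (inv_nonneg.2 hc.le), le_inv_mul_iff₀ hc]
      exact hlow a
  have hinj : Function.Injective J := hanti.injective
  have hclosed : IsClosed (LinearMap.range (J : lp (fun _ : ℕ => ℝ) p →ₗ[ℝ] X) : Set X) := by
    have := hanti.isClosed_range J.uniformContinuous
    rwa [LinearMap.coe_range]
  have hY : IsUniformlyClosedSublattice (LinearMap.range (J : lp (fun _ : ℕ => ℝ) p →ₗ[ℝ] X)) := by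
    refine isUniformlyClosedSublattice_of_isClosed hclosed ?_
    rintro _ ⟨a, rfl⟩ _ ⟨b, rfl⟩
    refine ⟨lpPosPart hp (a - b) + b, ?_⟩
    change J (lpPosPart hp (a - b) + b) = J a ⊔ J b
    rw [map_add, ← hJp, map_sub, sup_add, sub_add_cancel, zero_add]
  let e := LinearEquiv.ofInjective (J : lp (fun _ : ℕ => ℝ) p →ₗ[ℝ] X) hinj
  have he : ∀ y, J (e.symm y) = y := fun y => congrArg Subtype.val (e.apply_symm_apply y)
  let T : ℕ → LinearMap.range (J : lp (fun _ : ℕ => ℝ) p →ₗ[ℝ] X) →ₗ[ℝ] ℝ := fun n =>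
    { toFun := fun y => e.symm y n
      map_add' := fun y z => by rw [map_add]; rfl
      map_smul' := fun t y => by rw [map_smul]; rfl }
  have hT : ∀ n, ∀ y : LinearMap.range (J : lp (fun _ : ℕ => ℝ) p →ₗ[ℝ] X), 0 ≤ (y : X) →
      0 ≤ T n y := fun n y hy => by
    have h1 : J (e.symm y) = J (lpPosPart hp (e.symm y)) := by
      rw [← hJp, he, sup_eq_left.2 hy]
    have h2 : e.symm y n = max (e.symm y n) 0 :=
      congrArg (fun a : lp (fun _ : ℕ => ℝ) p => a n) (hinj h1)
    change 0 ≤ e.symm y n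
    rw [h2]
    exact le_max_right _ _
  obtain ⟨S, hS0, hSY, -⟩ := hM.exists_extension hp (zero_le_one.trans hM1)
    (inv_nonneg.2 hc.le) hY hT fun N y => by
      refine (norm_section_le hp (e.symm y) N).trans ?_
      rw [le_inv_mul_iff₀ hc, ← he y]
      simpa [he] using hlow (e.symm y)
  have hSJ : ∀ a, S (J a) = a := fun a => by
    ext n
    have h1 := hSY (e a) n
    have h2 : T n (e a) = a n := by
      change e.symm (e a) n = a n
      rw [e.symm_apply_apply]
    rw [h2] at h1
    exact h1
  have hrange : LinearMap.range (J : lp (fun _ : ℕ => ℝ) p →ₗ[ℝ] X) =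
      (Submodule.span ℝ (Set.range x)).topologicalClosure := by
    apply le_antisymm
    · rintro _ ⟨a, rfl⟩
      refine mem_closure_of_tendsto (hJs a) (Filter.Eventually.of_forall fun s => ?_)
      exact Submodule.sum_mem _ fun n _ => Submodule.smul_mem _ _
        (Submodule.subset_span ⟨n, rfl⟩)
    · refine Submodule.topologicalClosure_minimal _ ?_ hclosed
      rw [Submodule.span_le]
      rintro _ ⟨n, rfl⟩
      refine ⟨lp.single p n (1 : ℝ), ?_⟩
      refine (hJs (lp.single p n (1 : ℝ))).unique ?_
      have h1 := hasSum_single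
        (f := fun m => (lp.single p n (1 : ℝ) : lp (fun _ : ℕ => ℝ) p) m • x m) n fun m hm => by simp [lp.single_apply, hm]
      simpa using h1
  refine ⟨J ∘L S, fun y hy => ?_, ?_, ?_⟩
  · exact ge_of_tendsto' (hJs (S y)) fun s =>
      Finset.sum_nonneg fun n _ => smul_nonneg (hS0 y hy n) (hx.1 n)
  · ext y
    simp [hSJ]
  · rw [← hrange]
    apply le_antisymm
    · rintro _ ⟨y, rfl⟩
      exact ⟨S y, rfl⟩
    · rintro _ ⟨a, rfl⟩
      exact ⟨J a, congrArg J (hSJ a)⟩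

end DisjointSequence

/-! ### The finite-dimensional spaces `ℓ^p(N)` and the free `p`-convex norm -/

section FiniteLp

variable {p : ℝ≥0∞} [Fact (1 ≤ p)]

/-- The space `ℓ^p(N)` with the coordinatewise order, in an arbitrary universe. -/
def FinLp (p : ℝ≥0∞) (N : ℕ) : Type u := PiLp p fun _ : ULift.{u} (Fin N) => ℝ

variable {N : ℕ}

noncomputable instance : NormedAddCommGroup (FinLp.{u} p N) :=
  inferInstanceAs (NormedAddCommGroup (PiLp p fun _ : ULift.{u} (Fin N) => ℝ))

noncomputable instance : NormedSpace ℝ (FinLp.{u} p N) :=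
  inferInstanceAs (NormedSpace ℝ (PiLp p fun _ : ULift.{u} (Fin N) => ℝ))

instance : CompleteSpace (FinLp.{u} p N) :=
  inferInstanceAs (CompleteSpace (PiLp p fun _ : ULift.{u} (Fin N) => ℝ))

/-- The coordinates of a vector. -/
def FinLp.coord (x : FinLp.{u} p N) : ULift.{u} (Fin N) → ℝ := WithLp.ofLp x

/-- The vector with given coordinates. -/
def FinLp.mk (t : ULift.{u} (Fin N) → ℝ) : FinLp.{u} p N := WithLp.toLp p t

theorem FinLp.coord_injective : Function.Injective (FinLp.coord (p := p) (N := N)) :=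
  WithLp.ofLp_injective p

instance : Max (FinLp.{u} p N) := ⟨fun x y => FinLp.mk (x.coord ⊔ y.coord)⟩
instance : Min (FinLp.{u} p N) := ⟨fun x y => FinLp.mk (x.coord ⊓ y.coord)⟩
instance : LE (FinLp.{u} p N) := ⟨fun x y => x.coord ≤ y.coord⟩
instance : LT (FinLp.{u} p N) := ⟨fun x y => x.coord < y.coord⟩

noncomputable instance : Lattice (FinLp.{u} p N) :=
  FinLp.coord_injective.lattice FinLp.coord Iff.rfl Iff.rfl (fun _ _ => rfl) (fun _ _ => rfl)

instance : IsOrderedAddMonoid (FinLp.{u} p N) where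
  add_le_add_left _ _ h z i := add_le_add_left (h i) (z.coord i)

instance : IsOrderedModule ℝ (FinLp.{u} p N) where
  smul_le_smul_of_nonneg_left := fun _ ha _ _ h i => mul_le_mul_of_nonneg_left (h i) ha
  smul_le_smul_of_nonneg_right := fun _ hx _ _ h i => mul_le_mul_of_nonneg_right h (hx i)

theorem FinLp.norm_rpow (hp : p ≠ ∞) (x : FinLp.{u} p N) :
    ‖x‖ ^ p.toReal = ∑ i, |x.coord i| ^ p.toReal :=
  norm_toLp_rpow hp x.coord

theorem FinLp.norm_mk (hp : p ≠ ∞) (t : Fin N → ℝ) :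
    ‖(FinLp.mk fun i => t i.down : FinLp.{u} p N)‖ = ‖WithLp.toLp p t‖ := by
  have hr := toReal_pos' hp
  refine Real.rpow_left_injOn hr.ne' (norm_nonneg _) (norm_nonneg _) ?_
  simp only
  rw [FinLp.norm_rpow hp, norm_toLp_rpow hp]
  exact Equiv.ulift.sum_comp fun i => |t i| ^ p.toReal

theorem FinLp.norm_mono (hp : p ≠ ∞) {x y : FinLp.{u} p N}
    (h : ∀ i, |x.coord i| ≤ |y.coord i|) : ‖x‖ ≤ ‖y‖ := by
  rw [← Real.rpow_le_rpow_iff (norm_nonneg _) (norm_nonneg _) (toReal_pos' hp),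
    FinLp.norm_rpow hp, FinLp.norm_rpow hp]
  exact Finset.sum_le_sum fun i _ =>
    Real.rpow_le_rpow (abs_nonneg _) (h i) (toReal_pos' hp).le

/-- The space `ℓ^p(N)` as a Banach lattice. -/
noncomputable def finLpLat (p : ℝ≥0∞) [Fact (1 ≤ p)] (hp : p ≠ ∞) (N : ℕ) : BanachLat.{u} :=
  letI : HasSolidNorm (FinLp.{u} p N) := ⟨fun _ _ h => FinLp.norm_mono hp h⟩
  { carrier := FinLp.{u} p N }

theorem FinLp.coord_sum_smul {n : ℕ} (a : Fin n → ℝ) (x : Fin n → FinLp.{u} p N)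
    (i : ULift.{u} (Fin N)) : (∑ k, a k • x k).coord i = ∑ k, a k * (x k).coord i := by
  let c : FinLp.{u} p N →ₗ[ℝ] ℝ :=
    { toFun := fun y => y.coord i
      map_add' := fun _ _ => rfl
      map_smul' := fun _ _ => rfl }
  change c (∑ k, a k • x k) = _
  rw [map_sum]
  simp only [map_smul]
  rfl

theorem finLpLat_pConvex (hp : p ≠ ∞) (N : ℕ) : PConvexWith p 1 (finLpLat.{u} p hp N) := by
  intro n (x : Fin n → FinLp.{u} p N)
  refine ⟨(FinLp.mk fun i => ‖WithLp.toLp p fun k => (x k).coord i‖ : FinLp.{u} p N),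
    ⟨?_, ?_⟩, ?_⟩
  · rintro _ ⟨a, ha, rfl⟩ i
    exact (FinLp.coord_sum_smul a x i).trans_le (ha fun k => (x k).coord i)
  · intro s hs i
    obtain ⟨a, ha, hai⟩ := exists_dualBall_eq_norm (p := p) fun k => (x k).coord i
    have h1 := hs ⟨a, ha, rfl⟩ i
    exact (hai.symm.trans (FinLp.coord_sum_smul a x i).symm).trans_le h1
  · have hr := toReal_pos' hp
    change ‖(FinLp.mk fun i => ‖WithLp.toLp p fun k => (x k).coord i‖ : FinLp.{u} p N)‖ ≤
      1 * ‖WithLp.toLp p fun k => ‖(x k : FinLp.{u} p N)‖‖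
    rw [one_mul, ← Real.rpow_le_rpow_iff (norm_nonneg _) (norm_nonneg _) hr, FinLp.norm_rpow hp,
      norm_toLp_rpow hp]
    simp only [abs_norm, FinLp.norm_rpow hp]
    rw [Finset.sum_comm]
    refine Finset.sum_le_sum fun i _ => ?_
    change |‖WithLp.toLp p fun k => (x k).coord i‖| ^ p.toReal ≤ _
    rw [abs_norm, norm_toLp_rpow hp]

variable {E : Type u} [NormedAddCommGroup E] [NormedSpace ℝ E]

/-- The values of `f` at a finite family of functionals that defines a contraction into `ℓ^p(N)` are
controlled by the free `p`-convex norm. -/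
theorem norm_values_le_rho (hp : p ≠ ∞) {ℓ : Fin N → StrongDual ℝ E}
    (hℓ : ∀ x, ‖WithLp.toLp p fun i => ℓ i x‖ ≤ ‖x‖) (f : FVL p E) :
    ‖WithLp.toLp p fun i => f.1 (ℓ i)‖ ≤ rho f := by
  let S : FVL p E →ₗ[ℝ] finLpLat.{u} p hp N :=
    { toFun := fun f => (FinLp.mk fun i => f.1 (ℓ i.down) : FinLp.{u} p N)
      map_add' := fun _ _ => rfl
      map_smul' := fun _ _ => rfl }
  let T : E →ₗ[ℝ] finLpLat.{u} p hp N :=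
    { toFun := fun x => (FinLp.mk fun i => ℓ i.down x : FinLp.{u} p N)
      map_add' := fun x y => by simp only [map_add]; rfl
      map_smul' := fun c x => by simp only [map_smul]; rfl }
  have hS : IsContractiveExtension S := by
    refine ⟨finLpLat_pConvex hp N, fun f g => ⟨rfl, rfl⟩, T.mkContinuous 1 fun x => ?_,
      T.mkContinuous_norm_le zero_le_one _, fun x => rfl⟩
    rw [one_mul]
    exact (FinLp.norm_mk hp fun i => ℓ i x).trans_le (hℓ x)
  exact (FinLp.norm_mk.{u} hp fun i => f.1 (ℓ i)).ge.trans (le_rho f hS)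

theorem norm_values_le_mul_rho (hp : p ≠ ∞) {ℓ : Fin N → StrongDual ℝ E} {C : ℝ} (hC : 0 ≤ C)
    (hℓ : ∀ x, ‖WithLp.toLp p fun i => ℓ i x‖ ≤ C * ‖x‖) (f : FVL p E) :
    ‖WithLp.toLp p fun i => f.1 (ℓ i)‖ ≤ C * rho f := by
  have key : ∀ D : ℝ, C ≤ D → 0 < D → ‖WithLp.toLp p fun i => f.1 (ℓ i)‖ ≤ D * rho f := by
    intro D hCD hD
    have hs : ∀ t : Fin N → ℝ, ‖WithLp.toLp p fun i => D⁻¹ * t i‖ = D⁻¹ * ‖WithLp.toLp p t‖ :=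
      fun t => by
        have h1 : (WithLp.toLp p fun i => D⁻¹ * t i) = D⁻¹ • WithLp.toLp p t := rfl
        rw [h1, norm_smul, Real.norm_of_nonneg (inv_nonneg.2 hD.le)]
    have h1 := norm_values_le_rho hp (ℓ := fun i => D⁻¹ • ℓ i) (fun x => by
      simp only [FunLike.coe_smul, Pi.smul_apply, smul_eq_mul]
      rw [hs, inv_mul_le_iff₀ hD]
      exact (hℓ x).trans (mul_le_mul_of_nonneg_right hCD (norm_nonneg x))) f
    simp only [fvl_homogeneous f.2 (inv_nonneg.2 hD.le)] at h1
    rwa [hs, inv_mul_le_iff₀ hD] at h1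
  refine le_of_forall_pos_le_add fun δ hδ => ?_
  have hρ := rho_nonneg f
  refine (key (C + δ / (rho f + 1)) (le_add_of_nonneg_right (by positivity))
    (add_pos_of_nonneg_of_pos hC (by positivity))).trans ?_
  rw [add_mul]
  gcongr
  rw [div_mul_eq_mul_div, div_le_iff₀ (by positivity)]
  gcongr
  linarith

theorem rho_delta_le (x : E) : rho (delta p x) ≤ ‖x‖ :=
  rho_le (norm_nonneg x) fun X S hS => by
    obtain ⟨-, -, T, hT, hST⟩ := hS
    rw [hST]
    simpa using T.le_of_opNorm_le hT x

/-! ### The free `p`-convex Banach lattice is `p`-convex -/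

theorem isLatticeHom_coe {V : Type u} [NormedAddCommGroup V] [NormedSpace ℝ V] [Lattice V]
    [HasSolidNorm V] [IsOrderedAddMonoid V] :
    IsLatticeHom (UniformSpace.Completion.toComplL (𝕜 := ℝ) (E := V) :
      V →ₗ[ℝ] UniformSpace.Completion V) :=
  fun a b => ⟨coe_sup a b, coe_inf a b⟩

theorem norm_supList_fvl_le {n : ℕ} (x : Fin n → FVL p E) {A : List (Fin n → ℝ)}
    (hA : ∀ a ∈ A, DualBall p a) : ‖supList A x‖ ≤ ‖WithLp.toLp p fun k => ‖x k‖‖ := by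
  refine rho_le (norm_nonneg _) fun X S hS => ?_
  rw [hS.2.1.map_supList]
  refine (hS.1.norm_supList_le _ hA).trans ?_
  rw [one_mul]
  refine norm_toLp_mono fun k => ?_
  rw [abs_norm, abs_norm]
  exact le_rho (x k) hS

theorem fbl_pConvex : PConvexWith p 1 (FBL p E) := by
  refine pConvexWith_of_supList fun n x A hA => ?_
  rw [one_mul]
  have hd : DenseRange fun (y : Fin n → FVL p E) k => (y k : FBL p E) :=
    DenseRange.piMap fun _ => UniformSpace.Completion.denseRange_coe
  refine isClosed_property hd (p := fun x => ‖supList A x‖ ≤ ‖WithLp.toLp p fun k => ‖x k‖‖)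
    (isClosed_le (continuous_supList A).norm ((PiLp.continuous_toLp p _).comp
      (continuous_pi fun k => (continuous_apply k).norm)).norm) (fun y => ?_) x
  have h1 : supList A (fun k => (y k : FBL p E)) = ((supList A y : FVL p E) : FBL p E) :=
    (isLatticeHom_coe.map_supList A y).symm
  rw [h1]
  simp only [UniformSpace.Completion.norm_coe]
  exact norm_supList_fvl_le y hA

end FiniteLp

/-! ### Extending operators with the help of a lattice embedding -/

section OperatorExtension

variable {p : ℝ≥0∞} [Fact (1 ≤ p)] {E F : Type w} [NormedAddCommGroup E] [NormedSpace ℝ E]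
  [NormedAddCommGroup F] [NormedSpace ℝ F]

/-- The coordinate functionals of an operator into `ℓ^p`. -/
noncomputable def coordDual (T : F →L[ℝ] lp (fun _ : ℕ => ℝ) p) (n : ℕ) : StrongDual ℝ F :=
  lp.evalCLM ℝ (fun _ : ℕ => ℝ) p n ∘L T

theorem norm_coordDual_le (hp : p ≠ ∞) (T : F →L[ℝ] lp (fun _ : ℕ => ℝ) p) (N : ℕ) (x : F) :
    ‖WithLp.toLp p fun n : Fin N => coordDual T n x‖ ≤ ‖T‖ * ‖x‖ :=
  (norm_section_le hp (T x) N).trans (T.le_opNorm x)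

/-- Operators into `ℓ^p` extend to lattice homomorphisms on the free `p`-convex Banach lattice; only
their positivity on positive elements is recorded here. -/
theorem exists_fbl_extension (hp : p ≠ ∞) (T : F →L[ℝ] lp (fun _ : ℕ => ℝ) p) :
    ∃ U : FBL p F →L[ℝ] lp (fun _ : ℕ => ℝ) p, (∀ x, U (delta p x : FVL p F) = T x) ∧
      (∀ u, ‖U u‖ ≤ ‖T‖ * ‖u‖) ∧ ∀ u, 0 ≤ u → ∀ n, 0 ≤ U u n := by
  let V : ℕ → FVL p F →ₗ[ℝ] ℝ := fun n =>
    { toFun := fun f => f.1 (coordDual T n)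
      map_add' := fun _ _ => rfl
      map_smul' := fun _ _ => rfl }
  obtain ⟨U₀, hU₀, hU₀n⟩ := exists_operator_of_section_le (S := V) hp (norm_nonneg T)
    fun N f => norm_values_le_mul_rho hp (norm_nonneg T) (norm_coordDual_le hp T N) f
  have hd : DenseRange (UniformSpace.Completion.toComplL (𝕜 := ℝ) (E := FVL p F) :
      FVL p F →ₗ[ℝ] FBL p F) := UniformSpace.Completion.denseRange_coe
  have hb : ∀ f : FVL p F, ‖(U₀ : FVL p F →ₗ[ℝ] lp (fun _ : ℕ => ℝ) p) f‖ ≤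
      ‖T‖ * ‖(UniformSpace.Completion.toComplL (𝕜 := ℝ) (E := FVL p F) :
        FVL p F →ₗ[ℝ] FBL p F) f‖ := fun f => by
    have h1 : ‖(UniformSpace.Completion.toComplL (𝕜 := ℝ) (E := FVL p F) :
        FVL p F →ₗ[ℝ] FBL p F) f‖ = ‖f‖ := UniformSpace.Completion.norm_coe f
    rw [h1]
    exact U₀.le_of_opNorm_le hU₀n f
  let U := (U₀ : FVL p F →ₗ[ℝ] lp (fun _ : ℕ => ℝ) p).extendOfNorm
    (UniformSpace.Completion.toComplL (𝕜 := ℝ) (E := FVL p F) : FVL p F →ₗ[ℝ] FBL p F)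
  have hU : ∀ f : FVL p F, U (f : FBL p F) = U₀ f := fun f =>
    LinearMap.extendOfNorm_eq hd ⟨_, hb⟩ f
  refine ⟨U, fun x => ?_, fun u => LinearMap.norm_extendOfNorm_apply_le hd _ hb u,
    fun u hu n => ?_⟩
  · rw [hU]
    ext n
    rw [hU₀]
    rfl
  · have key : ∀ v : FBL p F, 0 ≤ lp.evalCLM ℝ (fun _ : ℕ => ℝ) p n (U |v|) := fun v =>
      UniformSpace.Completion.induction_on v
        (isClosed_le continuous_const ((lp.evalCLM ℝ (fun _ : ℕ => ℝ) p n).continuous.comp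
          (U.continuous.comp cont_abs))) fun f => by
        rw [← coe_abs, hU]
        have h1 : lp.evalCLM ℝ (fun _ : ℕ => ℝ) p n (U₀ |f|) = |f.1 (coordDual T n)| := hU₀ |f| n
        rw [h1]
        exact abs_nonneg _
    have h2 := key u
    rwa [abs_of_nonneg hu] at h2

theorem mapFBL_coe (ι : F →ₗᵢ[ℝ] E) (f : FVL p F) :
    mapFBL p ι (f : FBL p F) = (mapFVL p ι f : FVL p E) :=
  ContinuousLinearMap.completion_apply_coe _ f

/-- If the map between the free `p`-convex Banach lattices is a `c`-lattice embedding, then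
operators into `ℓ^p` extend with constant `c`: the lattice homomorphism that is induced by the
operator extends by the injectivity of `ℓ^p`. -/
theorem exists_operator_extension (hp : p ≠ ∞) (ι : F →ₗᵢ[ℝ] E) {c : ℝ}
    (hι : IsLatticeEmbedding c (mapFBL p ι)) (T : F →L[ℝ] lp (fun _ : ℕ => ℝ) p) :
    ∃ R : E →L[ℝ] lp (fun _ : ℕ => ℝ) p, R ∘L ι.toContinuousLinearMap = T ∧ ‖R‖ ≤ c * ‖T‖ := by
  obtain ⟨hc1, hlat, hnorm⟩ := hι
  have hc : 0 < c := zero_lt_one.trans_le hc1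
  obtain ⟨U, hUδ, hUn, hU0⟩ := exists_fbl_extension hp T
  have hle : ∀ u, ‖u‖ ≤ c * ‖mapFBL p ι u‖ := fun u => (inv_mul_le_iff₀ hc).1 (hnorm u).1
  have hanti : AntilipschitzWith (Real.toNNReal c) (mapFBL p ι) :=
    ContinuousLinearMap.antilipschitz_of_bound _ fun u => by
      rw [Real.coe_toNNReal _ hc.le]
      exact hle u
  have hinj : Function.Injective (mapFBL p ι) := hanti.injective
  have hY : IsUniformlyClosedSublattice
      (LinearMap.range (mapFBL p ι : FBL p F →ₗ[ℝ] FBL p E)) := by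
    refine isUniformlyClosedSublattice_of_isClosed ?_ ?_
    · rw [LinearMap.coe_range]
      exact hanti.isClosed_range (mapFBL p ι).uniformContinuous
    · rintro _ ⟨u, rfl⟩ _ ⟨v, rfl⟩
      exact ⟨u ⊔ v, (hlat u v).1⟩
  let e := LinearEquiv.ofInjective (mapFBL p ι : FBL p F →ₗ[ℝ] FBL p E) hinj
  have he : ∀ y, mapFBL p ι (e.symm y) = y := fun y => congrArg Subtype.val (e.apply_symm_apply y)
  let V : ℕ → LinearMap.range (mapFBL p ι : FBL p F →ₗ[ℝ] FBL p E) →ₗ[ℝ] ℝ := fun n =>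
    lp.evalₗ (fun _ : ℕ => ℝ) p n ∘ₗ (U : FBL p F →ₗ[ℝ] _) ∘ₗ e.symm.toLinearMap
  obtain ⟨S, -, hSV, hSn⟩ := (fbl_pConvex (p := p) (E := E)).exists_extension (T := V) hp
    zero_le_one (mul_nonneg hc.le (norm_nonneg T)) hY (fun n y hy => by
      have h1 : |e.symm y| = e.symm y := hinj (by
        have h2 := hlat.map_abs (e.symm y)
        rw [ContinuousLinearMap.coe_coe, he, abs_of_nonneg hy] at h2
        rw [h2, he])
      exact hU0 _ (h1 ▸ abs_nonneg (e.symm y)) n) fun N y => by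
      refine (norm_section_le hp (U (e.symm y)) N).trans ((hUn _).trans ?_)
      rw [mul_comm c, mul_assoc]
      have h1 := hle (e.symm y)
      rw [he] at h1
      exact mul_le_mul_of_nonneg_left h1 (norm_nonneg T)
  rw [mul_one] at hSn
  let δ : E →ₗ[ℝ] FBL p E :=
    { toFun := fun x => (delta p x : FVL p E)
      map_add' := fun x y => by
        rw [← UniformSpace.Completion.coe_add]
        congr 1
        exact Subtype.ext (funext fun ℓ => map_add ℓ x y)
      map_smul' := fun t x => by
        rw [RingHom.id_apply, ← UniformSpace.Completion.coe_smul]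
        congr 1
        exact Subtype.ext (funext fun ℓ => map_smul ℓ t x) }
  have hδ : ∀ x, ‖δ x‖ ≤ 1 * ‖x‖ := fun x => by
    rw [one_mul]
    exact (UniformSpace.Completion.norm_coe (delta p x)).trans_le (rho_delta_le x)
  refine ⟨S ∘L δ.mkContinuous 1 hδ, ?_, ?_⟩
  · ext x n
    have h1 : δ (ι x) = mapFBL p ι (delta p x : FVL p F) := (mapFBL_coe ι (delta p x)).symm
    have h2 := hSV (e (delta p x : FVL p F)) n
    change S (δ (ι x)) n = T x n
    rw [h1]
    refine h2.trans ?_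
    change U (e.symm (e (delta p x : FVL p F))) n = _
    rw [e.symm_apply_apply, hUδ]
  · refine (S.opNorm_comp_le _).trans ?_
    calc ‖S‖ * ‖δ.mkContinuous 1 hδ‖ ≤ ‖S‖ * 1 :=
          mul_le_mul_of_nonneg_left (δ.mkContinuous_norm_le zero_le_one hδ) (norm_nonneg S)
      _ ≤ c * ‖T‖ := by rwa [mul_one]

end OperatorExtension

/-! ### Lattice embeddings from extensions of operators -/

section LatticeEmbedding

variable {p : ℝ≥0∞} [Fact (1 ≤ p)] {E F : Type w} [NormedAddCommGroup E] [NormedSpace ℝ E]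
  [NormedAddCommGroup F] [NormedSpace ℝ F]

/-- Elements of the free vector lattice are Lipschitz functions of finitely many coordinates. The
functional `ℓ` on `F` is compared with the (only partially defined) functional `y ↦ G y ω` that a
lattice homomorphism `S` and a representation `Φ` induce. -/
theorem exists_lipschitz_representation {X : Type w} [NormedAddCommGroup X] [NormedSpace ℝ X]
    [Lattice X] [IsOrderedAddMonoid X] {S : FVL p F →ₗ[ℝ] X} (hS : IsLatticeHom S)
    {f : StrongDual ℝ F → ℝ} (hf : f ∈ fvl F) :
    ∃ (m : ℕ) (x : Fin m → F) (C : ℝ), 0 ≤ C ∧ ∀ (K : Type w) [TopologicalSpace K]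
      (Φ : C(K, ℝ) →ₗ[ℝ] X), IsLatticeHom Φ → ∀ G : F → C(K, ℝ),
      (∀ i, Φ (G (x i)) = S (delta p (x i))) →
      ∃ g, Φ g = S ⟨f, hf⟩ ∧ ∀ (ω : K) (ℓ : StrongDual ℝ F),
        |g ω - f ℓ| ≤ C * ∑ i, |G (x i) ω - ℓ (x i)| := by
  let Q : (f : StrongDual ℝ F → ℝ) → f ∈ fvl F → Prop := fun f hf =>
    ∃ (m : ℕ) (x : Fin m → F) (C : ℝ), 0 ≤ C ∧ ∀ (K : Type w) [TopologicalSpace K]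
      (Φ : C(K, ℝ) →ₗ[ℝ] X), IsLatticeHom Φ → ∀ G : F → C(K, ℝ),
      (∀ i, Φ (G (x i)) = S (delta p (x i))) →
      ∃ g, Φ g = S ⟨f, hf⟩ ∧ ∀ (ω : K) (ℓ : StrongDual ℝ F),
        |g ω - f ℓ| ≤ C * ∑ i, |G (x i) ω - ℓ (x i)|
  let V : Submodule ℝ (StrongDual ℝ F → ℝ) :=
    { carrier := {f | ∃ h : f ∈ fvl F, Q f h}
      add_mem' := by
        rintro f k ⟨hf, m, x, C, hC, H⟩ ⟨hk, n, y, D, hD, H'⟩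
        refine ⟨add_mem hf hk, m + n, Fin.append x y, C + D, add_nonneg hC hD,
          fun K _ Φ hΦ G hG => ?_⟩
        obtain ⟨g, hg, hgl⟩ := H K Φ hΦ G fun i => by simpa using hG (Fin.castAdd n i)
        obtain ⟨g', hg', hgl'⟩ := H' K Φ hΦ G fun i => by simpa using hG (Fin.natAdd m i)
        refine ⟨g + g', ?_, fun ω ℓ => ?_⟩
        · rw [map_add, hg, hg']
          exact (map_add S (⟨f, hf⟩ : FVL p F) ⟨k, hk⟩).symm
        · simp only [Fin.sum_univ_add, Fin.append_left, Fin.append_right]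
          have h1 := hgl ω ℓ
          have h2 := hgl' ω ℓ
          have h3 : 0 ≤ ∑ i, |G (x i) ω - ℓ (x i)| := Finset.sum_nonneg fun i _ => abs_nonneg _
          have h4 : 0 ≤ ∑ i, |G (y i) ω - ℓ (y i)| := Finset.sum_nonneg fun i _ => abs_nonneg _
          have h5 : (g + g') ω - (f + k) ℓ = (g ω - f ℓ) + (g' ω - k ℓ) := by
            rw [ContinuousMap.add_apply, Pi.add_apply]
            ring
          rw [h5]
          refine (abs_add_le _ _).trans ((add_le_add h1 h2).trans ?_)
          have h6 := mul_nonneg hC h4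
          have h7 := mul_nonneg hD h3
          linarith
      zero_mem' := ⟨zero_mem _, 0, Fin.elim0, 0, le_rfl, fun K _ Φ hΦ G hG => ⟨0, by
        rw [map_zero]
        exact (map_zero S).symm, fun ω ℓ => by simp⟩⟩
      smul_mem' := by
        rintro t f ⟨hf, m, x, C, hC, H⟩
        refine ⟨Submodule.smul_mem _ t hf, m, x, |t| * C, mul_nonneg (abs_nonneg t) hC,
          fun K _ Φ hΦ G hG => ?_⟩
        obtain ⟨g, hg, hgl⟩ := H K Φ hΦ G hG
        refine ⟨t • g, ?_, fun ω ℓ => ?_⟩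
        · rw [map_smul, hg]
          exact (map_smul S t (⟨f, hf⟩ : FVL p F)).symm
        · have h1 : (t • g) ω - (t • f) ℓ = t * (g ω - f ℓ) := by
            rw [ContinuousMap.smul_apply, Pi.smul_apply, smul_eq_mul, smul_eq_mul]
            ring
          rw [h1, abs_mul, mul_assoc]
          exact mul_le_mul_of_nonneg_left (hgl ω ℓ) (abs_nonneg t) }
  have hV : fvl F ≤ V := by
    refine fvl_le (fun y => ⟨delta_mem F y, 1, fun _ => y, 1, zero_le_one,
      fun K _ Φ hΦ G hG => ⟨G y, hG 0, fun ω ℓ => by simp⟩⟩) ?_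
    rintro f ⟨hf, m, x, C, hC, H⟩
    refine ⟨abs_mem hf, m, x, C, hC, fun K _ Φ hΦ G hG => ?_⟩
    obtain ⟨g, hg, hgl⟩ := H K Φ hΦ G hG
    refine ⟨|g|, ?_, fun ω ℓ => ?_⟩
    · rw [hΦ.map_abs, hg]
      exact (hS.map_abs (⟨f, hf⟩ : FVL p F)).symm
    · exact (abs_abs_sub_abs_le (g ω) (f ℓ)).trans (hgl ω ℓ)
  exact (hV hf).2

variable {X : Type w} [NormedAddCommGroup X] [NormedSpace ℝ X] [Lattice X]
  [IsOrderedAddMonoid X] [IsOrderedModule ℝ X] [HasSolidNorm X] [CompleteSpace X]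

/-- A norming functional for `g` on the `p`-concavification. -/
theorem exists_norming_functional (hp : p ≠ ∞) (hX : PConvexWith p 1 X) {K : Type v}
    [TopologicalSpace K] [CompactSpace K] {Φ : C(K, ℝ) →ₗ[ℝ] X} (hΦ : IsLatticeHom Φ)
    (g : C(K, ℝ)) :
    ∃ μ : C(K, ℝ) →ₗ[ℝ] ℝ, (∀ f, 0 ≤ f → 0 ≤ μ f) ∧
      (∀ h, μ (powFun p h) ≤ ‖Φ h‖ ^ p.toReal) ∧ ‖Φ g‖ ^ p.toReal ≤ μ (powFun p g) := by
  have hr := toReal_pos' hp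
  obtain ⟨μ, h1, h2, h3⟩ := hX.exists_functional hp (C := 1) zero_le_one zero_le_one hΦ
    (Submodule.span {c : ℝ // 0 ≤ c} {(powFun p g, ‖Φ g‖ ^ p.toReal)}) (by
      rintro d hd h hh hdh
      obtain ⟨⟨c, hc⟩, rfl⟩ := Submodule.mem_span_singleton.1 hd
      change c • powFun p g ≤ powFun p h at hdh
      change c * ‖Φ g‖ ^ p.toReal ≤ (1 * ‖Φ h‖) ^ p.toReal
      have hc' : 0 ≤ c ^ p.toReal⁻¹ := Real.rpow_nonneg hc _
      have hcp : (c ^ p.toReal⁻¹) ^ p.toReal = c := Real.rpow_inv_rpow hc hr.ne'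
      rw [one_mul, ← hcp, ← Real.mul_rpow hc' (norm_nonneg _)]
      refine Real.rpow_le_rpow (mul_nonneg hc' (norm_nonneg _)) ?_ hr.le
      rw [← Real.norm_of_nonneg hc', ← norm_smul, ← map_smul]
      refine norm_le_norm_of_abs_le_abs ?_
      rw [← hΦ.map_abs, abs_of_nonneg (hΦ.nonneg hh)]
      refine hΦ.mono ((powFun_le_iff hp hh (abs_nonneg _)).1 ?_)
      have h4 : powFun p |c ^ p.toReal⁻¹ • g| = c • powFun p g := by
        rw [← hcp, ← powFun_smul hc', hcp]
        ext ω
        change |(|(c ^ p.toReal⁻¹ • g) ω|)| ^ p.toReal = _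
        rw [abs_abs]
        rfl
      rwa [h4])
  refine ⟨μ, h1, fun h => ?_, h3 _ (Submodule.mem_span_singleton_self _)⟩
  simpa using h2 h

/-- Discretization: averages over the members of a partition of unity define a contraction into
`ℓ^p` on a whole `p`-convex Banach lattice. -/
theorem exists_discretization (hp : p ≠ ∞) (hX : PConvexWith p 1 X) {K : Type v}
    [TopologicalSpace K] [CompactSpace K] {Φ : C(K, ℝ) →ₗ[ℝ] X} (hΦ : IsLatticeHom Φ)
    (hinj : Function.Injective Φ) (hrange : LinearMap.range Φ = orderIdeal (Φ 1))
    {μ : C(K, ℝ) →ₗ[ℝ] ℝ} (hμ : ∀ f, 0 ≤ f → 0 ≤ μ f)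
    (hμΦ : ∀ h, μ (powFun p h) ≤ ‖Φ h‖ ^ p.toReal) {N : ℕ} {f : Fin N → C(K, ℝ)}
    (hf : ∀ i, 0 ≤ f i) (hf1 : ∑ i, f i = 1) :
    ∃ S : X →L[ℝ] lp (fun _ : ℕ => ℝ) p, ‖S‖ ≤ 1 ∧
      ∀ (i : Fin N) ζ, S (Φ ζ) i = μ (f i) ^ p.toReal⁻¹ * (μ (ζ * f i) / μ (f i)) := by
  have hr := toReal_pos' hp
  have hY : IsUniformlyClosedSublattice (LinearMap.range Φ) := by
    rw [hrange]
    exact orderIdeal_isUniformlyClosedSublattice _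
  let e := LinearEquiv.ofInjective Φ hinj
  have he : ∀ y, Φ (e.symm y) = y := fun y => congrArg Subtype.val (e.apply_symm_apply y)
  let avg : Fin N → C(K, ℝ) →ₗ[ℝ] ℝ := fun i =>
    { toFun := fun ζ => μ (f i) ^ p.toReal⁻¹ * (μ (ζ * f i) / μ (f i))
      map_add' := fun ζ ξ => by rw [add_mul, map_add]; ring
      map_smul' := fun t ζ => by
        rw [smul_mul_assoc, map_smul, RingHom.id_apply, smul_eq_mul, smul_eq_mul]; ring }
  let T : ℕ → LinearMap.range Φ →ₗ[ℝ] ℝ := fun n =>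
    if h : n < N then avg ⟨n, h⟩ ∘ₗ e.symm.toLinearMap else 0
  have hm : ∀ i, 0 ≤ μ (f i) := fun i => hμ _ (hf i)
  have hnorm : ∀ ζ : C(K, ℝ), ‖WithLp.toLp p fun i => avg i ζ‖ ≤ ‖Φ ζ‖ := fun ζ => by
    rw [← Real.rpow_le_rpow_iff (norm_nonneg _) (norm_nonneg _) hr, norm_toLp_rpow hp]
    have h1 := sum_average_rpow_le hμ hp hf hf1 (abs_nonneg ζ)
    have h2 : powFun p |ζ| = powFun p ζ := ContinuousMap.ext fun ω => by
      change |(|ζ ω|)| ^ p.toReal = |ζ ω| ^ p.toReal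
      rw [abs_abs]
    rw [h2] at h1
    refine le_trans (Finset.sum_le_sum fun i _ => ?_) (h1.trans (hμΦ ζ))
    have h3 : |μ (ζ * f i)| ≤ μ (|ζ| * f i) := by
      have h4 : 0 ≤ μ ((|ζ| - ζ) * f i) :=
        hμ _ (mul_nonneg (sub_nonneg.2 (le_abs_self ζ)) (hf i))
      have h5 : 0 ≤ μ ((|ζ| + ζ) * f i) := by
        refine hμ _ (mul_nonneg ?_ (hf i))
        have := neg_le_abs ζ
        rwa [neg_le_iff_add_nonneg] at this
      rw [sub_mul, map_sub] at h4
      rw [add_mul, map_add] at h5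
      exact abs_le.2 ⟨by linarith, by linarith⟩
    change |μ (f i) ^ p.toReal⁻¹ * (μ (ζ * f i) / μ (f i))| ^ p.toReal ≤ _
    rw [abs_mul, Real.mul_rpow (abs_nonneg _) (abs_nonneg _),
      abs_of_nonneg (Real.rpow_nonneg (hm i) _), Real.rpow_inv_rpow (hm i) hr.ne', mul_comm,
      abs_div, abs_of_nonneg (hm i)]
    refine mul_le_mul_of_nonneg_right (Real.rpow_le_rpow (by have := hm i; positivity) ?_ hr.le)
      (hm i)
    exact div_le_div_of_nonneg_right h3 (hm i)
  obtain ⟨S, -, hST, hSn⟩ := hX.exists_extension (T := T) hp zero_le_one zero_le_one hY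
    (fun n y hy => by
      by_cases h : n < N
      · simp only [T, h, dif_pos]
        have h1 : 0 ≤ e.symm y := hΦ.le_of_map_le hinj (by rw [map_zero, he]; exact hy)
        exact mul_nonneg (Real.rpow_nonneg (hm _) _)
          (div_nonneg (hμ _ (mul_nonneg h1 (hf _))) (hm _))
      · simp [T, h])
    fun m y => by
      have h1 : (fun n : Fin m => T n y) =
          fun n : Fin m => if h : (n : ℕ) < N then avg ⟨n, h⟩ (e.symm y) else 0 := by
        funext n
        by_cases h : (n : ℕ) < N <;> simp [T, h]
      rw [h1, one_mul]
      refine (norm_toLp_extend_le hp (fun i => avg i (e.symm y)) m).trans ?_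
      have := hnorm (e.symm y)
      rwa [he] at this
  refine ⟨S, by rwa [one_mul] at hSn, fun i ζ => ?_⟩
  have h1 := hST (e ζ) i
  have h2 : T i (e ζ) = avg i ζ := by simp [T]
  rw [h2] at h1
  exact h1

/-- The values of `f` at the coordinate functionals of operators into `ℓ^p` determine the free
`p`-convex norm. -/
theorem exists_operator_norm_le (hp : p ≠ ∞) (hX : PConvexWith p 1 X) {S : FVL p F →ₗ[ℝ] X}
    (hS : IsLatticeHom S) {T₀ : F →L[ℝ] X} (hT₀ : ‖T₀‖ ≤ 1) (hST : ∀ y, S (delta p y) = T₀ y)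
    (f : FVL p F) {ε : ℝ} (hε : 0 < ε) :
    ∃ (T : F →L[ℝ] lp (fun _ : ℕ => ℝ) p) (N : ℕ), ‖T‖ ≤ 1 ∧
      ‖S f‖ ≤ ‖WithLp.toLp p fun n : Fin N => f.1 (coordDual T n)‖ + ε := by
  classical
  have hr := toReal_pos' hp
  obtain ⟨m, x, C, hC, H⟩ := exists_lipschitz_representation hS f.2
  have he : 0 ≤ ∑ i, |S (delta p (x i))| := Finset.sum_nonneg fun i _ => abs_nonneg _
  obtain ⟨K, _, _, Φ, hΦ, hinj, hΦ1, hsurj⟩ := exists_continuousMap_representation he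
  have hrange : LinearMap.range Φ = orderIdeal (Φ 1) := by
    rw [hΦ1]
    refine le_antisymm ?_ fun z hz => hsurj z hz
    rintro _ ⟨g, rfl⟩
    refine ⟨‖g‖, ?_⟩
    rw [← hΦ.map_abs, ← hΦ1, ← map_smul]
    refine hΦ.mono fun ω => ?_
    change |g ω| ≤ ‖g‖ * 1
    rw [mul_one]
    exact g.norm_coe_le_norm ω
  let G : F → C(K, ℝ) := fun y =>
    if h : S (delta p y) ∈ orderIdeal (∑ i, |S (delta p (x i))|) then (hsurj _ h).choose else 0
  have hG : ∀ i, Φ (G (x i)) = S (delta p (x i)) := fun i => by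
    have h : S (delta p (x i)) ∈ orderIdeal (∑ i, |S (delta p (x i))|) := ⟨1, by
      rw [one_smul]
      exact Finset.single_le_sum (f := fun i => |S (delta p (x i))|) (fun i _ => abs_nonneg _)
        (Finset.mem_univ i)⟩
    simp only [G, h, dif_pos]
    exact (hsurj _ h).choose_spec
  obtain ⟨g, hgS, hgl⟩ := H K Φ hΦ G hG
  obtain ⟨μ, hμ, hμΦ, hμg⟩ := exists_norming_functional hp hX hΦ g
  rw [hgS] at hμg
  -- the oscillation that is allowed on the members of the partition
  have hμ1 : 0 ≤ μ 1 ^ p.toReal⁻¹ := Real.rpow_nonneg (hμ 1 zero_le_one) _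
  let η : ℝ := ε / (2 * C * m * μ 1 ^ p.toReal⁻¹ + 1)
  have hη : 0 < η := by positivity
  let ε' : ℝ := C * (m * (2 * η))
  have hε'0 : 0 ≤ ε' := by positivity
  have hε' : ε' * μ 1 ^ p.toReal⁻¹ ≤ ε := by
    have h1 : ε' * μ 1 ^ p.toReal⁻¹ = ε * (2 * C * m * μ 1 ^ p.toReal⁻¹) /
      (2 * C * m * μ 1 ^ p.toReal⁻¹ + 1) := by simp only [ε', η]; ring
    rw [h1, div_le_iff₀ (by positivity)]
    exact mul_le_mul_of_nonneg_left (by linarith) hε.le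
  have htop : IsUnitalSublattice (⊤ : Submodule ℝ C(K, ℝ)) :=
    ⟨trivial, fun _ _ _ _ => trivial, isClosed_univ⟩
  obtain ⟨N, φ, c, -, hφ, hφ1, hosc⟩ := htop.exists_partition (η := fun i => G (x i))
    (fun _ => trivial) hη
  obtain ⟨S', hS'n, hS'⟩ := exists_discretization hp hX hΦ hinj hrange hμ hμΦ hφ hφ1
  have hm : ∀ n, 0 ≤ μ (φ n) := fun n => hμ _ (hφ n)
  have hφω : ∀ n ω, 0 ≤ φ n ω := fun n ω => hφ n ω
  have hμmono : ∀ {g h : C(K, ℝ)}, g ≤ h → μ g ≤ μ h := fun {g h} hgh => by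
    have := hμ (h - g) (sub_nonneg.2 hgh)
    rw [map_sub] at this
    linarith
  refine ⟨S' ∘L T₀, N, ?_, ?_⟩
  · refine (S'.opNorm_comp_le T₀).trans ?_
    exact mul_le_one₀ hS'n (norm_nonneg _) hT₀
  set s : Fin N → ℝ := fun n => μ (φ n) ^ p.toReal⁻¹ with hs
  have hs0 : ∀ n, 0 ≤ s n := fun n => Real.rpow_nonneg (hm n) _
  have hsp : ∀ n, s n ^ p.toReal = μ (φ n) := fun n => Real.rpow_inv_rpow (hm n) hr.ne'
  let v : Fin N → ℝ := fun n => |f.1 (coordDual (S' ∘L T₀) n)|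
  have hv0 : ∀ n, 0 ≤ v n := fun n => abs_nonneg _
  have hcell : ∀ n, μ (powFun p g * φ n) ≤ (v n + ε' * s n) ^ p.toReal := fun n => by
    rcases (hm n).eq_or_lt with h0 | h0
    · have h1 : powFun p g * φ n ≤ ‖powFun p g‖ • φ n := fun ω =>
        mul_le_mul_of_nonneg_right ((le_abs_self _).trans ((powFun p g).norm_coe_le_norm ω))
          (hφω n ω)
      have h2 := hμmono h1
      rw [map_smul, ← h0, smul_zero] at h2
      exact h2.trans (Real.rpow_nonneg (add_nonneg (hv0 n) (mul_nonneg hε'0 (hs0 n))) _)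
    · have hsn : 0 < s n := Real.rpow_pos_of_pos h0 _
      -- the average over the member `φ n`, extended to a functional on `F`
      let ℓ : StrongDual ℝ F := (s n)⁻¹ • coordDual (S' ∘L T₀) n
      have hℓ : ∀ i, ℓ (x i) = μ (G (x i) * φ n) / μ (φ n) := fun i => by
        have h1 : ℓ (x i) = (s n)⁻¹ * S' (T₀ (x i)) n := rfl
        rw [h1, ← hST, ← hG, hS', inv_mul_cancel_left₀ hsn.ne']
      have havg : ∀ i, |μ (G (x i) * φ n) / μ (φ n) - c n i| ≤ η := fun i => by
        have h1 : |μ (G (x i) * φ n) - c n i * μ (φ n)| ≤ η * μ (φ n) := by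
          have h2 : (c n i - η) • φ n ≤ G (x i) * φ n := fun ω => by
            change (c n i - η) * φ n ω ≤ G (x i) ω * φ n ω
            rcases (hφω n ω).eq_or_lt with h | h
            · simp [← h]
            · have := (abs_le.1 (hosc n i ω h)).1
              exact mul_le_mul_of_nonneg_right (by linarith) h.le
          have h3 : G (x i) * φ n ≤ (c n i + η) • φ n := fun ω => by
            change G (x i) ω * φ n ω ≤ (c n i + η) * φ n ω
            rcases (hφω n ω).eq_or_lt with h | h
            · simp [← h]
            · have := (abs_le.1 (hosc n i ω h)).2
              exact mul_le_mul_of_nonneg_right (by linarith) h.le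
          have h4 := hμmono h2
          have h5 := hμmono h3
          rw [map_smul, smul_eq_mul] at h4 h5
          exact abs_le.2 ⟨by linarith, by linarith⟩
        have h2 : μ (G (x i) * φ n) / μ (φ n) - c n i =
            (μ (G (x i) * φ n) - c n i * μ (φ n)) / μ (φ n) := by
          field_simp
        rw [h2, abs_div, abs_of_pos h0, div_le_iff₀ h0]
        exact h1
      have hg : ∀ ω, 0 < φ n ω → |g ω| ≤ v n / s n + ε' := fun ω hω => by
        have h1 : |g ω - f.1 ℓ| ≤ ε' := by
          refine (hgl ω ℓ).trans (mul_le_mul_of_nonneg_left ?_ hC)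
          have h2 : ∀ i, |G (x i) ω - ℓ (x i)| ≤ 2 * η := fun i => by
            rw [hℓ]
            have h3 := abs_le.1 (hosc n i ω hω)
            have h4 := abs_le.1 (havg i)
            exact abs_le.2 ⟨by linarith [h3.1, h4.2], by linarith [h3.2, h4.1]⟩
          refine (Finset.sum_le_sum fun i _ => h2 i).trans (le_of_eq ?_)
          simp
        have h2 : |f.1 ℓ| = v n / s n := by
          rw [fvl_homogeneous f.2 (inv_nonneg.2 hsn.le), abs_mul, abs_of_pos (inv_pos.2 hsn),
            inv_mul_eq_div]
        rw [← h2]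
        have h3 := abs_sub_abs_le_abs_sub (g ω) (f.1 ℓ)
        linarith
      have h1 : powFun p g * φ n ≤ (v n / s n + ε') ^ p.toReal • φ n := fun ω => by
        change |g ω| ^ p.toReal * φ n ω ≤ (v n / s n + ε') ^ p.toReal * φ n ω
        rcases (hφω n ω).eq_or_lt with h | h
        · simp [← h]
        · exact mul_le_mul_of_nonneg_right (Real.rpow_le_rpow (abs_nonneg _) (hg ω h) hr.le) h.le
      refine (hμmono h1).trans (le_of_eq ?_)
      rw [map_smul, smul_eq_mul, ← hsp n,
        ← Real.mul_rpow (add_nonneg (div_nonneg (hv0 n) hsn.le) hε'0) hsn.le, add_mul,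
        div_mul_cancel₀ _ hsn.ne']
  have hsum : ‖S f‖ ^ p.toReal ≤ ‖WithLp.toLp p fun n => v n + ε' * s n‖ ^ p.toReal := by
    rw [norm_toLp_rpow hp]
    have h1 : μ (powFun p g) = ∑ n, μ (powFun p g * φ n) := by
      rw [← map_sum, ← Finset.mul_sum, hφ1, mul_one]
    rw [h1] at hμg
    refine hμg.trans (Finset.sum_le_sum fun n _ => ?_)
    rw [abs_of_nonneg (add_nonneg (hv0 n) (mul_nonneg hε'0 (hs0 n)))]
    exact hcell n
  have hs1 : ‖WithLp.toLp p s‖ = μ 1 ^ p.toReal⁻¹ := by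
    rw [← Real.rpow_rpow_inv (norm_nonneg (WithLp.toLp p s)) hr.ne', norm_toLp_rpow hp]
    congr 1
    rw [← hφ1, map_sum]
    exact Finset.sum_congr rfl fun n _ => by rw [abs_of_nonneg (hs0 n), hsp]
  calc ‖S f‖ ≤ ‖WithLp.toLp p fun n => v n + ε' * s n‖ :=
        (Real.rpow_le_rpow_iff (norm_nonneg _) (norm_nonneg _) hr).1 hsum
    _ = ‖WithLp.toLp p v + ε' • WithLp.toLp p s‖ := rfl
    _ ≤ ‖WithLp.toLp p v‖ + ‖ε' • WithLp.toLp p s‖ := norm_add_le _ _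
    _ ≤ ‖WithLp.toLp p fun n : Fin N => f.1 (coordDual (S' ∘L T₀) n)‖ + ε := by
        rw [norm_smul, Real.norm_of_nonneg hε'0, hs1]
        refine add_le_add (norm_toLp_mono fun n => ?_) hε'
        rw [abs_of_nonneg (hv0 n)]

/-- If operators into `ℓ^p` extend from `F` to `E` with constant `c`, then the free `p`-convex norms
compare with constant `c`. -/
theorem rho_le_mul_rho_mapFVL (hp : p ≠ ∞) (ι : F →ₗᵢ[ℝ] E) {c : ℝ} (hc : 1 ≤ c)
    (h : ∀ T : F →L[ℝ] lp (fun _ : ℕ => ℝ) p, ∃ R : E →L[ℝ] lp (fun _ : ℕ => ℝ) p,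
      R ∘L ι.toContinuousLinearMap = T ∧ ‖R‖ ≤ c * ‖T‖) (f : FVL p F) :
    rho f ≤ c * rho (mapFVL p ι f) := by
  have hc0 : 0 ≤ c := zero_le_one.trans hc
  refine rho_le (mul_nonneg hc0 (rho_nonneg _)) fun X S hS => ?_
  obtain ⟨hX, hlat, T₀, hT₀, hST⟩ := hS
  refine le_of_forall_pos_le_add fun ε hε => ?_
  obtain ⟨T, N, hT, hle⟩ := exists_operator_norm_le hp hX hlat hT₀ hST f hε
  obtain ⟨R, hRT, hRn⟩ := h T
  have hRc : ‖R‖ ≤ c := hRn.trans (mul_le_of_le_one_right hc0 hT)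
  refine hle.trans ?_
  gcongr
  have h1 : ∀ n, f.1 (coordDual T n) = (mapFVL p ι f).1 (coordDual R n) := fun n => by
    rw [← hRT]
    rfl
  simp only [h1]
  exact norm_values_le_mul_rho hp hc0 (fun x => (norm_coordDual_le hp R N x).trans
    (mul_le_mul_of_nonneg_right hRc (norm_nonneg x))) _

theorem isLatticeEmbedding_mapFBL (hp : p ≠ ∞) (ι : F →ₗᵢ[ℝ] E) {c : ℝ} (hc : 1 ≤ c)
    (h : ∀ T : F →L[ℝ] lp (fun _ : ℕ => ℝ) p, ∃ R : E →L[ℝ] lp (fun _ : ℕ => ℝ) p,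
      R ∘L ι.toContinuousLinearMap = T ∧ ‖R‖ ≤ c * ‖T‖) :
    IsLatticeEmbedding c (mapFBL p ι) := by
  have hcont := (mapFBL p ι).continuous
  refine ⟨hc, fun u v => UniformSpace.Completion.induction_on₂ u v ?_ fun f g => ?_, fun u =>
    UniformSpace.Completion.induction_on u ?_ fun f => ?_⟩
  · exact (isClosed_eq (hcont.comp (cont_sup continuous_fst continuous_snd))
      (cont_sup (hcont.comp continuous_fst) (hcont.comp continuous_snd))).inter
      (isClosed_eq (hcont.comp (cont_inf continuous_fst continuous_snd))
      (cont_inf (hcont.comp continuous_fst) (hcont.comp continuous_snd)))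
  · rw [← coe_sup, ← coe_inf, ContinuousLinearMap.coe_coe, mapFBL_coe, mapFBL_coe, mapFBL_coe,
      mapFBL_coe, ← coe_sup, ← coe_inf]
    exact ⟨rfl, rfl⟩
  · exact (isClosed_le (continuous_const.mul continuous_norm) hcont.norm).inter
      (isClosed_le hcont.norm continuous_norm)
  · rw [mapFBL_coe, UniformSpace.Completion.norm_coe, UniformSpace.Completion.norm_coe,
      inv_mul_le_iff₀ (zero_lt_one.trans_le hc)]
    exact ⟨rho_le_mul_rho_mapFVL hp ι hc h f, rho_mapFVL_le ι f⟩

end LatticeEmbedding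

end PConvexFree

theorem theorem5p9 (p : ℝ≥0∞) [Fact (1 ≤ p)] (hp : p ≠ ∞) :
    -- In a `p`-convex Banach lattice, a disjoint positive sequence that is equivalent to the
    -- `ℓ^p` basis spans a closed subspace which is the range of a positive projection.
    (∀ (X : PConvexFree.BanachLat.{u}), PConvexFree.PConvex p X →
      ∀ x : ℕ → X, PConvexFree.IsPositiveDisjoint x → PConvexFree.IsEquivLpBasis p x →
        ∃ P : X →L[ℝ] X, (∀ y : X, 0 ≤ y → 0 ≤ P y) ∧ P ∘L P = P ∧
          P.range = (Submodule.span ℝ (Set.range x)).topologicalClosure) ∧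
    -- `ℓ^p` is injective in the class of Banach lattices with `p`-convexity constant one.
    (∀ (Z : PConvexFree.BanachLat.{v}), PConvexFree.PConvexWith p 1 Z →
      ∀ Y : Submodule ℝ Z, IsClosed (Y : Set Z) → (∀ y ∈ Y, ∀ z ∈ Y, y ⊔ z ∈ Y ∧ y ⊓ z ∈ Y) →
        ∀ T : Y →L[ℝ] lp (fun _ : ℕ => ℝ) p, (∀ y : Y, 0 ≤ (y : Z) → ∀ n, 0 ≤ T y n) →
          ∃ S : Z →L[ℝ] lp (fun _ : ℕ => ℝ) p, (∀ z : Z, 0 ≤ z → ∀ n, 0 ≤ S z n) ∧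
            (∀ y : Y, S y = T y) ∧ ‖S‖ = ‖T‖) ∧
    -- The subspace problem for the free `p`-convex Banach lattice, with constants.
    (∀ (E F : Type w) [NormedAddCommGroup E] [NormedSpace ℝ E] [CompleteSpace E]
      [NormedAddCommGroup F] [NormedSpace ℝ F] [CompleteSpace F] (ι : F →ₗᵢ[ℝ] E) (c : ℝ),
      1 ≤ c →
      (PConvexFree.IsLatticeEmbedding c (PConvexFree.mapFBL p ι) →
        ∀ T : F →L[ℝ] lp (fun _ : ℕ => ℝ) p, ∃ R : E →L[ℝ] lp (fun _ : ℕ => ℝ) p,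
          R ∘L ι.toContinuousLinearMap = T ∧
            ‖R‖ ≤ (2 : ℝ) ^ (p.toReal - 1 / p.toReal) * c * ‖T‖) ∧
      ((∀ T : F →L[ℝ] lp (fun _ : ℕ => ℝ) p, ∃ R : E →L[ℝ] lp (fun _ : ℕ => ℝ) p,
          R ∘L ι.toContinuousLinearMap = T ∧ ‖R‖ ≤ c * ‖T‖) →
        PConvexFree.IsLatticeEmbedding c (PConvexFree.mapFBL p ι))) := by
  refine ⟨fun X hX x hx hxp => PConvexFree.exists_positive_projection hp hX hx hxp,
    fun Z hZ Y hYc hYl T hT => hZ.exists_extension_norm_eq hp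
      (PConvexFree.isUniformlyClosedSublattice_of_isClosed hYc fun y hy z hz => (hYl y hy z hz).1)
      T hT,
    fun E F _ _ _ _ _ _ ι c hc => ⟨fun h T => ?_, PConvexFree.isLatticeEmbedding_mapFBL hp ι hc⟩⟩
  obtain ⟨R, hR, hRn⟩ := PConvexFree.exists_operator_extension hp ι h T
  refine ⟨R, hR, hRn.trans ?_⟩
  have h1 := PConvexFree.one_le_toReal hp
  have h2 : (1 : ℝ) ≤ 2 ^ (p.toReal - 1 / p.toReal) :=
    Real.one_le_rpow one_le_two (sub_nonneg.2
      (((div_le_one (zero_lt_one.trans_le h1)).2 h1).trans h1))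
  rw [mul_assoc]
  exact le_mul_of_one_le_left (mul_nonneg (zero_le_one.trans hc) (norm_nonneg T)) h2
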